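/- Let $L,T,\varepsilon>0$, $m_0\ge 0$, and $\Omega=[0,L]^2$ with periodic boundary conditions. Consider the Swift–Hohenberg equation $$\partial_t u=-(\Delta+1)^2u-f(u)\quad\text{in }\Omega\times(0,T),\qquad f(u)=u^3-\varepsilon u ,$$ and let $u_e$ be a (distributional in space) solution that is continuous on $[0,T]$ with values in $C^0(\Omega)$ and satisfies $$u_e\in H^3(0,T;C^0)\cap H^2(0,T;H^{m_0})\cap L^\infty(0,T;H^{m_0+4}),$$ where $C^0$ and $H^s$ are the spaces of continuous, respectively Sobolev, $\Omega$-periodic real functions. **Discretization.** For $N=2K+1$ ($K\ge0$ an integer) put $h=L/N$, and use the grid points $(x_p,y_q)=(ph,qh)$, $0\le p,q<N$. For real grid functions let $\langle f,g\rangle=h^2\sum_{p,q}f_{p,q}g_{p,q}$, $\|f\|_2=\langle f,f\rangle^{1/2}$ and $\|f\|_\infty=\max_{p,q}|f_{p,q}|$. Let $\hat f_{\ell,m}$, $|\ell|,|m|\le K$, be the discrete Fourier coefficients, $f_{p,q}=\sum_{\ell,m=-K}^K\hat f_{\ell,m}e^{2\pi i(\ell x_p+my_q)/L}$; let $\Delta_N$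 be the Fourier multiplier with symbol $-\lambda_{\ell,m}$, $\lambda_{\ell,m}=\frac{4\pi^2}{L^2}(\ell^2+m^2)$, and $$E_N(u)=\tfrac12\|(\Delta_N+I)u\|_2^2+\langle\tfrac14u^4-\tfrac\varepsilon2u^2,1\rangle .$$ For $\kappa>0$ put $L_\kappa=(\Delta_N+I)^2+\kappa I$, which has the symbol $(\lambda_{\ell,m}-1)^2+\kappa$; $N_\kappa(u)=\kappa u-f(u)$; $\varphi_0(z)=e^{-z}$, $\varphi_1(z)=(1-e^{-z})/z$. For a positive integer $N_t$ put $\tau=T/N_t$ and $t^n=n\tau$. The ERK(2,2) solution is defined by $$u_{n,1}=\varphi_0(\tfrac\tau2L_\kappa)u^n+\tfrac\tau2\varphi_1(\tfrac\tau2L_\kappa)N_\kappa(u^n),\qquad u^{n+1}=\varphi_0(\tau L_\kappa)u^n+\tau\varphi_1(\tau L_\kappa)N_\kappa(u_{n,1}),$$ where $u^0$ consists of the grid values of the Fourier projection of $u_e(\cdot,0)$ onto the trigonometric polynomials of degree at most $K$ in each variable. **Choice of $\kappa$.** Let $\hat C$ be any constant for which $\|f\|_\infty\le\hat C(\|f\|_2+\|\Delta_Nf\|_2)$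 holds for all grid functions $f$ and all $N=2K+1$. On each grid take $$\kappa=\max\Big\{\tfrac12\big|3\tilde C_2^2-\varepsilon\big|,\,1\Big\},\qquad \tilde C_2=2\sqrt3\,\hat C\,C_0,\qquad C_0=2\sqrt{\max\{C_e+L^2,\,0\}},\qquad C_e=E_N(u^0).$$ **Theorem 4.1.** There are constants $C,\tau_0,h_0>0$ (which may depend on $L,T,\varepsilon,m_0,u_e$ and, through the choice of $\kappa$, on $\hat C$, but not on $\tau$ or $h$) such that, whenever $\tau\le\tau_0$ and $h\le h_0$, $$\|u_e(t^n)-u^n\|_2\le C(\tau^2+h^{m_0})\qquad\text{for all }0\le n\le N_t,$$ where $u_e(t^n)$ stands for its grid values. -/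

import Mathlib

open MeasureTheory Set

namespace SwiftHohenberg

/-! ### Continuous level: the periodic square `[0, L]²` -/

/-- `Ω = [0, L]²` with periodic boundary conditions. -/
abbrev Torus (L : ℝ) : Type := AddCircle L × AddCircle L

/-- The character `e^{2πi(ℓx + my)/L}`, for `k = (ℓ, m)`. -/
noncomputable def wave (L : ℝ) (k : ℤ × ℤ) (x y : ℝ) : ℂ :=
  Complex.exp (2 * Real.pi * Complex.I * (k.1 * x + k.2 * y) / L)

/-- `λ_{ℓ,m} = (4π²/L²)(ℓ² + m²)`, the eigenvalues of `-Δ`. -/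
noncomputable def lam (L : ℝ) (k : ℤ × ℤ) : ℝ :=
  4 * Real.pi ^ 2 / L ^ 2 * ((k.1 : ℝ) ^ 2 + (k.2 : ℝ) ^ 2)

/-- Fourier coefficient `L⁻² ∫_Ω f e^{-2πi(ℓx + my)/L}` of a continuous periodic function. -/
noncomputable def torusCoeff (L : ℝ) (f : C(Torus L, ℝ)) (k : ℤ × ℤ) : ℂ :=
  1 / (L : ℂ) ^ 2 * ∫ x in (0 : ℝ)..L, ∫ y in (0 : ℝ)..L,
    (f ((x : AddCircle L), (y : AddCircle L)) : ℂ) * wave L (-k) x y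

/-- The Hilbert space `ℓ²(ℤ²)`. -/
abbrev SeqSpace : Type := lp (fun _ : ℤ × ℤ => ℂ) 2

/-- The (time-dependent) sequence of weighted Fourier coefficients `(1 + λ_k)^{s/2} û_k(t)`
is given by `v` for almost every `t ∈ (0, T)`. The periodic Sobolev space `H^s(Ω)` consists of the
functions whose weighted sequence lies in `ℓ²`, and its norm is the `ℓ²` norm of that sequence, so
`v` is the function `u`, seen as a function of time with values in `H^s(Ω)`. -/
def RepresentsInHs (L T s : ℝ) (u : ℝ → C(Torus L, ℝ)) (v : ℝ → SeqSpace) : Prop :=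
  ∀ᵐ t ∂(volume.restrict (Ioo 0 T)), ∀ k : ℤ × ℤ,
    (v t) k = (((1 + lam L k) ^ (s / 2) : ℝ) : ℂ) * torusCoeff L (u t) k

/-- The Bochner–Sobolev space `H^k(0, T; X)` of a Banach space `X`: `u` and its weak time derivatives
`g 1, …, g k` lie in `L²(0, T; X)`. -/
def MemBochnerSobolev {X : Type*} [NormedAddCommGroup X] [NormedSpace ℝ X]
    (k : ℕ) (T : ℝ) (u : ℝ → X) : Prop :=
  ∃ g : ℕ → ℝ → X, g 0 = u ∧
    (∀ j ≤ k, MemLp (g j) 2 (volume.restrict (Ioo 0 T))) ∧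
    ∀ j < k, ∀ φ : ℝ → ℝ, ContDiff ℝ ((⊤ : ℕ∞) : WithTop ℕ∞) φ → HasCompactSupport φ →
      tsupport φ ⊆ Ioo 0 T →
      ∫ t in Ioo 0 T, deriv φ t • g j t = - ∫ t in Ioo 0 T, φ t • g (j + 1) t

/-- `u ∈ H^k(0, T; H^s(Ω))`. -/
def MemHkHs (L T : ℝ) (k : ℕ) (s : ℝ) (u : ℝ → C(Torus L, ℝ)) : Prop :=
  ∃ v : ℝ → SeqSpace, RepresentsInHs L T s u v ∧ MemBochnerSobolev k T v

/-- `u ∈ L^∞(0, T; H^s(Ω))`. -/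
def MemLinftyHs (L T s : ℝ) (u : ℝ → C(Torus L, ℝ)) : Prop :=
  ∃ v : ℝ → SeqSpace, RepresentsInHs L T s u v ∧ MemLp v ⊤ (volume.restrict (Ioo 0 T))

/-- The regularity class `H³(0,T;C⁰) ∩ H²(0,T;H^{m₀}) ∩ L^∞(0,T;H^{m₀+4})`. -/
def RegularityClass (L T m₀ : ℝ) [Fact (0 < L)] (u : ℝ → C(Torus L, ℝ)) : Prop :=
  MemBochnerSobolev 3 T u ∧ MemHkHs L T 2 m₀ u ∧ MemLinftyHs L T (m₀ + 4) u

/-- The nonlinearity `f(u) = u³ - εu`. -/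
def nonlin (ε a : ℝ) : ℝ := a ^ 3 - ε * a

/-- The classical Laplacian of a function of two variables. -/
noncomputable def laplacian (ψ : ℝ → ℝ → ℝ) (x y : ℝ) : ℝ :=
  iteratedDeriv 2 (fun a => ψ a y) x + iteratedDeriv 2 (fun b => ψ x b) y

/-- The operator `Δ + 1`. -/
noncomputable def laplacianAddOne (ψ : ℝ → ℝ → ℝ) (x y : ℝ) : ℝ :=
  laplacian ψ x y + ψ x y

/-- `∫_Ω w ψ`. -/
noncomputable def pairing (L : ℝ) (w ψ : ℝ → ℝ → ℝ) : ℝ :=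
  ∫ x in (0 : ℝ)..L, ∫ y in (0 : ℝ)..L, w x y * ψ x y

/-- `u` solves `∂ₜu = -(Δ + 1)²u - f(u)` on `Ω × (0, T)`, the space derivatives being taken in the
sense of distributions: they are moved to smooth `Ω`-periodic test functions. -/
def IsSolution (L T ε : ℝ) (u : ℝ → C(Torus L, ℝ)) : Prop :=
  ∀ ψ : ℝ → ℝ → ℝ, ContDiff ℝ ((⊤ : ℕ∞) : WithTop ℕ∞) (fun z : ℝ × ℝ => ψ z.1 z.2) →
    (∀ x y, ψ (x + L) y = ψ x y) → (∀ x y, ψ x (y + L) = ψ x y) →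
    ∀ t ∈ Ioo 0 T,
      HasDerivAt (fun s => pairing L (fun x y => u s ((x : AddCircle L), (y : AddCircle L))) ψ)
        (- pairing L (fun x y => u t ((x : AddCircle L), (y : AddCircle L)))
              (laplacianAddOne (laplacianAddOne ψ))
          - pairing L (fun x y => nonlin ε (u t ((x : AddCircle L), (y : AddCircle L)))) ψ) t

/-! ### Discrete level: `N = 2K + 1` points in each direction -/

/-- Periodic grid functions on the `N × N` mesh, `N = 2K + 1`. -/
abbrev Grid (K : ℕ) : Type := Fin (2 * K + 1) × Fin (2 * K + 1) → ℝ

/-- The mesh size `h = L / N`. -/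
noncomputable def meshSize (L : ℝ) (K : ℕ) : ℝ := L / (2 * K + 1)

/-- The frequencies `-K ≤ ℓ, m ≤ K`. -/
noncomputable def freqs (K : ℕ) : Finset (ℤ × ℤ) := Finset.Icc (-(K : ℤ)) K ×ˢ Finset.Icc (-(K : ℤ)) K

/-- `e^{2πi(ℓx_p + my_q)/L}` at the grid point `(x_p, y_q) = (ph, qh)`. -/
noncomputable def gridWave (L : ℝ) (K : ℕ) (k : ℤ × ℤ)
    (p : Fin (2 * K + 1) × Fin (2 * K + 1)) : ℂ :=
  wave L k ((p.1 : ℕ) * meshSize L K) ((p.2 : ℕ) * meshSize L K)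

/-- The discrete inner product `⟨f, g⟩ = h² ∑ f g`. -/
noncomputable def gridInner (L : ℝ) (K : ℕ) (f g : Grid K) : ℝ :=
  meshSize L K ^ 2 * ∑ p, f p * g p

/-- The discrete `ℓ²` norm. -/
noncomputable def gridNorm (L : ℝ) (K : ℕ) (f : Grid K) : ℝ := Real.sqrt (gridInner L K f f)

/-- Discrete Fourier coefficients. -/
noncomputable def gridCoeff (L : ℝ) (K : ℕ) (f : Grid K) (k : ℤ × ℤ) : ℂ :=
  1 / (2 * K + 1 : ℂ) ^ 2 * ∑ p, (f p : ℂ) * gridWave L K (-k) p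

/-- The grid values of `∑_{-K ≤ ℓ, m ≤ K} c_{ℓ,m} e^{2πi(ℓx + my)/L}`. The sum is real whenever
`c_{-ℓ,-m}` is the conjugate of `c_{ℓ,m}`, as it is in every use below. -/
noncomputable def synthesize (L : ℝ) (K : ℕ) (c : ℤ × ℤ → ℂ) : Grid K :=
  fun p => (∑ k ∈ freqs K, c k * gridWave L K k p).re

/-- The Fourier multiplier `f ↦ ∑ σ_{ℓ,m} f̂_{ℓ,m} e^{2πi(ℓx + my)/L}` on grid functions. -/
noncomputable def multiplier (L : ℝ) (K : ℕ) (σ : ℤ × ℤ → ℝ) (f : Grid K) : Grid K :=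
  synthesize L K (fun k => (σ k : ℂ) * gridCoeff L K f k)

/-- The discrete Laplacian `Δ_N`. -/
noncomputable def gridLaplacian (L : ℝ) (K : ℕ) (f : Grid K) : Grid K :=
  multiplier L K (fun k => - lam L k) f

/-- The discrete energy `E_N(u) = ½‖(Δ_N + I)u‖₂² + ⟨¼u⁴ - (ε/2)u², 1⟩`. -/
noncomputable def gridEnergy (L ε : ℝ) (K : ℕ) (f : Grid K) : ℝ :=
  1 / 2 * gridNorm L K (gridLaplacian L K f + f) ^ 2
    + gridInner L K (fun p => 1 / 4 * f p ^ 4 - ε / 2 * f p ^ 2) 1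

/-- `φ₁(z) = (1 - e^{-z}) / z`, `φ₁(0) = 1`. -/
noncomputable def phi1 (z : ℝ) : ℝ := if z = 0 then 1 else (1 - Real.exp (-z)) / z

/-- The eigenvalues `Λ_{ℓ,m} = (-1 + λ_{ℓ,m})² + κ` of `L_κ = (Δ_N + I)² + κI`. -/
noncomputable def Lam (L κ : ℝ) (k : ℤ × ℤ) : ℝ := (-1 + lam L k) ^ 2 + κ

/-- The operator `φ₀(sL_κ) = e^{-sL_κ}`. -/
noncomputable def phi0Op (L κ : ℝ) (K : ℕ) (s : ℝ) (f : Grid K) : Grid K :=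
  multiplier L K (fun k => Real.exp (-(s * Lam L κ k))) f

/-- The operator `φ₁(sL_κ)`. -/
noncomputable def phi1Op (L κ : ℝ) (K : ℕ) (s : ℝ) (f : Grid K) : Grid K :=
  multiplier L K (fun k => phi1 (s * Lam L κ k)) f

/-- `N_κ(u) = κu - f(u)`, pointwise. -/
def nonlinK (ε κ : ℝ) {K : ℕ} (f : Grid K) : Grid K := fun p => κ * f p - nonlin ε (f p)

/-- The internal stage `u_{n,1} = φ₀(½τL_κ)uⁿ + (τ/2)φ₁(½τL_κ)N_κ(uⁿ)`. -/
noncomputable def erkStage (L ε κ τ : ℝ) (K : ℕ) (f : Grid K) : Grid K :=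
  phi0Op L κ K (τ / 2) f + (τ / 2) • phi1Op L κ K (τ / 2) (nonlinK ε κ f)

/-- One step `uⁿ⁺¹ = φ₀(τL_κ)uⁿ + τφ₁(τL_κ)N_κ(u_{n,1})` of ERK(2,2). -/
noncomputable def erkStep (L ε κ τ : ℝ) (K : ℕ) (f : Grid K) : Grid K :=
  phi0Op L κ K τ f + τ • phi1Op L κ K τ (nonlinK ε κ (erkStage L ε κ τ K f))

/-- The ERK(2,2) solution `uⁿ` started from `u⁰`. -/
noncomputable def erkSol (L ε κ τ : ℝ) (K : ℕ) (u0 : Grid K) : ℕ → Grid K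
  | 0 => u0
  | n + 1 => erkStep L ε κ τ K (erkSol L ε κ τ K u0 n)

/-- The grid values of a continuous periodic function. -/
noncomputable def restrictToGrid (L : ℝ) (K : ℕ) (f : C(Torus L, ℝ)) : Grid K :=
  fun p => f ((((p.1 : ℕ) * meshSize L K : ℝ) : AddCircle L),
    (((p.2 : ℕ) * meshSize L K : ℝ) : AddCircle L))

/-- The grid values of the Fourier projection of `f` onto the trigonometric polynomials of degree
at most `K`. -/
noncomputable def projectToGrid (L : ℝ) (K : ℕ) (f : C(Torus L, ℝ)) : Grid K :=
  synthesize L K (torusCoeff L f)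

/-- `Ĉ` is an admissible constant for the discrete Sobolev inequality
`‖f‖_∞ ≤ Ĉ (‖f‖₂ + ‖Δ_N f‖₂)`, uniformly in the grid. -/
def IsDiscreteSobolevConst (L Chat : ℝ) : Prop :=
  ∀ (K : ℕ) (f : Grid K) (p : Fin (2 * K + 1) × Fin (2 * K + 1)),
    |f p| ≤ Chat * (gridNorm L K f + gridNorm L K (gridLaplacian L K f))

/-- `C̃₂ = 2√3 Ĉ C₀` with `C₀ = 2√(C_e + |Ω|)`, `C_e = E_N(u⁰)`. -/
noncomputable def supBound (L ε Chat : ℝ) (K : ℕ) (u0 : Grid K) : ℝ :=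
  2 * Real.sqrt 3 * Chat * (2 * Real.sqrt (gridEnergy L ε K u0 + L ^ 2))

/-- The stabilization parameter `κ = max {|3C̃₂² - ε| / 2, 1}`. -/
noncomputable def kappa (L ε Chat : ℝ) (K : ℕ) (u0 : Grid K) : ℝ :=
  max (|3 * supBound L ε Chat K u0 ^ 2 - ε| / 2) 1

end SwiftHohenberg

/-! Mode by mode, the exact solution satisfies `v' = -Λv + g`, where `g` is a Fourier coefficient of
`N_κ(u)`, and one exponential Euler step solves the same equation with the source frozen
(`expStep`). The error inside a time step therefore solves a damped linear ODE forced by the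
mismatch of the two sources. It is measured by `kappaSq`, whose weights are the damping rates `Λ`.
In that norm Young's inequality lets the damping absorb the forcing, so a step adds at most `τ`
times the squared `ℓ²` norm of the forcing, with no growth factor (`sum_weighted_norm_sq_le`).

Second order in time comes from the midpoint `m = tⁿ + τ/2`. The exact source is `N(m) + (t -
m)N'(m) + O(τ²)`, and the linear term has mean zero over the step. Subtracting from the error the
corrector `σ(σ-τ)/2 · N'(m)`, with `σ = t - tⁿ`, which vanishes at both ends of the step, replaces
that term by `Λσ(τ-σ)/2 · N'(m)`. This is `O(τ²)` once `N'(m)` is bounded in `H⁴`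
(`ExactData.kappaSq_step_sub_le`). The `H⁴` bound comes from the time-differentiated equation:
`(Δ+1)²∂ₜu = -∂ₜ²u - f'(u)∂ₜu` is bounded in `C⁰` (`exists_exactData`), and `H⁴` is an algebra
(`SobBound.conv`). The internal stage only has to be accurate to `O(τ²)`, which a first-order
estimate provides (`ExactData.sum_norm_stage_sub_le`).

In space, `H^{m₀+4}` regularity makes the `ℓ¹` tail of the Fourier coefficients `O(h^{m₀+2})`; this
controls projection and aliasing errors in the maximum norm (`SobBound.sum_norm_tail_le`).

The nonlinearity is only locally Lipschitz, and this is handled by a bootstrap rather than by energy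
decay of the scheme. While the squared error `E_n` is at most one, the discrete Sobolev inequality
bounds `uⁿ` and its stage uniformly in the grid, so that `E_{n+1} ≤ E_n + τC(E_n + ρ²)` with `ρ = τ²
+ h^{m₀+2}` (`ExactData.exists_step_bound`). Gronwall's inequality then keeps `E_n` below one when
`τ` and `h` are small (`discrete_gronwall`). The parameter `κ` enters only through `1 ≤ κ ≤ κb`,
with `κb` independent of the grid (`exists_kappa_bound`). -/

namespace SwiftHohenberg

/-! ### Fourier coefficients on the torus of side `L`, by transport from the unit torus. -/

section TorusFourier

-- The `UnitAddTorus` Fourier theory uses the Haar probability measure; these instances make it the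
-- `volume` of the circle here too.
noncomputable local instance : MeasureSpace UnitAddCircle := ⟨AddCircle.haarAddCircle⟩

local instance : IsProbabilityMeasure (volume : Measure UnitAddCircle) :=
  inferInstanceAs (IsProbabilityMeasure AddCircle.haarAddCircle)

local instance : Measure.IsAddHaarMeasure (volume : Measure UnitAddCircle) :=
  inferInstanceAs (Measure.IsAddHaarMeasure AddCircle.haarAddCircle)

variable {L : ℝ} [hL : Fact (0 < L)]

/-- A continuous function on `(ℝ / Lℤ)²`, as a complex function on the unit torus. -/
noncomputable def unitLift (f : C(Torus L, ℝ)) : C(UnitAddTorus (Fin 2), ℂ) where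
  toFun x := (f (AddCircle.homeomorphAddCircle 1 L one_ne_zero hL.out.ne' (x 0),
    AddCircle.homeomorphAddCircle 1 L one_ne_zero hL.out.ne' (x 1)) : ℂ)
  continuous_toFun := by fun_prop

/-- Frequencies as functions on `Fin 2`. -/
def freqEquiv : ℤ × ℤ ≃ (Fin 2 → ℤ) := (finTwoArrowEquiv ℤ).symm

lemma mFourier_freqEquiv (k : ℤ × ℤ) (x y : ℝ) :
    UnitAddTorus.mFourier (freqEquiv k) ![(x : UnitAddCircle), (y : UnitAddCircle)]
      = wave L k (L * x) (L * y) := by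
  have hL0 : (L : ℂ) ≠ 0 := by exact_mod_cast hL.out.ne'
  simp only [UnitAddTorus.mFourier, freqEquiv, ContinuousMap.coe_mk, Fin.prod_univ_two,
    finTwoArrowEquiv_symm_apply, Matrix.cons_val_zero, Matrix.cons_val_one, wave]
  rw [fourier_coe_apply, fourier_coe_apply, ← Complex.exp_add]
  congr 1
  push_cast
  field_simp

lemma unitLift_apply_coe (f : C(Torus L, ℝ)) (x y : ℝ) :
    unitLift f ![(x : UnitAddCircle), (y : UnitAddCircle)]
      = (f (((L * x : ℝ) : AddCircle L), ((L * y : ℝ) : AddCircle L)) : ℂ) := by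
  simp only [unitLift, ContinuousMap.coe_mk, Matrix.cons_val_zero, Matrix.cons_val_one]
  rw [AddCircle.homeomorphAddCircle_apply_mk, AddCircle.homeomorphAddCircle_apply_mk]
  simp [mul_comm]

/-- Rescaling both variables by `L` produces the Jacobian that cancels the prefactor `L⁻²`. Bessel's
inequality, inversion and the convolution formula are all imported through this identity. -/
lemma torusCoeff_eq_mFourierCoeff (f : C(Torus L, ℝ)) (k : ℤ × ℤ) :
    torusCoeff L f k = UnitAddTorus.mFourierCoeff (unitLift f) (freqEquiv k) := by
  have hL0 : (L : ℂ) ≠ 0 := by exact_mod_cast hL.out.ne'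
  rw [UnitAddTorus.mFourierCoeff_eq_integral _ _ 0]
  set F : ℝ × ℝ → ℂ := fun z =>
    (f (((L * z.1 : ℝ) : AddCircle L), ((L * z.2 : ℝ) : AddCircle L)) : ℂ) *
      wave L (-k) (L * z.1) (L * z.2) with hF
  have hFc : Continuous F := by
    have : Continuous fun z : ℝ × ℝ => wave L (-k) (L * z.1) (L * z.2) := by
      unfold wave; fun_prop
    have h2 : Continuous fun z : ℝ × ℝ =>
        f (((L * z.1 : ℝ) : AddCircle L), ((L * z.2 : ℝ) : AddCircle L)) := by
      refine f.continuous.comp (Continuous.prodMk ?_ ?_)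
      · exact (AddCircle.continuous_mk' L).comp (by fun_prop)
      · exact (AddCircle.continuous_mk' L).comp (by fun_prop)
    exact (Complex.continuous_ofReal.comp h2).mul this
  have key : ∀ x : Fin 2 → ℝ, (UnitAddTorus.mFourier (-freqEquiv k) fun i => (x i : UnitAddCircle)) •
      unitLift f (fun i => (x i : UnitAddCircle)) = F (MeasurableEquiv.finTwoArrow x) := by
    intro x
    have hx : (fun i => (x i : UnitAddCircle)) = ![(x 0 : UnitAddCircle), (x 1 : UnitAddCircle)] := by
      ext i; fin_cases i <;> rfl
    have hk : -freqEquiv k = freqEquiv (-k) := by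
      ext i; fin_cases i <;> rfl
    rw [hx, hk, mFourier_freqEquiv (L := L), unitLift_apply_coe, smul_eq_mul, mul_comm]
    rfl
  simp_rw [key]
  have hset : {x : Fin 2 → ℝ | ∀ i, x i ∈ Ioc ((0 : Fin 2 → ℝ) i) ((0 : Fin 2 → ℝ) i + 1)}
      = MeasurableEquiv.finTwoArrow ⁻¹' (Ioc (0:ℝ) 1 ×ˢ Ioc (0:ℝ) 1) := by
    ext x
    simp [Fin.forall_fin_two, MeasurableEquiv.finTwoArrow]
  rw [hset, (volume_preserving_finTwoArrow ℝ).setIntegral_preimage_emb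
    (MeasurableEquiv.measurableEmbedding _) F, Measure.volume_eq_prod, setIntegral_prod]
  · have h1 : ∀ x y : ℝ, F (x, y) = (fun a b : ℝ => (f ((a : AddCircle L), (b : AddCircle L)) : ℂ) *
      wave L (-k) a b) (L * x) (L * y) := fun x y => rfl
    simp_rw [h1, ← intervalIntegral.integral_of_le zero_le_one]
    simp_rw [fun x : ℝ => intervalIntegral.integral_comp_mul_left (a := 0) (b := 1)
      (fun b => (f (((L * x : ℝ) : AddCircle L), (b : AddCircle L)) : ℂ) * wave L (-k) (L * x) b)
      hL.out.ne']
    rw [intervalIntegral.integral_comp_mul_left (a := 0) (b := 1)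
      (fun a : ℝ => L⁻¹ • ∫ (b : ℝ) in L * 0..L * 1,
        (f ((a : AddCircle L), (b : AddCircle L)) : ℂ) * wave L (-k) a b) hL.out.ne',
      intervalIntegral.integral_smul, smul_smul]
    simp only [mul_zero, mul_one, torusCoeff, Complex.real_smul]
    push_cast
    field_simp
  · exact (hFc.continuousOn.integrableOn_compact
      (isCompact_Icc.prod isCompact_Icc)).mono_set
      (prod_mono Ioc_subset_Icc_self Ioc_subset_Icc_self)

lemma norm_unitLift_le (f : C(Torus L, ℝ)) : ‖unitLift f‖ ≤ ‖f‖ := by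
  refine (ContinuousMap.norm_le _ (norm_nonneg _)).2 fun x => ?_
  simp only [unitLift, ContinuousMap.coe_mk, Complex.norm_real]
  exact f.norm_coe_le_norm _

/-- `f` as an element of `L²` of the unit torus. -/
noncomputable def unitLp (f : C(UnitAddTorus (Fin 2), ℂ)) :
    Lp ℂ 2 (volume : Measure (UnitAddTorus (Fin 2))) :=
  ContinuousMap.toLp 2 volume ℂ f

lemma mFourierCoeff_eq_inner (f : C(UnitAddTorus (Fin 2), ℂ)) (k : Fin 2 → ℤ) :
    UnitAddTorus.mFourierCoeff f k = inner ℂ (UnitAddTorus.mFourierLp 2 k) (unitLp f) := by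
  rw [unitLp, ContinuousMap.inner_toLp, UnitAddTorus.mFourierCoeff]
  refine integral_congr_ae (Filter.Eventually.of_forall fun x => ?_)
  simp only [UnitAddTorus.mFourier_neg, smul_eq_mul, mul_comm]

/-- Bessel's inequality for the Fourier coefficients of a continuous function. -/
lemma sum_norm_torusCoeff_sq_le (f : C(Torus L, ℝ)) (F : Finset (ℤ × ℤ)) :
    ∑ k ∈ F, ‖torusCoeff L f k‖ ^ 2 ≤ ‖f‖ ^ 2 := by
  have h := UnitAddTorus.orthonormal_mFourier.sum_inner_products_le (unitLp (unitLift f))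
    (s := F.map freqEquiv.toEmbedding)
  rw [Finset.sum_map] at h
  simp_rw [torusCoeff_eq_mFourierCoeff, mFourierCoeff_eq_inner]
  refine h.trans ?_
  have h2 : ‖unitLp (unitLift f)‖ ≤ ‖f‖ := by
    have h3 := (ContinuousMap.toLp (E := ℂ) 2 (volume : Measure (UnitAddTorus (Fin 2))) ℂ).le_opNorm
      (unitLift f)
    have h4 := ContinuousMap.toLp_norm_le (p := 2) (E := ℂ) (𝕜 := ℂ)
      (μ := (volume : Measure (UnitAddTorus (Fin 2))))
    refine h3.trans ?_
    simp only [measureUnivNNReal, measure_univ, ENNReal.toNNReal_one, NNReal.coe_one,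
      Real.one_rpow] at h4
    calc _ ≤ 1 * ‖f‖ := mul_le_mul h4 (norm_unitLift_le f) (norm_nonneg _) zero_le_one
      _ = _ := one_mul _
  gcongr

/-- Fourier inversion when the coefficients are summable. -/
lemma hasSum_torusCoeff_wave (f : C(Torus L, ℝ)) (h : Summable (torusCoeff L f)) (x y : ℝ) :
    HasSum (fun k => torusCoeff L f k * wave L k x y)
      (f ((x : AddCircle L), (y : AddCircle L)) : ℂ) := by
  have h' : Summable (UnitAddTorus.mFourierCoeff (unitLift f)) := by
    rw [← freqEquiv.summable_iff]
    exact h.congr fun k => (torusCoeff_eq_mFourierCoeff f k)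
  have := UnitAddTorus.hasSum_mFourier_series_apply_of_summable h'
    ![((x / L : ℝ) : UnitAddCircle), ((y / L : ℝ) : UnitAddCircle)]
  rw [← freqEquiv.hasSum_iff, unitLift_apply_coe] at this
  rw [mul_div_cancel₀ _ hL.out.ne', mul_div_cancel₀ _ hL.out.ne'] at this
  refine this.congr_fun fun k => ?_
  simp only [Function.comp, mFourier_freqEquiv (L := L), ← torusCoeff_eq_mFourierCoeff, smul_eq_mul]
  rw [mul_div_cancel₀ _ hL.out.ne', mul_div_cancel₀ _ hL.out.ne']

/-- The Fourier coefficients of a product are the convolution of the Fourier coefficients. -/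
lemma hasSum_torusCoeff_mul (f g : C(Torus L, ℝ)) (k : ℤ × ℤ) :
    HasSum (fun l => torusCoeff L f l * torusCoeff L g (k - l)) (torusCoeff L (f * g) k) := by
  -- Parseval for the pair `ḡ e_k` and `f`: their inner product is the `k`-th coefficient of `fg`,
  -- and the conjugate of the `l`-th coefficient of `ḡ e_k` is the coefficient of `g` at `k - l`.
  have h := (UnitAddTorus.mFourierBasis (d := Fin 2)).hasSum_inner_mul_inner
    (unitLp (star (unitLift g) * UnitAddTorus.mFourier (freqEquiv k))) (unitLp (unitLift f))
  rw [← freqEquiv.hasSum_iff] at h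
  convert! h using 1
  · ext l
    simp only [Function.comp, UnitAddTorus.coe_mFourierBasis]
    rw [← mFourierCoeff_eq_inner, ← torusCoeff_eq_mFourierCoeff, mul_comm]
    congr 1
    rw [torusCoeff_eq_mFourierCoeff, unitLp, ContinuousMap.inner_toLp, UnitAddTorus.mFourierCoeff]
    refine integral_congr_ae (Filter.Eventually.of_forall fun x => ?_)
    have hk : -freqEquiv (k - l) = freqEquiv l + - freqEquiv k := by
      ext i; fin_cases i <;> simp [freqEquiv, sub_eq_add_neg]
    simp only [hk, smul_eq_mul, UnitAddTorus.mFourier_add, UnitAddTorus.mFourier_neg,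
      ContinuousMap.mul_apply, ContinuousMap.star_apply, map_mul, RCLike.star_def,
      RingHomCompTriple.comp_apply, RingHom.id_apply]
    ring
  · rw [torusCoeff_eq_mFourierCoeff, unitLp, unitLp, ContinuousMap.inner_toLp,
      UnitAddTorus.mFourierCoeff]
    refine integral_congr_ae (Filter.Eventually.of_forall fun x => ?_)
    simp only [smul_eq_mul, UnitAddTorus.mFourier_neg,
      ContinuousMap.mul_apply, ContinuousMap.star_apply, map_mul, RCLike.star_def, unitLift,
      ContinuousMap.coe_mk, Complex.ofReal_mul, Complex.conj_conj]
    ring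

lemma torusCoeff_add (f g : C(Torus L, ℝ)) (k : ℤ × ℤ) :
    torusCoeff L (f + g) k = torusCoeff L f k + torusCoeff L g k := by
  simp only [torusCoeff_eq_mFourierCoeff, mFourierCoeff_eq_inner, ← inner_add_right]
  congr 1
  rw [unitLp, unitLp, unitLp, ← map_add]
  congr 1
  ext x
  simp [unitLift]

lemma torusCoeff_smul (r : ℝ) (f : C(Torus L, ℝ)) (k : ℤ × ℤ) :
    torusCoeff L (r • f) k = r * torusCoeff L f k := by
  simp only [torusCoeff_eq_mFourierCoeff, mFourierCoeff_eq_inner, ← inner_smul_right]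
  congr 1
  rw [unitLp, unitLp, ← map_smul]
  congr 1
  ext x
  simp [unitLift]

variable (L) in
/-- The `k`-th Fourier coefficient as a bounded real-linear functional. -/
noncomputable def torusCoeffCLM (k : ℤ × ℤ) : C(Torus L, ℝ) →L[ℝ] ℂ :=
  LinearMap.mkContinuous
    { toFun := fun f => torusCoeff L f k
      map_add' := fun f g => torusCoeff_add f g k
      map_smul' := fun r f => by
        rw [torusCoeff_smul]; simp } 1 (fun f => by
      have h := sum_norm_torusCoeff_sq_le f {k}
      rw [Finset.sum_singleton] at h
      rw [one_mul]
      exact le_of_sq_le_sq h (norm_nonneg _))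

@[simp] lemma torusCoeffCLM_apply (f : C(Torus L, ℝ)) (k : ℤ × ℤ) :
    torusCoeffCLM L k f = torusCoeff L f k := rfl

/-- This is where real-valuedness of `f` enters; the symmetry makes the real part in `synthesize`
harmless. -/
lemma torusCoeff_neg_freq (f : C(Torus L, ℝ)) (k : ℤ × ℤ) :
    torusCoeff L f (-k) = star (torusCoeff L f k) := by
  rw [torusCoeff_eq_mFourierCoeff, torusCoeff_eq_mFourierCoeff, UnitAddTorus.mFourierCoeff,
    UnitAddTorus.mFourierCoeff, RCLike.star_def, ← integral_conj]
  refine integral_congr_ae (Filter.Eventually.of_forall fun x => ?_)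
  have hk : freqEquiv (-k) = - freqEquiv k := by
    ext i; fin_cases i <;> simp [freqEquiv]
  simp only [hk, smul_eq_mul, UnitAddTorus.mFourier_neg, map_mul, Complex.conj_conj, unitLift,
    ContinuousMap.coe_mk, Complex.conj_ofReal]

end TorusFourier

/-! ### Weighted sequence spaces: `ℓ¹` embedding, tail decay, algebra property. -/

section Sobolev

variable {L : ℝ}

/-- The Fourier weight `1 + λ_k`. -/
noncomputable def wt (L : ℝ) (k : ℤ × ℤ) : ℝ := 1 + lam L k

lemma lam_nonneg (k : ℤ × ℤ) : 0 ≤ lam L k := by unfold lam; positivity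

lemma lam_neg (k : ℤ × ℤ) : lam L (-k) = lam L k := by simp [lam]

lemma one_le_wt (k : ℤ × ℤ) : 1 ≤ wt L k := by
  have := lam_nonneg (L := L) k
  unfold wt; linarith

lemma wt_pos (k : ℤ × ℤ) : 0 < wt L k := one_pos.trans_le (one_le_wt k)

/-- The difference of the two sides is `(λ - 3)²`. The kernel of `(Δ+1)²` (modes with `λ = 1`)
forces the additive constant. -/
lemma wt_sq_le (k : ℤ × ℤ) : wt L k ^ 2 ≤ 2 * (lam L k - 1) ^ 2 + 8 := by
  unfold wt
  nlinarith [sq_nonneg (lam L k - 3)]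

/-- Peetre-type inequality, from `|k|² ≤ 2|l|² + 2|k-l|²`. -/
lemma wt_le (k l : ℤ × ℤ) : wt L k ≤ 2 * (wt L l + wt L (k - l)) := by
  have h : lam L k ≤ 2 * (lam L l + lam L (k - l)) := by
    unfold lam
    have hc : 0 ≤ 4 * Real.pi ^ 2 / L ^ 2 := by positivity
    have : (k.1 : ℝ) ^ 2 + (k.2 : ℝ) ^ 2 ≤ 2 * (((l.1 : ℝ) ^ 2 + (l.2 : ℝ) ^ 2)
        + (((k - l).1 : ℝ) ^ 2 + ((k - l).2 : ℝ) ^ 2)) := by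
      simp only [Prod.fst_sub, Prod.snd_sub, Int.cast_sub]
      nlinarith [sq_nonneg (2 * (l.1 : ℝ) - k.1), sq_nonneg (2 * (l.2 : ℝ) - k.2)]
    nlinarith [mul_le_mul_of_nonneg_left this hc]
  unfold wt; linarith

lemma wt_rpow_le {s : ℝ} (hs : 0 ≤ s) (k l : ℤ × ℤ) :
    wt L k ^ s ≤ 4 ^ s * (wt L l ^ s + wt L (k - l) ^ s) := by
  have h1 := wt_pos (L := L) l
  have h2 := wt_pos (L := L) (k - l)
  have h3 : wt L k ≤ 4 * max (wt L l) (wt L (k - l)) := by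
    have := wt_le (L := L) k l
    linarith [le_max_left (wt L l) (wt L (k - l)), le_max_right (wt L l) (wt L (k - l))]
  calc wt L k ^ s ≤ (4 * max (wt L l) (wt L (k - l))) ^ s :=
        Real.rpow_le_rpow (wt_pos k).le h3 hs
    _ = 4 ^ s * (max (wt L l) (wt L (k - l))) ^ s :=
        Real.mul_rpow (by norm_num) (h1.le.trans (le_max_left _ _))
    _ ≤ _ := by
        gcongr
        rcases max_choice (wt L l) (wt L (k - l)) with h | h <;> rw [h]
        · linarith [Real.rpow_nonneg h2.le s]
        · linarith [Real.rpow_nonneg h1.le s]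

lemma summable_int_inv_one_add_sq : Summable fun n : ℤ => (1 + (n : ℝ) ^ 2)⁻¹ := by
  have h : Summable fun n : ℕ => (1 + (n : ℝ) ^ 2)⁻¹ := by
    refine Summable.of_norm_bounded_eventually_nat
      (Real.summable_nat_pow_inv.2 (by norm_num : 1 < 2)) ?_
    filter_upwards [Filter.eventually_gt_atTop 0] with n hn
    have : (0 : ℝ) < (n : ℝ) ^ 2 := by positivity
    rw [Real.norm_of_nonneg (by positivity)]
    gcongr
    linarith
  refine Summable.of_nat_of_neg (by simpa using h) (by simpa using h)

/-- Comparison with the product series `∑ (1+ℓ²)⁻¹ · ∑ (1+m²)⁻¹`, since `(1+ℓ²)(1+m²) ≤ (1+ℓ²+m²)²`.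
-/
lemma summable_wt_inv_sq (hL : 0 < L) : Summable fun k : ℤ × ℤ => (wt L k ^ (2 : ℝ))⁻¹ := by
  set c := min (4 * Real.pi ^ 2 / L ^ 2) 1 with hc
  have hc0 : 0 < c := lt_min (by positivity) one_pos
  have h := (summable_int_inv_one_add_sq.mul_of_nonneg summable_int_inv_one_add_sq
    (fun n => by positivity) (fun n => by positivity)).mul_left (c ^ 2)⁻¹
  refine Summable.of_nonneg_of_le (fun k => inv_nonneg.2 (Real.rpow_nonneg (wt_pos k).le _))
    (fun k => ?_) h
  rw [Real.rpow_two, ← mul_inv, ← mul_inv]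
  have h1 : c * (1 + (k.1 : ℝ) ^ 2 + (k.2 : ℝ) ^ 2) ≤ wt L k := by
    have h2 : c ≤ 4 * Real.pi ^ 2 / L ^ 2 := min_le_left _ _
    have h3 : c ≤ 1 := min_le_right _ _
    have h4 : c * ((k.1 : ℝ) ^ 2 + (k.2 : ℝ) ^ 2)
      ≤ 4 * Real.pi ^ 2 / L ^ 2 * ((k.1 : ℝ) ^ 2 + (k.2 : ℝ) ^ 2) := by gcongr
    unfold wt lam; nlinarith
  gcongr
  calc c ^ 2 * ((1 + (k.1 : ℝ) ^ 2) * (1 + (k.2 : ℝ) ^ 2))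
      ≤ c ^ 2 * (1 + (k.1 : ℝ) ^ 2 + (k.2 : ℝ) ^ 2) ^ 2 := by
        gcongr
        nlinarith [sq_nonneg (k.1 : ℝ), sq_nonneg (k.2 : ℝ),
          mul_nonneg (sq_nonneg (k.1 : ℝ)) (sq_nonneg (k.2 : ℝ)), sq_nonneg ((k.1 : ℝ) ^ 2),
          sq_nonneg ((k.2 : ℝ) ^ 2)]
    _ = (c * (1 + (k.1 : ℝ) ^ 2 + (k.2 : ℝ) ^ 2)) ^ 2 := by ring
    _ ≤ wt L k ^ 2 := by gcongr

/-- `∑_k (1 + λ_k)⁻²`. -/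
noncomputable def wtSum (L : ℝ) : ℝ := ∑' k : ℤ × ℤ, (wt L k ^ (2 : ℝ))⁻¹

lemma wtSum_nonneg : 0 ≤ wtSum L :=
  tsum_nonneg fun k => inv_nonneg.2 (Real.rpow_nonneg (wt_pos k).le _)

lemma sum_wt_inv_sq_le (hL : 0 < L) (F : Finset (ℤ × ℤ)) :
    ∑ k ∈ F, (wt L k ^ (2 : ℝ))⁻¹ ≤ wtSum L :=
  (summable_wt_inv_sq hL).sum_le_tsum F
    fun k _ => inv_nonneg.2 (Real.rpow_nonneg (wt_pos k).le _)

lemma sum_wt_inv_le (hL : 0 < L) {s : ℝ} (hs : 2 ≤ s) (F : Finset (ℤ × ℤ)) :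
    ∑ k ∈ F, (wt L k ^ s)⁻¹ ≤ wtSum L := by
  refine le_trans (Finset.sum_le_sum fun k _ => ?_) (sum_wt_inv_sq_le hL F)
  have := Real.rpow_pos_of_pos (wt_pos (L := L) k) 2
  gcongr
  exact one_le_wt k

lemma sum_wt_inv_sub_le (hL : 0 < L) {s : ℝ} (hs : 2 ≤ s) (k : ℤ × ℤ) (F : Finset (ℤ × ℤ)) :
    ∑ l ∈ F, (wt L (k - l) ^ s)⁻¹ ≤ wtSum L := by
  have := sum_wt_inv_le hL hs (F.map (Equiv.subLeft k).toEmbedding)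
  rwa [Finset.sum_map] at this

/-- The squared weighted norm `∑ (1 + λ_k)^s |a_k|²` is at most `B`. -/
def SobBound (L s : ℝ) (a : ℤ × ℤ → ℂ) (B : ℝ) : Prop :=
  ∀ F : Finset (ℤ × ℤ), ∑ k ∈ F, wt L k ^ s * ‖a k‖ ^ 2 ≤ B

namespace SobBound

variable {s A B : ℝ} {a b c : ℤ × ℤ → ℂ}

lemma nonneg (h : SobBound L s a A) : 0 ≤ A := by simpa using h ∅

lemma mono (h : SobBound L s a A) (hAB : A ≤ B) :
    SobBound L s a B := fun F => (h F).trans hAB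

lemma mono_exp {r : ℝ} (hr : r ≤ s) (h : SobBound L s a A) : SobBound L r a A := fun F =>
  (Finset.sum_le_sum fun k _ => mul_le_mul_of_nonneg_right
    (Real.rpow_le_rpow_of_exponent_le (one_le_wt k) hr) (sq_nonneg _)).trans (h F)

lemma add (ha : SobBound L s a A) (hb : SobBound L s b B) :
    SobBound L s (a + b) (2 * A + 2 * B) := fun F => by
  calc ∑ k ∈ F, wt L k ^ s * ‖(a + b) k‖ ^ 2
      ≤ ∑ k ∈ F, (2 * (wt L k ^ s * ‖a k‖ ^ 2) + 2 * (wt L k ^ s * ‖b k‖ ^ 2)) := by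
        refine Finset.sum_le_sum fun k _ => ?_
        have h1 : ‖(a + b) k‖ ^ 2 ≤ 2 * ‖a k‖ ^ 2 + 2 * ‖b k‖ ^ 2 := by
          have := norm_add_le (a k) (b k)
          have h0 := norm_nonneg (a k + b k)
          rw [Pi.add_apply]
          nlinarith [sq_nonneg (‖a k‖ - ‖b k‖)]
        have h2 := Real.rpow_nonneg (wt_pos (L := L) k).le s
        nlinarith
    _ ≤ _ := by
        rw [Finset.sum_add_distrib, ← Finset.mul_sum, ← Finset.mul_sum]
        linarith [ha F, hb F]

lemma smul (ha : SobBound L s a A) (r : ℝ) : SobBound L s (fun k => (r : ℂ) * a k) (r ^ 2 * A) :=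
  fun F => by
  calc _ = r ^ 2 * ∑ k ∈ F, wt L k ^ s * ‖a k‖ ^ 2 := by
        rw [Finset.mul_sum]
        refine Finset.sum_congr rfl fun k _ => ?_
        rw [norm_mul, Complex.norm_real, Real.norm_eq_abs, mul_pow, sq_abs]
        ring
    _ ≤ _ := mul_le_mul_of_nonneg_left (ha F) (sq_nonneg r)

/-- Cauchy–Schwarz: the Sobolev norm controls the `ℓ¹` norm. -/
lemma sum_norm_le (hL : 0 < L) (hs : 2 ≤ s) (ha : SobBound L s a A) (F : Finset (ℤ × ℤ)) :
    ∑ k ∈ F, ‖a k‖ ≤ Real.sqrt (A * wtSum L) := by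
  refine Real.le_sqrt_of_sq_le ?_
  have h := Finset.sum_sq_le_sum_mul_sum_of_sq_le_mul F (r := fun k => ‖a k‖)
    (f := fun k => wt L k ^ s * ‖a k‖ ^ 2) (g := fun k => (wt L k ^ s)⁻¹)
    (fun k _ => mul_nonneg (Real.rpow_nonneg (wt_pos k).le _) (sq_nonneg _))
    (fun k _ => inv_nonneg.2 (Real.rpow_nonneg (wt_pos k).le _))
    (fun k _ => by
      have := Real.rpow_pos_of_pos (wt_pos (L := L) k) s
      exact le_of_eq (by field_simp))
  refine h.trans ?_
  exact mul_le_mul (ha F) (sum_wt_inv_le hL hs F)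
    (Finset.sum_nonneg fun k _ => inv_nonneg.2 (Real.rpow_nonneg (wt_pos k).le _)) ha.nonneg

lemma summable_norm (hL : 0 < L) (hs : 2 ≤ s) (ha : SobBound L s a A) :
    Summable fun k => ‖a k‖ :=
  summable_of_sum_le (fun _ => norm_nonneg _) (ha.sum_norm_le hL hs)

/-- Outside the frequency range of the grid, the `ℓ¹` norm is small. -/
lemma sum_norm_tail_le (hL : 0 < L) (hs : 2 ≤ s) (ha : SobBound L s a A) (K : ℕ)
    (F : Finset (ℤ × ℤ)) (hF : Disjoint F (freqs K)) :
    ∑ k ∈ F, ‖a k‖ ≤ Real.sqrt (A * wtSum L) * meshSize L K ^ (s - 2) := by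
  set h := meshSize L K with hh
  have hpos : 0 < h := by rw [hh, meshSize]; positivity
  -- Outside the box one of the two frequencies is at least `K+1` in absolute value, so `h²λ_k ≥
  -- π²(2(K+1)/(2K+1))² ≥ π²`.
  have hwt : ∀ k ∈ F, 1 ≤ h ^ 2 * wt L k := by
    intro k hk
    have hk' : k ∉ freqs K := Finset.disjoint_left.1 hF hk
    have h1 : ((K : ℝ) + 1) ^ 2 ≤ (k.1 : ℝ) ^ 2 + (k.2 : ℝ) ^ 2 := by
      simp only [freqs, Finset.mem_product, Finset.mem_Icc, ← abs_le, not_and_or, not_le] at hk'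
      have aux : ∀ n : ℤ, (K : ℤ) < |n| → ((K : ℝ) + 1) ^ 2 ≤ (n : ℝ) ^ 2 := by
        intro n hn
        have : ((K : ℝ) + 1) ≤ |(n : ℝ)| := by exact_mod_cast hn
        rw [← sq_abs (n : ℝ)]
        gcongr
      rcases hk' with h | h
      · nlinarith [aux _ h, sq_nonneg (k.2 : ℝ)]
      · nlinarith [aux _ h, sq_nonneg (k.1 : ℝ)]
    have h2 : 4 * Real.pi ^ 2 / L ^ 2 * ((K : ℝ) + 1) ^ 2 ≤ wt L k := by
      have : 4 * Real.pi ^ 2 / L ^ 2 * ((K : ℝ) + 1) ^ 2 ≤ lam L k := by unfold lam; gcongr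
      unfold wt; linarith
    calc (1 : ℝ) ≤ Real.pi ^ 2 := by nlinarith [Real.pi_gt_three]
      _ ≤ h ^ 2 * (4 * Real.pi ^ 2 / L ^ 2 * ((K : ℝ) + 1) ^ 2) := by
          rw [hh, meshSize]
          have : (L / (2 * K + 1)) ^ 2 * (4 * Real.pi ^ 2 / L ^ 2 * ((K : ℝ) + 1) ^ 2)
            = Real.pi ^ 2 * ((2 * (K + 1)) / (2 * K + 1)) ^ 2 := by
            field_simp; ring
          rw [this]
          have h3 : (1 : ℝ) ≤ (2 * (K + 1)) / (2 * K + 1) := by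
            rw [one_le_div (by positivity)]; linarith
          nlinarith [Real.pi_gt_three, one_le_pow₀ (n := 2) h3]
      _ ≤ _ := by gcongr
  -- Two powers of the weight are kept for summability; each of the other `s - 2` yields a factor
  -- `h²`.
  have hwt' : ∀ k ∈ F, (wt L k ^ s)⁻¹ ≤ (wt L k ^ (2 : ℝ))⁻¹ * (h ^ (s - 2)) ^ 2 := by
    intro k hk
    have hw := wt_pos (L := L) k
    have e1 : wt L k ^ s = wt L k ^ (2 : ℝ) * wt L k ^ (s - 2) := by
      rw [← Real.rpow_add hw]; ring_nf
    have e2 : (h ^ (s - 2)) ^ 2 = (h ^ 2) ^ (s - 2) := by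
      rw [← Real.rpow_natCast, ← Real.rpow_natCast, ← Real.rpow_mul hpos.le,
        ← Real.rpow_mul hpos.le, mul_comm]
    rw [e1, mul_inv, e2]
    have := Real.rpow_pos_of_pos hw 2
    gcongr
    rw [← Real.inv_rpow hw.le]
    refine Real.rpow_le_rpow (inv_nonneg.2 hw.le) ?_ (by linarith)
    rw [inv_le_iff_one_le_mul₀ hw]
    exact hwt k hk
  have hsum : (∑ k ∈ F, ‖a k‖) ^ 2 ≤ A * wtSum L * (h ^ (s - 2)) ^ 2 := by
    have h := Finset.sum_sq_le_sum_mul_sum_of_sq_le_mul F (r := fun k => ‖a k‖)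
      (f := fun k => wt L k ^ s * ‖a k‖ ^ 2) (g := fun k => (wt L k ^ s)⁻¹)
      (fun k _ => mul_nonneg (Real.rpow_nonneg (wt_pos k).le _) (sq_nonneg _))
      (fun k _ => inv_nonneg.2 (Real.rpow_nonneg (wt_pos k).le _))
      (fun k _ => by
        have := Real.rpow_pos_of_pos (wt_pos (L := L) k) s
        exact le_of_eq (by field_simp))
    refine h.trans ?_
    rw [mul_assoc]
    refine mul_le_mul (ha F) ((Finset.sum_le_sum hwt').trans ?_)
      (Finset.sum_nonneg fun k _ => inv_nonneg.2 (Real.rpow_nonneg (wt_pos k).le _)) ha.nonneg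
    rw [← Finset.sum_mul]
    gcongr
    exact sum_wt_inv_sq_le hL F
  calc ∑ k ∈ F, ‖a k‖ ≤ Real.sqrt (A * wtSum L * (h ^ (s - 2)) ^ 2) := Real.le_sqrt_of_sq_le hsum
    _ = _ := by
      rw [Real.sqrt_mul (mul_nonneg ha.nonneg wtSum_nonneg),
        Real.sqrt_sq (Real.rpow_nonneg hpos.le _)]

/-- The weighted space is an algebra under convolution. -/
lemma conv (hL : 0 < L) (hs : 2 ≤ s) (ha : SobBound L s a A) (hb : SobBound L s b B)
    (hc : ∀ k, HasSum (fun l => a l * b (k - l)) (c k)) :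
    SobBound L s c (2 * 4 ^ s * wtSum L * (A * B)) := by
  intro G
  set p : ℤ × ℤ → ℝ := fun l => wt L l ^ s * ‖a l‖ ^ 2
  set q : ℤ × ℤ → ℝ := fun l => wt L l ^ s * ‖b l‖ ^ 2
  have hw : ∀ l, 0 < wt L l ^ s := fun l => Real.rpow_pos_of_pos (wt_pos l) s
  have hp : ∀ l, 0 ≤ p l := fun l => mul_nonneg (hw l).le (sq_nonneg _)
  have hq : ∀ l, 0 ≤ q l := fun l => mul_nonneg (hw l).le (sq_nonneg _)
  have hlim : Filter.Tendsto
      (fun F : Finset (ℤ × ℤ) => ∑ k ∈ G, wt L k ^ s * ‖∑ l ∈ F, a l * b (k - l)‖ ^ 2)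
      Filter.atTop (nhds (∑ k ∈ G, wt L k ^ s * ‖c k‖ ^ 2)) :=
    tendsto_finsetSum _ fun k _ => ((hc k).norm.pow 2).const_mul _
  -- It is enough to bound the truncated convolutions uniformly in the truncation `F`, where all
  -- sums are finite and can be exchanged.
  refine le_of_tendsto' hlim fun F => ?_
  have hk : ∀ k ∈ G, wt L k ^ s * ‖∑ l ∈ F, a l * b (k - l)‖ ^ 2
      ≤ 2 * 4 ^ s * wtSum L * ∑ l ∈ F, p l * q (k - l) := by
    intro k _
    have h1 : (∑ l ∈ F, ‖a l‖ * ‖b (k - l)‖) ^ 2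
        ≤ (∑ l ∈ F, p l * q (k - l)) * ∑ l ∈ F, (wt L l ^ s)⁻¹ * (wt L (k - l) ^ s)⁻¹ := by
      refine Finset.sum_sq_le_sum_mul_sum_of_sq_le_mul F
        (fun l _ => mul_nonneg (hp l) (hq _))
        (fun l _ => mul_nonneg (inv_nonneg.2 (hw l).le) (inv_nonneg.2 (hw _).le))
        (fun l _ => le_of_eq ?_)
      have := hw l
      have := hw (k - l)
      simp only [p, q]
      field_simp
    have h2 : ‖∑ l ∈ F, a l * b (k - l)‖ ≤ ∑ l ∈ F, ‖a l‖ * ‖b (k - l)‖ :=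
      (norm_sum_le _ _).trans (le_of_eq (Finset.sum_congr rfl fun l _ => norm_mul _ _))
    -- The Peetre inequality cancels one of the two inverse weights in each term, leaving two copies
    -- of a summable series.
    have h3 : wt L k ^ s * ∑ l ∈ F, (wt L l ^ s)⁻¹ * (wt L (k - l) ^ s)⁻¹
        ≤ 2 * 4 ^ s * wtSum L := by
      calc wt L k ^ s * ∑ l ∈ F, (wt L l ^ s)⁻¹ * (wt L (k - l) ^ s)⁻¹
          ≤ ∑ l ∈ F, 4 ^ s * ((wt L l ^ s)⁻¹ + (wt L (k - l) ^ s)⁻¹) := by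
            rw [Finset.mul_sum]
            refine Finset.sum_le_sum fun l _ => ?_
            have e1 := hw l
            have e2 := hw (k - l)
            calc _ ≤ (4 ^ s * (wt L l ^ s + wt L (k - l) ^ s)) *
                  ((wt L l ^ s)⁻¹ * (wt L (k - l) ^ s)⁻¹) := by
                  gcongr
                  exact wt_rpow_le (by linarith) k l
              _ = _ := by field_simp; ring
        _ = 4 ^ s * (∑ l ∈ F, (wt L l ^ s)⁻¹ + ∑ l ∈ F, (wt L (k - l) ^ s)⁻¹) := by
            rw [← Finset.mul_sum, Finset.sum_add_distrib]
        _ ≤ 4 ^ s * (wtSum L + wtSum L) := by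
            gcongr
            · exact sum_wt_inv_le hL hs F
            · exact sum_wt_inv_sub_le hL hs k F
        _ = _ := by ring
    have h4 : 0 ≤ ∑ l ∈ F, p l * q (k - l) := Finset.sum_nonneg fun l _ => mul_nonneg (hp l) (hq _)
    calc wt L k ^ s * ‖∑ l ∈ F, a l * b (k - l)‖ ^ 2
        ≤ wt L k ^ s * ((∑ l ∈ F, p l * q (k - l)) *
          ∑ l ∈ F, (wt L l ^ s)⁻¹ * (wt L (k - l) ^ s)⁻¹) := by
          have := hw k
          gcongr
          exact le_trans (by gcongr) h1
      _ = (wt L k ^ s * ∑ l ∈ F, (wt L l ^ s)⁻¹ * (wt L (k - l) ^ s)⁻¹) *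
          ∑ l ∈ F, p l * q (k - l) := by ring
      _ ≤ _ := by gcongr
  refine (Finset.sum_le_sum hk).trans ?_
  rw [← Finset.mul_sum]
  have h5 : 0 ≤ 2 * (4 : ℝ) ^ s * wtSum L := by
    have := wtSum_nonneg (L := L)
    positivity
  refine mul_le_mul_of_nonneg_left ?_ h5
  rw [Finset.sum_comm]
  calc ∑ l ∈ F, ∑ k ∈ G, p l * q (k - l) ≤ ∑ l ∈ F, p l * B := by
        refine Finset.sum_le_sum fun l _ => ?_
        rw [← Finset.mul_sum]
        refine mul_le_mul_of_nonneg_left ?_ (hp l)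
        have := hb (G.map (Equiv.subRight l).toEmbedding)
        rwa [Finset.sum_map] at this
    _ = (∑ l ∈ F, p l) * B := by rw [Finset.sum_mul]
    _ ≤ A * B := mul_le_mul_of_nonneg_right (ha F) hb.nonneg

end SobBound

end Sobolev

/-! ### Weak time derivatives and the `C²` representative. -/

section WeakDerivative

variable {E : Type*} [NormedAddCommGroup E] [NormedSpace ℝ E] [CompleteSpace E] {T : ℝ}

/-- Integration by parts against the primitive of an integrable function. -/
lemma integral_deriv_smul_primitive {h : ℝ → E}
    (hh : IntegrableOn h (Ioo 0 T)) {φ : ℝ → ℝ}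
    (hφ : ContDiff ℝ ((⊤ : ℕ∞) : WithTop ℕ∞) φ) (hc : HasCompactSupport φ)
    (hs : tsupport φ ⊆ Ioo 0 T) :
    ∫ t in Ioo 0 T, deriv φ t • ∫ s in (0 : ℝ)..t, (Ioo 0 T).indicator h s
      = - ∫ t in Ioo 0 T, φ t • h t := by
  have hd : Continuous (deriv φ) := hφ.continuous_deriv (by simp)
  have hdi : Integrable (deriv φ) (volume.restrict (Ioo 0 T)) :=
    (hd.integrable_of_hasCompactSupport hc.deriv).restrict
  -- The kernel supported on the triangle `s ≤ t`: Fubini turns the primitive of `h` into the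
  -- integral of `φ'` from `s` to `T`, which is `-φ(s)`.
  set f : ℝ → ℝ → E := fun t s =>
    ({z : ℝ × ℝ | z.2 ≤ z.1}.indicator fun z => deriv φ z.1 • h z.2) (t, s) with hf
  have hint : Integrable (Function.uncurry f)
      ((volume.restrict (Ioo 0 T)).prod (volume.restrict (Ioo 0 T))) :=
    (hdi.smul_prod hh).indicator (measurableSet_le measurable_snd measurable_fst)
  have h1 : ∀ t ∈ Ioo 0 T, deriv φ t • ∫ s in (0 : ℝ)..t, (Ioo 0 T).indicator h s
      = ∫ s in Ioo 0 T, f t s := by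
    intro t ht
    rw [intervalIntegral.integral_of_le ht.1.le, ← integral_smul, ← integral_indicator
      measurableSet_Ioc, ← integral_indicator measurableSet_Ioo]
    congr 1
    ext s
    simp only [hf, indicator_apply, mem_Ioc, mem_Ioo, mem_ofPred_eq]
    by_cases h0 : 0 < s <;> by_cases h2 : s ≤ t <;> by_cases h3 : s < T <;> simp [h0, h2, h3]
  have h2 : ∀ s ∈ Ioo 0 T, ∫ t in Ioo 0 T, f t s = - (φ s • h s) := by
    intro s hs'
    have e : ∀ t, (Ioo 0 T).indicator (fun t => f t s) t
        = (Ico s T).indicator (fun t => deriv φ t • h s) t := by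
      intro t
      simp only [hf, indicator_apply, mem_Ico, mem_Ioo, mem_ofPred_eq]
      by_cases h2 : s ≤ t
      · have : 0 < t := hs'.1.trans_le h2
        simp [h2, this]
      · simp [h2]
    rw [← integral_indicator measurableSet_Ioo, funext e, integral_indicator measurableSet_Ico,
      integral_smul_const, integral_Ico_eq_integral_Ioo, ← integral_Ioc_eq_integral_Ioo,
      ← intervalIntegral.integral_of_le hs'.2.le,
      intervalIntegral.integral_deriv_eq_sub (fun x _ => (hφ.differentiable (by simp)) x)
        (hd.intervalIntegrable _ _)]
    have : φ T = 0 := by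
      by_contra hne
      exact lt_irrefl T (hs (subset_tsupport _ hne)).2
    rw [this, zero_sub, neg_smul]
  rw [setIntegral_congr_fun measurableSet_Ioo h1, integral_integral_swap hint,
    setIntegral_congr_fun measurableSet_Ioo h2, integral_neg]

lemma exists_Icc_of_isCompact_subset_Ioo (hT : 0 < T) {S : Set ℝ} (hS : IsCompact S)
    (h : S ⊆ Ioo 0 T) : ∃ a b, 0 < a ∧ b < T ∧ a ≤ b ∧ S ⊆ Icc a b := by
  rcases S.eq_empty_or_nonempty with rfl | hne
  · exact ⟨T / 2, T / 2, by linarith, by linarith, le_rfl, by simp⟩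
  · obtain ⟨a, ha⟩ := hS.exists_isLeast hne
    obtain ⟨b, hb⟩ := hS.exists_isGreatest hne
    exact ⟨a, b, (h ha.1).1, (h hb.1).2, ha.2 hb.1, fun x hx => ⟨ha.2 hx, hb.2 hx⟩⟩

/-- A smooth function with compact support in `(0, T)` and zero mean is the derivative of another
one. -/
lemma exists_primitive_test (hT : 0 < T) {χ : ℝ → ℝ}
    (hχ : ContDiff ℝ ((⊤ : ℕ∞) : WithTop ℕ∞) χ) (hc : HasCompactSupport χ)
    (hs : tsupport χ ⊆ Ioo 0 T) (h0 : ∫ t, χ t = 0) :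
    ∃ φ : ℝ → ℝ, ContDiff ℝ ((⊤ : ℕ∞) : WithTop ℕ∞) φ ∧ HasCompactSupport φ ∧
      tsupport φ ⊆ Ioo 0 T ∧ deriv φ = χ := by
  obtain ⟨a, b, ha, hb, hab, hsub⟩ := exists_Icc_of_isCompact_subset_Ioo hT hc hs
  have hder : ∀ t, HasDerivAt (fun t => ∫ s in (0 : ℝ)..t, χ s) (χ t) t := fun t =>
    (hχ.continuous.integral_hasStrictDerivAt 0 t).hasDerivAt
  have hderiv : deriv (fun t => ∫ s in (0 : ℝ)..t, χ s) = χ := funext fun t => (hder t).deriv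
  have hz : ∀ t, t ∉ Icc a b → χ t = 0 := fun t ht => by
    by_contra hne
    exact ht (hsub (subset_tsupport _ hne))
  have hsupp : Function.support (fun t => ∫ s in (0 : ℝ)..t, χ s) ⊆ Icc a b := by
    intro t ht
    by_contra hnot
    apply ht
    rw [mem_Icc, not_and_or, not_le, not_le] at hnot
    rcases hnot with h | h
    · refine (intervalIntegral.integral_congr (g := fun _ => (0 : ℝ)) fun s hs' => ?_).trans (by simp)
      refine hz s fun hs2 => ?_
      rcases mem_uIcc.1 hs' with h3 | h3 <;> linarith [hs2.1]
    -- To the right of the support the primitive is the full integral of `χ`, so the zero mean is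
    -- what keeps its support compact.
    · change ∫ s in (0 : ℝ)..t, χ s = 0
      rw [intervalIntegral.integral_eq_integral_of_support_subset, h0]
      intro s hs'
      have := hsub (subset_tsupport _ hs')
      exact ⟨ha.trans_le this.1, this.2.trans h.le⟩
  have hts : tsupport (fun t => ∫ s in (0 : ℝ)..t, χ s) ⊆ Icc a b :=
    closure_minimal hsupp isClosed_Icc
  refine ⟨fun t => ∫ s in (0 : ℝ)..t, χ s, ?_, ?_, ?_, hderiv⟩
  · rw [contDiff_infty_iff_deriv, hderiv]
    exact ⟨fun t => (hder t).differentiableAt, hχ⟩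
  · exact isCompact_Icc.of_isClosed_subset (isClosed_tsupport _) hts
  · exact hts.trans fun x hx => ⟨ha.trans_le hx.1, hx.2.trans_lt hb⟩

/-- The lemma of du Bois-Reymond. -/
lemma ae_eq_const_of_integral_deriv_smul_eq_zero (hT : 0 < T) {v : ℝ → E}
    (hv : IntegrableOn v (Ioo 0 T))
    (h : ∀ φ : ℝ → ℝ, ContDiff ℝ ((⊤ : ℕ∞) : WithTop ℕ∞) φ → HasCompactSupport φ →
      tsupport φ ⊆ Ioo 0 T → ∫ t in Ioo 0 T, deriv φ t • v t = 0) :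
    ∃ c : E, ∀ᵐ t ∂(volume.restrict (Ioo 0 T)), v t = c := by
  -- A fixed test function `η` of mean one. The constant will be `c = ∫ ηv`.
  let bump : ContDiffBump (T / 2) := ⟨T / 8, T / 4, by linarith, by linarith⟩
  set η : ℝ → ℝ := bump.normed volume with hη
  have hηd : ContDiff ℝ ((⊤ : ℕ∞) : WithTop ℕ∞) η := bump.contDiff_normed
  have hηs : tsupport η ⊆ Ioo 0 T := by
    rw [hη, bump.tsupport_normed_eq, Real.closedBall_eq_Icc]
    intro x hx
    change x ∈ Icc (T / 2 - T / 4) (T / 2 + T / 4) at hx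
    exact ⟨by linarith [hx.1], by linarith [hx.2]⟩
  have hηc : HasCompactSupport η := bump.hasCompactSupport_normed
  have hη1 : ∫ t, η t = 1 := bump.integral_normed
  have hint : ∀ ψ : ℝ → ℝ, Continuous ψ → HasCompactSupport ψ → ∀ w : ℝ → E,
      IntegrableOn w (Ioo 0 T) → IntegrableOn (fun t => ψ t • w t) (Ioo 0 T) := by
    intro ψ hψ hψc w hw
    obtain ⟨C, hC⟩ := hψc.exists_bound_of_continuous hψ
    exact hw.bdd_smul C hψ.aestronglyMeasurable (Filter.Eventually.of_forall hC)
  set c : E := ∫ t in Ioo 0 T, η t • v t with hc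
  refine ⟨c, ?_⟩
  have hconst : IntegrableOn (fun _ : ℝ => c) (Ioo 0 T) := by simp
  have hloc : LocallyIntegrableOn (fun t => v t - c) (Ioo 0 T) :=
    (hv.sub hconst).locallyIntegrableOn
  have key := isOpen_Ioo.ae_eq_zero_of_integral_contDiff_smul_eq_zero hloc (fun ψ hψ hψc hψs => ?_)
  · rw [ae_restrict_iff' measurableSet_Ioo]
    filter_upwards [key] with t ht ht'
    exact sub_eq_zero.1 (ht ht')
  · have hset : ∀ ρ : ℝ → ℝ, tsupport ρ ⊆ Ioo 0 T → ∀ w : ℝ → E,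
        ∫ t in Ioo 0 T, ρ t • w t = ∫ t, ρ t • w t := by
      intro ρ hρ w
      refine setIntegral_eq_integral_of_forall_compl_eq_zero fun t ht => ?_
      have : ρ t = 0 := by
        by_contra hne
        exact ht (hρ (subset_tsupport _ hne))
      rw [this, zero_smul]
    set m := ∫ t, ψ t with hm
    -- Removing the mean of `ψ` makes it the derivative of a test function, to which the hypothesis
    -- applies; the result is `∫ ψv = m ∫ ηv`.
    set χ : ℝ → ℝ := fun t => ψ t - m * η t with hχ
    have hiψ := hψ.continuous.integrable_of_hasCompactSupport (μ := volume) hψc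
    have hiη := hηd.continuous.integrable_of_hasCompactSupport (μ := volume) hηc
    have hχs : tsupport χ ⊆ tsupport ψ ∪ tsupport η := by
      refine closure_minimal ?_ ((isClosed_tsupport _).union (isClosed_tsupport _))
      intro t ht
      by_contra hnot
      rw [mem_union, not_or] at hnot
      apply ht
      simp only [hχ, image_eq_zero_of_notMem_tsupport hnot.1,
        image_eq_zero_of_notMem_tsupport hnot.2, mul_zero, sub_zero]
    obtain ⟨φ, h1, h2, h3, h4⟩ := exists_primitive_test hT (χ := χ)
      (hψ.sub (contDiff_const.mul hηd))
      ((hψc.isCompact.union hηc.isCompact).of_isClosed_subset (isClosed_tsupport _) hχs)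
      (hχs.trans (union_subset hψs hηs))
      (by
        rw [hχ, integral_sub hiψ (hiη.const_mul m), integral_const_mul, hη1, mul_one, sub_self])
    have h5 := h φ h1 h2 h3
    rw [h4] at h5
    rw [← hset ψ hψs]
    have e1 : ∀ t, χ t • v t = ψ t • v t - m • (η t • v t) := fun t => by
      rw [hχ, sub_smul, mul_smul]
    simp_rw [e1] at h5
    have hmi : IntegrableOn (fun t => m • (η t • v t)) (Ioo 0 T) :=
      (hint η hηd.continuous hηc v hv).smul m
    rw [integral_sub (hint ψ hψ.continuous hψc v hv) hmi,
      integral_smul] at h5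
    simp_rw [smul_sub]
    rw [integral_sub (hint ψ hψ.continuous hψc v hv) (hint ψ hψ.continuous hψc _ hconst),
      integral_smul_const]
    have e2 : ∫ t in Ioo 0 T, ψ t = m := by
      have : ∫ t in Ioo 0 T, ψ t = ∫ t, ψ t := by
        refine setIntegral_eq_integral_of_forall_compl_eq_zero fun t ht => ?_
        by_contra hne
        exact ht (hψs (subset_tsupport _ hne))
      rw [this]
    rw [e2]
    exact h5

/-- A function with an integrable weak derivative is a.e. equal to a primitive of it. -/
lemma ae_eq_primitive_of_weakDeriv (hT : 0 < T) {g h : ℝ → E}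
    (hg : IntegrableOn g (Ioo 0 T)) (hh : IntegrableOn h (Ioo 0 T))
    (hw : ∀ φ : ℝ → ℝ, ContDiff ℝ ((⊤ : ℕ∞) : WithTop ℕ∞) φ → HasCompactSupport φ →
      tsupport φ ⊆ Ioo 0 T →
      ∫ t in Ioo 0 T, deriv φ t • g t = - ∫ t in Ioo 0 T, φ t • h t) :
    ∃ c : E, ∀ᵐ t ∂(volume.restrict (Ioo 0 T)),
      g t = c + ∫ s in (0 : ℝ)..t, (Ioo 0 T).indicator h s := by
  have hH : Continuous fun t => ∫ s in (0 : ℝ)..t, (Ioo 0 T).indicator h s :=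
    (hh.integrable_indicator measurableSet_Ioo).continuous_primitive 0
  have hHi : IntegrableOn (fun t => ∫ s in (0 : ℝ)..t, (Ioo 0 T).indicator h s) (Ioo 0 T) :=
    (hH.continuousOn.integrableOn_compact isCompact_Icc).mono_set Ioo_subset_Icc_self
  obtain ⟨c, hc⟩ := ae_eq_const_of_integral_deriv_smul_eq_zero hT (hg.sub hHi) fun φ h1 h2 h3 => by
    have hd : Continuous (deriv φ) := h1.continuous_deriv (by simp)
    obtain ⟨C, hC⟩ := h2.deriv.exists_bound_of_continuous hd
    simp only [Pi.sub_apply, smul_sub]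
    have i1 : IntegrableOn (fun t => deriv φ t • g t) (Ioo 0 T) :=
      hg.bdd_smul C hd.aestronglyMeasurable (Filter.Eventually.of_forall hC)
    have i2 : IntegrableOn
        (fun t => deriv φ t • ∫ s in (0 : ℝ)..t, (Ioo 0 T).indicator h s) (Ioo 0 T) :=
      hHi.bdd_smul C hd.aestronglyMeasurable (Filter.Eventually.of_forall hC)
    rw [integral_sub i1 i2, hw φ h1 h2 h3, integral_deriv_smul_primitive hh h1 h2 h3, sub_self]
  refine ⟨c, ?_⟩
  filter_upwards [hc] with t ht
  rw [← ht]
  simp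

/-- A continuous function of class `H³(0, T; X)` is, on `[0, T]`, a `C²` function. -/
lemma exists_contDiff_two_of_memBochnerSobolev (hT : 0 < T) {u : ℝ → E}
    (hu : ContinuousOn u (Icc 0 T)) (h : MemBochnerSobolev 3 T u) :
    ∃ U G₁ G₂ : ℝ → E, (∀ t, HasDerivAt U (G₁ t) t) ∧ (∀ t, HasDerivAt G₁ (G₂ t) t) ∧
      Continuous G₂ ∧ ∀ t ∈ Icc 0 T, u t = U t := by
  obtain ⟨g, hg0, hL, hw⟩ := h
  have hint : ∀ j ≤ 3, IntegrableOn (g j) (Ioo 0 T) := fun j hj =>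
    (hL j hj).integrable (by norm_num)
  -- One integration: if the weak derivative agrees a.e. with a continuous `G`, the function agrees
  -- a.e. with a primitive of `G`. Since `G` is continuous on all of `ℝ`, that primitive has
  -- two-sided derivatives even at `0` and `T`.
  have step : ∀ (a b G : ℝ → E), IntegrableOn a (Ioo 0 T) → Continuous G →
      IntegrableOn b (Ioo 0 T) → (∀ᵐ t ∂(volume.restrict (Ioo 0 T)), b t = G t) →
      (∀ φ : ℝ → ℝ, ContDiff ℝ ((⊤ : ℕ∞) : WithTop ℕ∞) φ → HasCompactSupport φ →
      tsupport φ ⊆ Ioo 0 T →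
      ∫ t in Ioo 0 T, deriv φ t • a t = - ∫ t in Ioo 0 T, φ t • b t) →
      ∃ A : ℝ → E, (∀ t, HasDerivAt A (G t) t) ∧
        ∀ᵐ t ∂(volume.restrict (Ioo 0 T)), a t = A t := by
    intro a b G ha hG hb hbG hab
    obtain ⟨c, hc⟩ := ae_eq_primitive_of_weakDeriv hT ha hb hab
    refine ⟨fun t => c + ∫ s in (0 : ℝ)..t, G s,
      fun t => ((hG.integral_hasStrictDerivAt 0 t).hasDerivAt).const_add c, ?_⟩
    rw [ae_restrict_iff' measurableSet_Ioo] at hc hbG ⊢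
    filter_upwards [hc] with t ht htI
    rw [ht htI]
    congr 1
    refine intervalIntegral.integral_congr_ae ?_
    filter_upwards [hbG] with s hs hsI
    rw [uIoc_of_le htI.1.le] at hsI
    have : s ∈ Ioo 0 T := ⟨hsI.1, hsI.2.trans_lt htI.2⟩
    rw [indicator_of_mem this, hs this]
  obtain ⟨c, hc⟩ := ae_eq_primitive_of_weakDeriv hT (hint 2 (by norm_num)) (hint 3 le_rfl)
    (hw 2 (by norm_num))
  have hG2 := ((hint 3 le_rfl).integrable_indicator measurableSet_Ioo).continuous_primitive 0
  obtain ⟨G₁, hG1, hae1⟩ := step (g 1) (g 2) _ (hint 1 (by norm_num)) (hG2.const_add c)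
    (hint 2 (by norm_num)) hc (hw 1 (by norm_num))
  have hG1c : Continuous G₁ := continuous_iff_continuousAt.2 fun t => (hG1 t).continuousAt
  obtain ⟨U, hU, hae0⟩ := step (g 0) (g 1) G₁ (hint 0 (by norm_num)) hG1c
    (hint 1 (by norm_num)) hae1 (hw 0 (by norm_num))
  refine ⟨U, G₁, _, hU, hG1, hG2.const_add c, ?_⟩
  have hUc : Continuous U := continuous_iff_continuousAt.2 fun t => (hU t).continuousAt
  rw [hg0, restrict_Ioo_eq_restrict_Icc] at hae0
  -- The assumed continuity of `u` upgrades a.e. equality to equality at every time, endpoints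
  -- included.
  exact Measure.eqOn_Icc_of_ae_eq volume hT.ne hae0 hu hUc.continuousOn

end WeakDerivative

/-! ### The ODE satisfied by each Fourier coefficient of the solution. -/

section ModeEquation

variable {L : ℝ}

/-- The real plane wave `cos (2π(ℓx + my)/L + δ)`. -/
noncomputable def cosWave (L : ℝ) (k : ℤ × ℤ) (δ x y : ℝ) : ℝ :=
  Real.cos (2 * Real.pi * (k.1 * x + k.2 * y) / L + δ)

lemma contDiff_cosWave (k : ℤ × ℤ) (δ : ℝ) :
    ContDiff ℝ ((⊤ : ℕ∞) : WithTop ℕ∞) (fun z : ℝ × ℝ => cosWave L k δ z.1 z.2) := by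
  unfold cosWave
  refine Real.contDiff_cos.comp ?_
  fun_prop

lemma cosWave_add_left (hL : L ≠ 0) (k : ℤ × ℤ) (δ x y : ℝ) :
    cosWave L k δ (x + L) y = cosWave L k δ x y := by
  unfold cosWave
  have : 2 * Real.pi * (k.1 * (x + L) + k.2 * y) / L + δ
      = (2 * Real.pi * (k.1 * x + k.2 * y) / L + δ) + k.1 * (2 * Real.pi) := by
    field_simp; ring
  rw [this, Real.cos_add_int_mul_two_pi]

lemma cosWave_add_right (hL : L ≠ 0) (k : ℤ × ℤ) (δ x y : ℝ) :
    cosWave L k δ x (y + L) = cosWave L k δ x y := by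
  unfold cosWave
  have : 2 * Real.pi * (k.1 * x + k.2 * (y + L)) / L + δ
      = (2 * Real.pi * (k.1 * x + k.2 * y) / L + δ) + k.2 * (2 * Real.pi) := by
    field_simp; ring
  rw [this, Real.cos_add_int_mul_two_pi]

lemma iteratedDeriv_two_cos_affine (c a b x : ℝ) :
    iteratedDeriv 2 (fun x => c * Real.cos (a * x + b)) x = -a ^ 2 * (c * Real.cos (a * x + b)) := by
  have h0 : ∀ x : ℝ, HasDerivAt (fun x => a * x + b) a x := fun x => by
    simpa using ((hasDerivAt_id x).const_mul a).add_const b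
  have h1 : deriv (fun x => c * Real.cos (a * x + b)) = fun x => c * (-Real.sin (a * x + b) * a) :=
    funext fun x => (((h0 x).cos).const_mul c).deriv
  have h2 : deriv (fun x => c * (-Real.sin (a * x + b) * a)) x
      = c * (-(Real.cos (a * x + b) * a) * a) :=
    ((((h0 x).sin).neg.mul_const a).const_mul c).deriv
  rw [iteratedDeriv_succ, iteratedDeriv_one, h1, h2]
  ring

/-- The free factor `c` makes the identity iterable, so two applications give `(Δ+1)²`. -/
lemma laplacianAddOne_cosWave (c : ℝ) (k : ℤ × ℤ) (δ : ℝ) :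
    laplacianAddOne (fun x y => c * cosWave L k δ x y)
      = fun x y => ((1 - lam L k) * c) * cosWave L k δ x y := by
  ext x y
  simp only [laplacianAddOne, laplacian, cosWave]
  have e1 : (fun a : ℝ => c * Real.cos (2 * Real.pi * (k.1 * a + k.2 * y) / L + δ))
      = fun a => c * Real.cos (2 * Real.pi * k.1 / L * a + (2 * Real.pi * k.2 * y / L + δ)) := by
    ext a; congr 2; ring
  have e2 : (fun b : ℝ => c * Real.cos (2 * Real.pi * (k.1 * x + k.2 * b) / L + δ))
      = fun b => c * Real.cos (2 * Real.pi * k.2 / L * b + (2 * Real.pi * k.1 * x / L + δ)) := by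
    ext a; congr 2; ring
  rw [e1, e2, iteratedDeriv_two_cos_affine, iteratedDeriv_two_cos_affine]
  have e3 : 2 * Real.pi * k.1 / L * x + (2 * Real.pi * k.2 * y / L + δ)
      = 2 * Real.pi * (k.1 * x + k.2 * y) / L + δ := by ring
  have e4 : 2 * Real.pi * k.2 / L * y + (2 * Real.pi * k.1 * x / L + δ)
      = 2 * Real.pi * (k.1 * x + k.2 * y) / L + δ := by ring
  rw [e3, e4]
  unfold lam
  ring

/-- Admissible test functions are real, so the complex character is reached through the phases `0`
and `π/2`, the latter giving `-sin`. -/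
lemma wave_neg_eq (k : ℤ × ℤ) (x y : ℝ) :
    wave L (-k) x y = (cosWave L k 0 x y : ℂ) + Complex.I * (cosWave L k (Real.pi / 2) x y : ℂ) := by
  have h : wave L (-k) x y
      = Complex.exp (((-(2 * Real.pi * (k.1 * x + k.2 * y) / L) : ℝ) : ℂ) * Complex.I) := by
    unfold wave
    congr 1
    push_cast [Prod.fst_neg, Prod.snd_neg]
    ring
  rw [h, Complex.exp_mul_I, ← Complex.ofReal_cos, ← Complex.ofReal_sin, cosWave, cosWave, add_zero,
    Real.cos_add_pi_div_two, Real.cos_neg, Real.sin_neg]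
  push_cast
  ring

lemma pairing_const_mul (w ψ : ℝ → ℝ → ℝ) (c : ℝ) :
    pairing L w (fun x y => c * ψ x y) = c * pairing L w ψ := by
  unfold pairing
  simp_rw [mul_left_comm _ c, intervalIntegral.integral_const_mul]

/-- The periodic function of two real variables given by a function on the torus. -/
noncomputable def onPlane (f : C(Torus L, ℝ)) (x y : ℝ) : ℝ :=
  f ((x : AddCircle L), (y : AddCircle L))

/-- The nonlinearity `f(u) = u³ - εu` on continuous functions. -/
noncomputable def nonlinC (ε : ℝ) (f : C(Torus L, ℝ)) : C(Torus L, ℝ) := f * f * f - ε • f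

lemma nonlinC_apply (ε : ℝ) (f : C(Torus L, ℝ)) (x : Torus L) :
    nonlinC ε f x = nonlin ε (f x) := by
  simp only [nonlinC, nonlin, ContinuousMap.sub_apply, ContinuousMap.mul_apply,
    ContinuousMap.smul_apply, smul_eq_mul]
  ring

/-- The first time derivative of `f(U)` in direction `G`. -/
noncomputable def nonlinC₁ (ε : ℝ) (U G : C(Torus L, ℝ)) : C(Torus L, ℝ) :=
  (3 : ℝ) • (U * U * G) - ε • G

/-- The second time derivative of `f(U)`. -/
noncomputable def nonlinC₂ (ε : ℝ) (U G₁ G₂ : C(Torus L, ℝ)) : C(Torus L, ℝ) :=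
  (3 : ℝ) • (U * U * G₂) + (6 : ℝ) • (U * G₁ * G₁) - ε • G₂

lemma continuous_nonlinC (ε : ℝ) {U : ℝ → C(Torus L, ℝ)} (hU : Continuous U) :
    Continuous fun t => nonlinC ε (U t) :=
  ((hU.mul hU).mul hU).sub (hU.const_smul ε)

lemma continuous_nonlinC₁ (ε : ℝ) {U G : ℝ → C(Torus L, ℝ)} (hU : Continuous U)
    (hG : Continuous G) : Continuous fun t => nonlinC₁ ε (U t) (G t) :=
  (((hU.mul hU).mul hG).const_smul (3 : ℝ)).sub (hG.const_smul ε)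

lemma continuous_nonlinC₂ (ε : ℝ) {U G G₂ : ℝ → C(Torus L, ℝ)} (hU : Continuous U)
    (hG : Continuous G) (hG₂ : Continuous G₂) :
    Continuous fun t => nonlinC₂ ε (U t) (G t) (G₂ t) :=
  ((((hU.mul hU).mul hG₂).const_smul (3 : ℝ)).add
    (((hU.mul hG).mul hG).const_smul (6 : ℝ))).sub (hG₂.const_smul ε)

lemma torusCoeff_eq_pairing (f : C(Torus L, ℝ)) (k : ℤ × ℤ) :
    torusCoeff L f k = 1 / (L : ℂ) ^ 2 * ((pairing L (onPlane f) (cosWave L k 0) : ℂ)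
      + Complex.I * (pairing L (onPlane f) (cosWave L k (Real.pi / 2)) : ℂ)) := by
  have hf : Continuous fun z : ℝ × ℝ => onPlane f z.1 z.2 := by
    unfold onPlane
    refine f.continuous.comp (Continuous.prodMk ?_ ?_)
    · exact (AddCircle.continuous_mk' L).comp (by fun_prop)
    · exact (AddCircle.continuous_mk' L).comp (by fun_prop)
  have hc : ∀ δ, Continuous fun z : ℝ × ℝ =>
      ((onPlane f z.1 z.2 * cosWave L k δ z.1 z.2 : ℝ) : ℂ) := fun δ =>
    Complex.continuous_ofReal.comp (hf.mul (contDiff_cosWave k δ).continuous)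
  have hin : ∀ δ x, IntervalIntegrable (fun y => ((onPlane f x y * cosWave L k δ x y : ℝ) : ℂ))
      volume 0 L := fun δ x => by
    refine Continuous.intervalIntegrable ?_ _ _
    exact (hc δ).comp (by fun_prop : Continuous fun y : ℝ => (x, y))
  have hout : ∀ δ, IntervalIntegrable
      (fun x => ∫ y in (0 : ℝ)..L, ((onPlane f x y * cosWave L k δ x y : ℝ) : ℂ)) volume 0 L :=
    fun δ => Continuous.intervalIntegrable
      (intervalIntegral.continuous_parametric_intervalIntegral_of_continuous'
        (f := fun x y => ((onPlane f x y * cosWave L k δ x y : ℝ) : ℂ)) (hc δ) _ _) _ _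
  unfold torusCoeff pairing
  congr 1
  simp_rw [← intervalIntegral.integral_ofReal, ← intervalIntegral.integral_const_mul]
  rw [← intervalIntegral.integral_add (hout _)
    (by simp_rw [intervalIntegral.integral_const_mul]; exact (hout _).const_mul _)]
  refine intervalIntegral.integral_congr fun x _ => ?_
  rw [← intervalIntegral.integral_add (hin _ _) ((hin _ _).const_mul _)]
  refine intervalIntegral.integral_congr fun y _ => ?_
  simp only [wave_neg_eq, onPlane]
  push_cast
  ring

variable [hL : Fact (0 < L)]

/-- Plane waves are eigenfunctions of `(Δ+1)²`; testing the distributional equation with the two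
phases gives the real and imaginary parts of the mode equation. -/
lemma IsSolution.hasDerivAt_torusCoeff {T ε : ℝ} {u : ℝ → C(Torus L, ℝ)}
    (hu : IsSolution L T ε u) (k : ℤ × ℤ) {t : ℝ} (ht : t ∈ Ioo 0 T) :
    HasDerivAt (fun s => torusCoeff L (u s) k)
      (-((lam L k - 1) ^ 2 : ℝ) * torusCoeff L (u t) k - torusCoeff L (nonlinC ε (u t)) k) t := by
  have h : ∀ δ : ℝ, HasDerivAt (fun s => pairing L (onPlane (u s)) (cosWave L k δ))
      (-((lam L k - 1) ^ 2 * pairing L (onPlane (u t)) (cosWave L k δ))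
        - pairing L (onPlane (nonlinC ε (u t))) (cosWave L k δ)) t := by
    intro δ
    have h1 := hu (cosWave L k δ) (contDiff_cosWave k δ) (cosWave_add_left hL.out.ne' k δ)
      (cosWave_add_right hL.out.ne' k δ) t ht
    have h2 : laplacianAddOne (laplacianAddOne (cosWave L k δ))
        = fun x y => (lam L k - 1) ^ 2 * cosWave L k δ x y := by
      have h3 := laplacianAddOne_cosWave (L := L) 1 k δ
      simp only [one_mul, mul_one] at h3
      change laplacianAddOne (laplacianAddOne (fun x y => cosWave L k δ x y)) = _
      rw [h3, laplacianAddOne_cosWave]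
      ext x y
      ring
    rw [h2, pairing_const_mul] at h1
    convert! h1 using 3
    ext x y
    exact nonlinC_apply _ _ _
  have h0 := (((h 0).ofReal_comp).add (((h (Real.pi / 2)).ofReal_comp).const_mul Complex.I)).const_mul
    (1 / (L : ℂ) ^ 2)
  simp only [torusCoeff_eq_pairing]
  convert! h0 using 1
  push_cast
  ring

lemma hasDerivAt_nonlinC (ε : ℝ) {U : ℝ → C(Torus L, ℝ)} {G : C(Torus L, ℝ)} {t : ℝ}
    (h : HasDerivAt U G t) : HasDerivAt (fun s => nonlinC ε (U s)) (nonlinC₁ ε (U t) G) t := by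
  have h1 := ((h.mul h).mul h).sub (h.const_smul ε)
  convert! h1 using 1
  ext x
  simp only [nonlinC₁, ContinuousMap.sub_apply, ContinuousMap.smul_apply, ContinuousMap.mul_apply,
    ContinuousMap.add_apply, Pi.mul_apply, smul_eq_mul]
  ring

lemma hasDerivAt_nonlinC₁ (ε : ℝ) {U G : ℝ → C(Torus L, ℝ)} {G₂ : C(Torus L, ℝ)} {t : ℝ}
    (h : HasDerivAt U (G t) t) (hG : HasDerivAt G G₂ t) :
    HasDerivAt (fun s => nonlinC₁ ε (U s) (G s)) (nonlinC₂ ε (U t) (G t) G₂) t := by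
  have h1 := (((h.mul h).mul hG).const_smul (3 : ℝ)).sub (hG.const_smul ε)
  convert! h1 using 1
  ext x
  simp only [nonlinC₂, ContinuousMap.sub_apply, ContinuousMap.smul_apply, ContinuousMap.mul_apply,
    ContinuousMap.add_apply, Pi.mul_apply, smul_eq_mul]
  ring

lemma eqOn_Icc_of_eqOn_Ioo {E : Type*} [TopologicalSpace E] [T2Space E] {T : ℝ} (hT : 0 < T)
    {f g : ℝ → E} (hf : Continuous f) (hg : Continuous g) (h : ∀ t ∈ Ioo 0 T, f t = g t) :
    ∀ t ∈ Icc 0 T, f t = g t := by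
  have hcl : IsClosed {t | f t = g t} := isClosed_eq hf hg
  have := closure_minimal (s := Ioo 0 T) h hcl
  rw [closure_Ioo hT.ne] at this
  exact this

lemma continuous_torusCoeff {U : ℝ → C(Torus L, ℝ)} (hU : Continuous U) (k : ℤ × ℤ) :
    Continuous fun t => torusCoeff L (U t) k :=
  (torusCoeffCLM L k).continuous.comp hU

lemma hasDerivAt_coeff_comp {U : ℝ → C(Torus L, ℝ)} {G : C(Torus L, ℝ)} {t : ℝ}
    (hU : HasDerivAt U G t) (k : ℤ × ℤ) :
    HasDerivAt (fun s => torusCoeff L (U s) k) (torusCoeff L G k) t :=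
  (torusCoeffCLM L k).hasFDerivAt.comp_hasDerivAt t hU

/-- The Fourier coefficients of the solution satisfy the mode equations up to the endpoints. -/
lemma IsSolution.torusCoeff_deriv {T ε : ℝ} (hT : 0 < T) {u U G₁ : ℝ → C(Torus L, ℝ)}
    (hu : IsSolution L T ε u) (hU : ∀ t, HasDerivAt U (G₁ t) t) (hG₁ : Continuous G₁)
    (huU : ∀ t ∈ Icc 0 T, u t = U t) (k : ℤ × ℤ) :
    ∀ t ∈ Icc 0 T, torusCoeff L (G₁ t) k
      = -((lam L k - 1) ^ 2 : ℝ) * torusCoeff L (U t) k - torusCoeff L (nonlinC ε (U t)) k := by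
  have hUc : Continuous U := continuous_iff_continuousAt.2 fun t => (hU t).continuousAt
  refine eqOn_Icc_of_eqOn_Ioo hT (continuous_torusCoeff hG₁ k)
    ((continuous_const.mul (continuous_torusCoeff hUc k)).sub
      (continuous_torusCoeff (continuous_nonlinC ε hUc) k)) fun t ht => ?_
  have h1 := hu.hasDerivAt_torusCoeff k ht
  rw [huU t (Ioo_subset_Icc_self ht)] at h1
  -- Two derivatives of the same coefficient: one through the `C⁰`-valued derivative of `U`, one
  -- through the weak equation.
  refine (hasDerivAt_coeff_comp (hU t) k).unique (h1.congr_of_eventuallyEq ?_)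
  filter_upwards [isOpen_Ioo.mem_nhds ht] with s hs
  rw [huU s (Ioo_subset_Icc_self hs)]

/-- The differentiated mode equations. -/
lemma IsSolution.torusCoeff_deriv_two {T ε : ℝ} (hT : 0 < T) {u U G₁ G₂ : ℝ → C(Torus L, ℝ)}
    (hu : IsSolution L T ε u) (hU : ∀ t, HasDerivAt U (G₁ t) t)
    (hG₁ : ∀ t, HasDerivAt G₁ (G₂ t) t) (hG₂ : Continuous G₂)
    (huU : ∀ t ∈ Icc 0 T, u t = U t) (k : ℤ × ℤ) :
    ∀ t ∈ Icc 0 T, torusCoeff L (G₂ t) k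
      = -((lam L k - 1) ^ 2 : ℝ) * torusCoeff L (G₁ t) k
        - torusCoeff L (nonlinC₁ ε (U t) (G₁ t)) k := by
  have hUc : Continuous U := continuous_iff_continuousAt.2 fun t => (hU t).continuousAt
  have hG₁c : Continuous G₁ := continuous_iff_continuousAt.2 fun t => (hG₁ t).continuousAt
  refine eqOn_Icc_of_eqOn_Ioo hT (continuous_torusCoeff hG₂ k)
    ((continuous_const.mul (continuous_torusCoeff hG₁c k)).sub
      (continuous_torusCoeff (continuous_nonlinC₁ ε hUc hG₁c) k)) fun t ht => ?_
  have h1 := ((hasDerivAt_coeff_comp (hU t) k).const_mul (-((lam L k - 1) ^ 2 : ℝ) : ℂ)).sub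
    (hasDerivAt_coeff_comp (hasDerivAt_nonlinC ε (hU t)) k)
  refine (hasDerivAt_coeff_comp (hG₁ t) k).unique (h1.congr_of_eventuallyEq ?_)
  filter_upwards [isOpen_Ioo.mem_nhds ht] with s hs
  exact hu.torusCoeff_deriv hT hU hG₁c huU k s (Ioo_subset_Icc_self hs)

end ModeEquation

/-! ### Uniform-in-time Sobolev bounds for the solution and its time derivative. -/

section Regularity

variable {L : ℝ} [hL : Fact (0 < L)]

lemma SobBound.torusCoeff_mul {s A B : ℝ} (hs : 2 ≤ s) {f g : C(Torus L, ℝ)}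
    (hf : SobBound L s (torusCoeff L f) A) (hg : SobBound L s (torusCoeff L g) B) :
    SobBound L s (torusCoeff L (f * g)) (2 * 4 ^ s * wtSum L * (A * B)) :=
  hf.conv hL.out hs hg (hasSum_torusCoeff_mul f g)

lemma SobBound.torusCoeff_smul {s A : ℝ} {f : C(Torus L, ℝ)}
    (hf : SobBound L s (torusCoeff L f) A) (r : ℝ) :
    SobBound L s (torusCoeff L (r • f)) (r ^ 2 * A) := by
  have := hf.smul r
  rwa [funext fun k => (SwiftHohenberg.torusCoeff_smul r f k).symm] at this

lemma SobBound.torusCoeff_add {s A B : ℝ} {f g : C(Torus L, ℝ)}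
    (hf : SobBound L s (torusCoeff L f) A) (hg : SobBound L s (torusCoeff L g) B) :
    SobBound L s (torusCoeff L (f + g)) (2 * A + 2 * B) := by
  have := hf.add hg
  rwa [show torusCoeff L f + torusCoeff L g = torusCoeff L (f + g) from
    funext fun k => (SwiftHohenberg.torusCoeff_add f g k).symm] at this

lemma SobBound.torusCoeff_sub {s A B : ℝ} {f g : C(Torus L, ℝ)}
    (hf : SobBound L s (torusCoeff L f) A) (hg : SobBound L s (torusCoeff L g) B) :
    SobBound L s (torusCoeff L (f - g)) (2 * A + 2 * B) := by
  have := hf.torusCoeff_add (hg.torusCoeff_smul (-1))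
  rw [show f + (-1 : ℝ) • g = f - g by rw [neg_one_smul, sub_eq_add_neg]] at this
  simpa using this

/-- The point is the order of quantifiers: `B` depends on the size of `f` only, so one bound serves
all times. -/
lemma exists_sobBound_nonlinC {s A : ℝ} (hs : 2 ≤ s) (ε : ℝ) :
    ∃ B, ∀ f : C(Torus L, ℝ), SobBound L s (torusCoeff L f) A →
      SobBound L s (torusCoeff L (nonlinC ε f)) B :=
  ⟨_, fun _ hf => ((hf.torusCoeff_mul hs hf).torusCoeff_mul hs hf).torusCoeff_sub
    (hf.torusCoeff_smul ε)⟩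

lemma exists_sobBound_nonlinC₁ {s A A' : ℝ} (hs : 2 ≤ s) (ε : ℝ) :
    ∃ B, ∀ f g : C(Torus L, ℝ), SobBound L s (torusCoeff L f) A →
      SobBound L s (torusCoeff L g) A' → SobBound L s (torusCoeff L (nonlinC₁ ε f g)) B :=
  ⟨_, fun _ _ hf hg => (((hf.torusCoeff_mul hs hf).torusCoeff_mul hs hg).torusCoeff_smul
    3).torusCoeff_sub (hg.torusCoeff_smul ε)⟩

/-- Essentially bounded Sobolev norms are bounded at every time, for a continuous function. -/
lemma MemLinftyHs.exists_sobBound {T s : ℝ} (hT : 0 < T) {u U : ℝ → C(Torus L, ℝ)}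
    (h : MemLinftyHs L T s u) (hU : Continuous U) (huU : ∀ t ∈ Icc 0 T, u t = U t) :
    ∃ B, ∀ t ∈ Icc 0 T, SobBound L s (torusCoeff L (U t)) B := by
  obtain ⟨v, hv, hmem⟩ := h
  set M := (eLpNorm v ⊤ (volume.restrict (Ioo 0 T))).toReal with hM
  have hbd : ∀ᵐ t ∂(volume.restrict (Ioo 0 T)), ‖v t‖ ≤ M := by
    have := ae_le_eLpNormEssSup (f := v) (μ := volume.restrict (Ioo 0 T))
    filter_upwards [this] with t ht
    rw [← eLpNorm_exponent_top] at ht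
    have h2 := ENNReal.toReal_mono hmem.2.ne ht
    rwa [toReal_enorm] at h2
  refine ⟨M ^ 2, fun t ht F => ?_⟩
  -- Finite partial sums are continuous in time, although the full `H^s` norm need not be; this is
  -- why an a.e. bound extends to every `t`.
  set Φ : ℝ → ℝ := fun t => ∑ k ∈ F, wt L k ^ s * ‖torusCoeff L (U t) k‖ ^ 2 with hΦ
  have hΦc : Continuous Φ := continuous_finsetSum _ fun k _ =>
    continuous_const.mul ((continuous_torusCoeff hU k).norm.pow 2)
  have hae : ∀ᵐ t ∂(volume.restrict (Ioo 0 T)), Φ t ≤ M ^ 2 := by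
    filter_upwards [hv, hbd, ae_restrict_mem measurableSet_Ioo] with t h1 h2 h3
    have h4 := lp.sum_rpow_le_norm_rpow (p := 2) (by norm_num) (v t) F
    simp only [ENNReal.toReal_ofNat, Real.rpow_two] at h4
    refine le_trans (le_of_eq ?_) (h4.trans (by gcongr))
    refine Finset.sum_congr rfl fun k _ => ?_
    change _ = ‖(v t) k‖ ^ 2
    have h1k : (v t) k = ((wt L k ^ (s / 2) : ℝ) : ℂ) * torusCoeff L (u t) k := h1 k
    rw [h1k, norm_mul, mul_pow, Complex.norm_real, huU t (Ioo_subset_Icc_self h3),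
      Real.norm_of_nonneg (Real.rpow_nonneg (wt_pos k).le _)]
    congr 1
    rw [← Real.rpow_natCast, ← Real.rpow_mul (wt_pos k).le]
    congr 1
    push_cast
    ring
  -- The inequality `Φ ≤ M²` is recast as an equality of continuous functions, which passes from
  -- almost every time to all of `[0, T]`.
  have h5 : (fun t => max (Φ t) (M ^ 2)) =ᵐ[volume.restrict (Icc 0 T)] fun _ => M ^ 2 := by
    rw [← restrict_Ioo_eq_restrict_Icc]
    filter_upwards [hae] with t ht
    exact max_eq_right ht
  have h6 := Measure.eqOn_Icc_of_ae_eq volume hT.ne h5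
    (hΦc.max continuous_const).continuousOn continuousOn_const ht
  exact max_eq_right_iff.1 h6

/-- Functions whose image under `(Δ + 1)²` is bounded are bounded in `H⁴`. -/
lemma sobBound_four_of_eq {f g : C(Torus L, ℝ)} {M : ℝ} (hf : ‖f‖ ≤ M) (hg : ‖g‖ ≤ M)
    (h : ∀ k, torusCoeff L g k = ((lam L k - 1) ^ 2 : ℝ) * torusCoeff L f k) :
    SobBound L 4 (torusCoeff L f) (136 * M ^ 2) := fun F => by
  calc ∑ k ∈ F, wt L k ^ (4 : ℝ) * ‖torusCoeff L f k‖ ^ 2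
      ≤ ∑ k ∈ F, (8 * ‖torusCoeff L g k‖ ^ 2 + 128 * ‖torusCoeff L f k‖ ^ 2) := by
        refine Finset.sum_le_sum fun k _ => ?_
        rw [h k, norm_mul, Complex.norm_real, mul_pow, Real.norm_eq_abs, sq_abs]
        -- With `x = (λ-1)²`, the bound is `(2x+8)² ≤ 8x² + 128`; hence the constant `136 = 8 +
        -- 128`.
        have h1 : wt L k ^ (4 : ℝ) ≤ 8 * ((lam L k - 1) ^ 2) ^ 2 + 128 := by
          have h2 := wt_sq_le (L := L) k
          have h3 : wt L k ^ (4 : ℝ) = (wt L k ^ 2) ^ 2 := by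
            rw [← pow_mul, ← Real.rpow_natCast]; norm_num
          rw [h3]
          have h4 : 0 ≤ wt L k ^ 2 := sq_nonneg _
          nlinarith [sq_nonneg (2 * (lam L k - 1) ^ 2 - 8)]
        nlinarith [sq_nonneg ‖torusCoeff L f k‖]
    _ = 8 * ∑ k ∈ F, ‖torusCoeff L g k‖ ^ 2 + 128 * ∑ k ∈ F, ‖torusCoeff L f k‖ ^ 2 := by
        rw [Finset.sum_add_distrib, ← Finset.mul_sum, ← Finset.mul_sum]
    _ ≤ 8 * M ^ 2 + 128 * M ^ 2 := by
        have h1 := sum_norm_torusCoeff_sq_le f F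
        have h2 := sum_norm_torusCoeff_sq_le g F
        have h3 : ‖f‖ ^ 2 ≤ M ^ 2 := by gcongr
        have h4 : ‖g‖ ^ 2 ≤ M ^ 2 := by gcongr
        linarith
    _ = _ := by ring

/-- Everything that the error analysis uses about the exact solution. -/
structure ExactData (L : ℝ) [Fact (0 < L)] (T ε s M : ℝ) (U G₁ G₂ : ℝ → C(Torus L, ℝ)) : Prop where
  deriv_U : ∀ t, HasDerivAt U (G₁ t) t
  deriv_G₁ : ∀ t, HasDerivAt G₁ (G₂ t) t
  mode : ∀ k, ∀ t ∈ Icc 0 T, torusCoeff L (G₁ t) k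
    = -((lam L k - 1) ^ 2 : ℝ) * torusCoeff L (U t) k - torusCoeff L (nonlinC ε (U t)) k
  norm_U : ∀ t ∈ Icc 0 T, ‖U t‖ ≤ M
  norm_G₁ : ∀ t ∈ Icc 0 T, ‖G₁ t‖ ≤ M
  norm_G₂ : ∀ t ∈ Icc 0 T, ‖G₂ t‖ ≤ M
  norm_nonlinC₁ : ∀ t ∈ Icc 0 T, ‖nonlinC₁ ε (U t) (G₁ t)‖ ≤ M
  norm_nonlinC₂ : ∀ t ∈ Icc 0 T, ‖nonlinC₂ ε (U t) (G₁ t) (G₂ t)‖ ≤ M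
  sob_U : ∀ t ∈ Icc 0 T, SobBound L s (torusCoeff L (U t)) M
  sob_nonlinC : ∀ t ∈ Icc 0 T, SobBound L s (torusCoeff L (nonlinC ε (U t))) M
  sob_G₁ : ∀ t ∈ Icc 0 T, SobBound L 4 (torusCoeff L (G₁ t)) M
  sob_nonlinC₁ : ∀ t ∈ Icc 0 T, SobBound L 4 (torusCoeff L (nonlinC₁ ε (U t) (G₁ t))) M

/-- The `H⁴` bound on `∂ₜu` is not read off the regularity class: the time-differentiated equation
expresses `(Δ+1)²∂ₜu` through functions bounded in `C⁰`, and elliptic regularity in Fourier space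
does the rest. -/
lemma exists_exactData {T ε m₀ : ℝ} (hT : 0 < T) (hm₀ : 0 ≤ m₀) {u : ℝ → C(Torus L, ℝ)}
    (hcont : ContinuousOn u (Icc 0 T)) (hsol : IsSolution L T ε u)
    (hreg : RegularityClass L T m₀ u) :
    ∃ (M : ℝ) (U G₁ G₂ : ℝ → C(Torus L, ℝ)), 0 < M ∧ ExactData L T ε (m₀ + 4) M U G₁ G₂ ∧
      ∀ t ∈ Icc 0 T, u t = U t := by
  obtain ⟨U, G₁, G₂, hU, hG₁, hG₂, huU⟩ :=
    exists_contDiff_two_of_memBochnerSobolev hT hcont hreg.1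
  have hUc : Continuous U := continuous_iff_continuousAt.2 fun t => (hU t).continuousAt
  have hG₁c : Continuous G₁ := continuous_iff_continuousAt.2 fun t => (hG₁ t).continuousAt
  have hbd : ∀ g : ℝ → C(Torus L, ℝ), Continuous g → ∃ C, ∀ t ∈ Icc 0 T, ‖g t‖ ≤ C :=
    fun g hg => isCompact_Icc.exists_bound_of_continuousOn hg.continuousOn
  obtain ⟨M0, h0⟩ := hbd _ hUc
  obtain ⟨M1, h1⟩ := hbd _ hG₁c
  obtain ⟨M2, h2⟩ := hbd _ hG₂
  obtain ⟨M3, h3⟩ := hbd _ (continuous_nonlinC₁ ε hUc hG₁c)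
  obtain ⟨M4, h4⟩ := hbd _ (continuous_nonlinC₂ ε hUc hG₁c hG₂)
  obtain ⟨S0, s0⟩ := hreg.2.2.exists_sobBound hT hUc huU
  obtain ⟨S1, s1⟩ := exists_sobBound_nonlinC (L := L) (s := m₀ + 4) (A := S0) (by linarith) ε
  -- A bound for `(Δ+1)²∂ₜu`, in the form given by the differentiated equation.
  obtain ⟨M5, h5⟩ := hbd _ (hG₂.neg.sub (continuous_nonlinC₁ ε hUc hG₁c))
  have s2 : ∀ t ∈ Icc 0 T, SobBound L 4 (torusCoeff L (G₁ t)) (136 * (max M1 M5) ^ 2) := by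
    intro t ht
    refine sobBound_four_of_eq (g := -G₂ t - nonlinC₁ ε (U t) (G₁ t))
      ((h1 t ht).trans (le_max_left _ _)) ((h5 t ht).trans (le_max_right _ _)) fun k => ?_
    have e := hsol.torusCoeff_deriv_two hT hU hG₁ hG₂ huU k t ht
    have e2 := map_sub (torusCoeffCLM L k) (-G₂ t) (nonlinC₁ ε (U t) (G₁ t))
    rw [map_neg] at e2
    simp only [torusCoeffCLM_apply] at e2
    rw [e2, e]
    ring
  obtain ⟨S3, s3⟩ := exists_sobBound_nonlinC₁ (L := L) (s := 4) (A := S0)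
    (A' := 136 * (max M1 M5) ^ 2) (by norm_num) ε
  set S2 := 136 * (max M1 M5) ^ 2
  refine ⟨1 + |M0| + |M1| + |M2| + |M3| + |M4| + |S0| + |S1| + |S2| + |S3|, U, G₁, G₂,
    by positivity, ⟨hU, hG₁, fun k => hsol.torusCoeff_deriv hT hU hG₁c huU k, ?_, ?_, ?_, ?_, ?_,
      ?_, ?_, ?_, ?_⟩, huU⟩
  all_goals
    have := abs_nonneg M0; have := abs_nonneg M1; have := abs_nonneg M2; have := abs_nonneg M3
    have := abs_nonneg M4; have := abs_nonneg S0; have := abs_nonneg S1; have := abs_nonneg S2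
    have := abs_nonneg S3
    intro t ht
  · linarith [h0 t ht, le_abs_self M0]
  · linarith [h1 t ht, le_abs_self M1]
  · linarith [h2 t ht, le_abs_self M2]
  · linarith [h3 t ht, le_abs_self M3]
  · linarith [h4 t ht, le_abs_self M4]
  · exact (s0 t ht).mono (by linarith [le_abs_self S0])
  · exact (s1 _ (s0 t ht)).mono (by linarith [le_abs_self S1])
  · exact (s2 t ht).mono (by linarith [le_abs_self S2])
  · exact (s3 _ _ ((s0 t ht).mono_exp (by linarith)) (s2 t ht)).mono (by linarith [le_abs_self S3])

end Regularity

/-! ### Discrete Fourier analysis and the discrete Sobolev inequality. -/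

section GridFourier

variable {L : ℝ} {K : ℕ}

/-- The character `j ↦ e^{2πij/(2K+1)}`. -/
noncomputable def rootPow (K : ℕ) (j : ℤ) : ℂ :=
  Complex.exp (2 * Real.pi * Complex.I * j / (2 * K + 1))

lemma two_mul_add_one_ne_zero_complex : (2 * K + 1 : ℂ) ≠ 0 := by
  exact_mod_cast (Nat.succ_ne_zero (2 * K))

lemma rootPow_add (i j : ℤ) : rootPow K (i + j) = rootPow K i * rootPow K j := by
  unfold rootPow
  rw [← Complex.exp_add]
  congr 1
  push_cast
  ring

lemma rootPow_zero : rootPow K 0 = 1 := by simp [rootPow]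

lemma rootPow_neg (j : ℤ) : rootPow K (-j) = star (rootPow K j) := by
  unfold rootPow
  rw [RCLike.star_def, ← Complex.exp_conj]
  congr 1
  simp only [map_div₀, map_mul, map_add, map_one, Complex.conj_I, Complex.conj_ofReal, map_ofNat,
    map_natCast, map_intCast]
  push_cast
  ring

lemma rootPow_mul_nat (j : ℤ) (n : ℕ) : rootPow K (j * n) = rootPow K j ^ n := by
  unfold rootPow
  rw [← Complex.exp_nat_mul]
  congr 1
  push_cast
  ring

lemma rootPow_eq_one_iff (j : ℤ) : rootPow K j = 1 ↔ ((2 * K + 1 : ℕ) : ℤ) ∣ j := by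
  have hN := two_mul_add_one_ne_zero_complex (K := K)
  unfold rootPow
  rw [Complex.exp_eq_one_iff]
  constructor
  · rintro ⟨n, hn⟩
    refine ⟨n, ?_⟩
    have h2 : (2 * Real.pi * Complex.I : ℂ) ≠ 0 := Complex.two_pi_I_ne_zero
    have : (j : ℂ) = (2 * K + 1) * n := by
      rw [div_eq_iff hN] at hn
      apply mul_left_cancel₀ h2
      rw [hn]; ring
    exact_mod_cast this
  · rintro ⟨n, rfl⟩
    refine ⟨n, ?_⟩
    push_cast
    field_simp

lemma sum_range_rootPow (j : ℤ) (hj : ¬ ((2 * K + 1 : ℕ) : ℤ) ∣ j) :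
    ∑ n ∈ Finset.range (2 * K + 1), rootPow K (j * n) = 0 := by
  have h1 : rootPow K j ≠ 1 := fun h => hj ((rootPow_eq_one_iff j).1 h)
  have h2 : rootPow K j ^ (2 * K + 1) = 1 := by
    rw [← rootPow_mul_nat, rootPow_eq_one_iff]
    exact Dvd.intro_left j rfl
  simp_rw [rootPow_mul_nat]
  rw [geom_sum_eq h1, h2, sub_self, zero_div]

/-- Orthogonality of the characters over the grid points, in one dimension. -/
lemma sum_fin_rootPow {a b : ℤ} (ha : a ∈ Finset.Icc (-(K : ℤ)) K)
    (hb : b ∈ Finset.Icc (-(K : ℤ)) K) :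
    ∑ p : Fin (2 * K + 1), rootPow K ((a - b) * (p : ℕ)) = if a = b then (2 * K + 1 : ℂ) else 0 := by
  rw [Finset.mem_Icc] at ha hb
  rw [Fin.sum_univ_eq_sum_range (fun n => rootPow K ((a - b) * (n : ℕ)))]
  split_ifs with h
  · subst h
    simp [rootPow_zero]
  -- Two frequencies of the box differ by at most `2K`, so they are congruent modulo `2K+1` only if
  -- equal.
  · refine sum_range_rootPow _ fun hd => ?_
    obtain ⟨c, hc⟩ := hd
    push_cast at hc
    rcases lt_trichotomy c 0 with h0 | h0 | h0
    · nlinarith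
    · subst h0; exact h (by linarith)
    · nlinarith

/-- Orthogonality of the characters over the frequencies, in one dimension. -/
lemma sum_Icc_rootPow (p q : Fin (2 * K + 1)) :
    ∑ a ∈ Finset.Icc (-(K : ℤ)) K, rootPow K (a * ((p : ℕ) - (q : ℕ) : ℤ))
      = if p = q then (2 * K + 1 : ℂ) else 0 := by
  have h : ∑ a ∈ Finset.Icc (-(K : ℤ)) K, rootPow K (a * ((p : ℕ) - (q : ℕ) : ℤ))
      = ∑ n ∈ Finset.range (2 * K + 1), rootPow K (((n : ℤ) - K) * ((p : ℕ) - (q : ℕ) : ℤ)) := by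
    refine (Finset.sum_nbij' (fun n : ℕ => (n : ℤ) - K) (fun a : ℤ => (a + K).toNat)
      ?_ ?_ ?_ ?_ ?_).symm
    · intro n hn; simp only [Finset.mem_range, Finset.mem_Icc] at *; omega
    · intro n hn; simp only [Finset.mem_range, Finset.mem_Icc] at *; omega
    · intro n hn; simp
    · intro n hn; simp only [Finset.mem_Icc] at *; omega
    · intro n hn; rfl
  rw [h]
  split_ifs with hpq
  · subst hpq
    simp [rootPow_zero]
  · have e : ∀ n : ℕ, rootPow K (((n : ℤ) - K) * ((p : ℕ) - (q : ℕ) : ℤ))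
        = rootPow K (-(K : ℤ) * ((p : ℕ) - (q : ℕ) : ℤ)) *
          rootPow K (((p : ℕ) - (q : ℕ) : ℤ) * n) := fun n => by
      rw [← rootPow_add]; congr 1; ring
    simp_rw [e]
    rw [← Finset.mul_sum, sum_range_rootPow, mul_zero]
    rintro ⟨c, hc⟩
    have hp := p.2
    have hq := q.2
    have hne : (p : ℕ) ≠ (q : ℕ) := fun h => hpq (Fin.ext h)
    push_cast at hc
    rcases lt_trichotomy c 0 with h0 | h0 | h0
    · have : ((2 * K + 1 : ℕ) : ℤ) * c ≤ ((2 * K + 1 : ℕ) : ℤ) * (-1) := by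
        gcongr; omega
      push_cast at this
      omega
    · subst h0; omega
    · have : ((2 * K + 1 : ℕ) : ℤ) * 1 ≤ ((2 * K + 1 : ℕ) : ℤ) * c := by
        gcongr; omega
      push_cast at this
      omega

lemma gridWave_eq (hL : L ≠ 0) (k : ℤ × ℤ) (p : Fin (2 * K + 1) × Fin (2 * K + 1)) :
    gridWave L K k p = rootPow K (k.1 * (p.1 : ℕ)) * rootPow K (k.2 * (p.2 : ℕ)) := by
  have hN := two_mul_add_one_ne_zero_complex (K := K)
  have hLc : (L : ℂ) ≠ 0 := by exact_mod_cast hL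
  unfold gridWave wave rootPow meshSize
  rw [← Complex.exp_add]
  congr 1
  push_cast
  field_simp

lemma gridWave_neg (hL : L ≠ 0) (k : ℤ × ℤ) (p : Fin (2 * K + 1) × Fin (2 * K + 1)) :
    gridWave L K (-k) p = star (gridWave L K k p) := by
  rw [gridWave_eq hL, gridWave_eq hL, star_mul', ← rootPow_neg, ← rootPow_neg]
  simp only [Prod.fst_neg, Prod.snd_neg, neg_mul]

lemma sum_gridWave_mul (hL : L ≠ 0) {k l : ℤ × ℤ} (hk : k ∈ freqs K) (hl : l ∈ freqs K) :
    ∑ p, gridWave L K l p * gridWave L K (-k) p = if l = k then (2 * K + 1 : ℂ) ^ 2 else 0 := by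
  rw [freqs, Finset.mem_product] at hk hl
  have e : ∀ p : Fin (2 * K + 1) × Fin (2 * K + 1), gridWave L K l p * gridWave L K (-k) p
      = rootPow K ((l.1 - k.1) * (p.1 : ℕ)) * rootPow K ((l.2 - k.2) * (p.2 : ℕ)) := fun p => by
    rw [gridWave_eq hL, gridWave_eq hL, sub_mul, sub_mul, sub_eq_add_neg, sub_eq_add_neg,
      rootPow_add, rootPow_add]
    simp only [Prod.fst_neg, Prod.snd_neg, neg_mul]
    ring
  simp_rw [e]
  rw [Fintype.sum_prod_type]
  simp_rw [← Finset.mul_sum]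
  rw [← Finset.sum_mul, sum_fin_rootPow hl.1 hk.1, sum_fin_rootPow hl.2 hk.2]
  by_cases h1 : l.1 = k.1 <;> by_cases h2 : l.2 = k.2 <;> simp [h1, h2, Prod.ext_iff, sq]

/-- Completeness of the characters, the dual of the orthogonality above; Parseval's identity on the
grid rests on it. -/
lemma sum_freqs_gridWave (hL : L ≠ 0) (p q : Fin (2 * K + 1) × Fin (2 * K + 1)) :
    ∑ k ∈ freqs K, gridWave L K k p * gridWave L K (-k) q
      = if p = q then (2 * K + 1 : ℂ) ^ 2 else 0 := by
  have e : ∀ k : ℤ × ℤ, gridWave L K k p * gridWave L K (-k) q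
      = rootPow K (k.1 * ((p.1 : ℕ) - (q.1 : ℕ) : ℤ)) *
        rootPow K (k.2 * ((p.2 : ℕ) - (q.2 : ℕ) : ℤ)) := fun k => by
    rw [gridWave_eq hL, gridWave_eq hL, mul_sub, mul_sub, sub_eq_add_neg, sub_eq_add_neg,
      rootPow_add, rootPow_add]
    simp only [Prod.fst_neg, Prod.snd_neg, neg_mul]
    ring
  simp_rw [e]
  rw [freqs, Finset.sum_product]
  simp_rw [← Finset.mul_sum]
  rw [← Finset.sum_mul, sum_Icc_rootPow, sum_Icc_rootPow]
  by_cases h1 : p.1 = q.1 <;> by_cases h2 : p.2 = q.2 <;> simp [h1, h2, Prod.ext_iff, sq]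

lemma neg_mem_freqs {k : ℤ × ℤ} (hk : k ∈ freqs K) : -k ∈ freqs K := by
  simp only [freqs, Finset.mem_product, Finset.mem_Icc, Prod.fst_neg, Prod.snd_neg] at *
  omega

/-- Hermitian symmetry of `c` and the symmetric frequency box make the sum equal to its conjugate,
so taking the real part loses nothing. -/
lemma synthesize_coe (hL : L ≠ 0) {c : ℤ × ℤ → ℂ} (hc : ∀ k, c (-k) = star (c k))
    (p : Fin (2 * K + 1) × Fin (2 * K + 1)) :
    ((synthesize L K c p : ℝ) : ℂ) = ∑ k ∈ freqs K, c k * gridWave L K k p := by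
  unfold synthesize
  rw [← Complex.conj_eq_iff_re, map_sum]
  refine Finset.sum_nbij' (fun k => -k) (fun k => -k) (fun k => neg_mem_freqs)
    (fun k => neg_mem_freqs) (fun k _ => neg_neg k) (fun k _ => neg_neg k) fun k _ => ?_
  rw [hc, gridWave_neg hL, ← star_mul']
  rfl

lemma gridCoeff_synthesize (hL : L ≠ 0) {c : ℤ × ℤ → ℂ} (hc : ∀ k, c (-k) = star (c k))
    {k : ℤ × ℤ} (hk : k ∈ freqs K) : gridCoeff L K (synthesize L K c) k = c k := by
  have hN := two_mul_add_one_ne_zero_complex (K := K)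
  unfold gridCoeff
  simp_rw [synthesize_coe hL hc, Finset.sum_mul]
  rw [Finset.sum_comm]
  simp_rw [mul_assoc, ← Finset.mul_sum]
  rw [Finset.sum_congr rfl fun l hl => by rw [sum_gridWave_mul hL hk hl]]
  simp only [mul_ite, mul_zero, Finset.sum_ite_eq', hk, if_true]
  field_simp

lemma gridCoeff_neg_freq (hL : L ≠ 0) (f : Grid K) (k : ℤ × ℤ) :
    gridCoeff L K f (-k) = star (gridCoeff L K f k) := by
  unfold gridCoeff
  simp only [star_mul', star_sum, gridWave_neg hL, RCLike.star_def, map_div₀, map_one,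
    map_pow, map_add, map_mul, map_ofNat, map_natCast, Complex.conj_ofReal, Complex.conj_conj]

lemma gridCoeff_multiplier (hL : L ≠ 0) {σ : ℤ × ℤ → ℝ} (hσ : ∀ k, σ (-k) = σ k) (f : Grid K)
    {k : ℤ × ℤ} (hk : k ∈ freqs K) :
    gridCoeff L K (multiplier L K σ f) k = σ k * gridCoeff L K f k := by
  refine gridCoeff_synthesize hL (c := fun k => (σ k : ℂ) * gridCoeff L K f k) (fun l => ?_) hk
  rw [hσ, gridCoeff_neg_freq hL, star_mul', RCLike.star_def, Complex.conj_ofReal]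

lemma gridCoeff_add (f g : Grid K) (k : ℤ × ℤ) :
    gridCoeff L K (f + g) k = gridCoeff L K f k + gridCoeff L K g k := by
  simp only [gridCoeff, Pi.add_apply, Complex.ofReal_add, add_mul, Finset.sum_add_distrib, mul_add]

lemma gridCoeff_smul (r : ℝ) (f : Grid K) (k : ℤ × ℤ) :
    gridCoeff L K (r • f) k = r * gridCoeff L K f k := by
  simp only [gridCoeff, Pi.smul_apply, smul_eq_mul, Complex.ofReal_mul, mul_assoc,
    ← Finset.mul_sum]
  ring

lemma gridCoeff_sub (f g : Grid K) (k : ℤ × ℤ) :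
    gridCoeff L K (f - g) k = gridCoeff L K f k - gridCoeff L K g k := by
  simp only [gridCoeff, Pi.sub_apply, Complex.ofReal_sub, sub_mul, Finset.sum_sub_distrib, mul_sub]

/-- Parseval's identity on the grid. -/
lemma sum_norm_gridCoeff_sq (hL : L ≠ 0) (f : Grid K) :
    ∑ k ∈ freqs K, ‖gridCoeff L K f k‖ ^ 2 = (∑ p, f p ^ 2) / (2 * K + 1) ^ 2 := by
  have hN := two_mul_add_one_ne_zero_complex (K := K)
  have h : ∑ k ∈ freqs K, gridCoeff L K f (-k) * gridCoeff L K f k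
      = ((∑ p, f p ^ 2 : ℝ) : ℂ) / (2 * K + 1) ^ 2 := by
    have e : ∀ k : ℤ × ℤ, gridCoeff L K f (-k) * gridCoeff L K f k = 1 / (2 * K + 1 : ℂ) ^ 4 *
        ∑ p, ∑ q, (f p * f q : ℂ) * (gridWave L K k p * gridWave L K (-k) q) := fun k => by
      unfold gridCoeff
      rw [neg_neg, mul_mul_mul_comm, Finset.sum_mul_sum]
      congr 1
      · field_simp
      · refine Finset.sum_congr rfl fun p _ => Finset.sum_congr rfl fun q _ => ?_
        ring
    simp_rw [e]
    rw [← Finset.mul_sum, Finset.sum_comm]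
    simp_rw [fun p : Fin (2 * K + 1) × Fin (2 * K + 1) => Finset.sum_comm
      (s := freqs K) (t := Finset.univ)
      (f := fun k q => (f p * f q : ℂ) * (gridWave L K k p * gridWave L K (-k) q)),
      ← Finset.mul_sum, sum_freqs_gridWave hL]
    simp only [mul_ite, mul_zero, Finset.sum_ite_eq, Finset.mem_univ, if_true]
    rw [← Finset.sum_mul]
    push_cast
    field_simp
  have h2 : ∀ k, gridCoeff L K f (-k) * gridCoeff L K f k
      = ((‖gridCoeff L K f k‖ ^ 2 : ℝ) : ℂ) := fun k => by
    rw [gridCoeff_neg_freq hL, RCLike.star_def, Complex.conj_mul']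
    push_cast; rfl
  simp_rw [h2] at h
  exact_mod_cast h

lemma gridNorm_sq (hL : L ≠ 0) (f : Grid K) :
    gridNorm L K f ^ 2 = L ^ 2 * ∑ k ∈ freqs K, ‖gridCoeff L K f k‖ ^ 2 := by
  have h0 : 0 ≤ ∑ p, f p * f p := Finset.sum_nonneg fun p _ => mul_self_nonneg _
  rw [sum_norm_gridCoeff_sq hL, gridNorm, gridInner, Real.sq_sqrt (by positivity), meshSize]
  simp_rw [sq (f _)]
  field_simp

/-- Parseval applied twice; it transfers pointwise Lipschitz bounds for the nonlinearity to Fourier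
coefficients. -/
lemma sum_norm_gridCoeff_sq_le_of_abs_le (hL : L ≠ 0) {f g : Grid K} {C : ℝ}
    (h : ∀ p, |f p| ≤ C * |g p|) :
    ∑ k ∈ freqs K, ‖gridCoeff L K f k‖ ^ 2 ≤ C ^ 2 * ∑ k ∈ freqs K, ‖gridCoeff L K g k‖ ^ 2 := by
  rw [sum_norm_gridCoeff_sq hL, sum_norm_gridCoeff_sq hL, ← mul_div_assoc, Finset.mul_sum]
  refine div_le_div_of_nonneg_right (Finset.sum_le_sum fun p _ => ?_) (by positivity)
  rw [← sq_abs (f p), ← sq_abs (g p), ← mul_pow]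
  exact pow_le_pow_left₀ (abs_nonneg _) (h p) 2

/-- The coefficients are normalized so that the grid has total mass one, hence no factor depending
on `K` or `L`. -/
lemma sum_norm_gridCoeff_sq_le_of_le (hL : L ≠ 0) {f : Grid K} {b : ℝ} (h : ∀ p, |f p| ≤ b) :
    ∑ k ∈ freqs K, ‖gridCoeff L K f k‖ ^ 2 ≤ b ^ 2 := by
  refine (sum_norm_gridCoeff_sq_le_of_abs_le hL (f := f) (g := fun _ => 1) (C := b)
    (by simpa using h)).trans ?_
  rw [sum_norm_gridCoeff_sq hL]
  simp only [one_pow, Finset.sum_const, Finset.card_univ, Fintype.card_prod, Fintype.card_fin,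
    nsmul_eq_mul, mul_one]
  push_cast
  rw [← sq, div_self (by positivity), mul_one]

lemma norm_gridWave (k : ℤ × ℤ) (p : Fin (2 * K + 1) × Fin (2 * K + 1)) :
    ‖gridWave L K k p‖ = 1 := by
  unfold gridWave wave
  rw [Complex.norm_exp]
  have : 2 * (Real.pi : ℂ) * Complex.I * (k.1 * ((((p.1 : ℕ) : ℝ) * meshSize L K : ℝ) : ℂ)
      + k.2 * ((((p.2 : ℕ) : ℝ) * meshSize L K : ℝ) : ℂ)) / L
      = ((2 * Real.pi * (k.1 * ((p.1 : ℕ) * meshSize L K) + k.2 * ((p.2 : ℕ) * meshSize L K)) / L :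
        ℝ) : ℂ) * Complex.I := by
    push_cast; ring
  rw [this]
  simp

/-- The squared norm `⟨L_κ f, f⟩`, up to the factor `L²`. -/
noncomputable def kappaSq (L κ : ℝ) (K : ℕ) (f : Grid K) : ℝ :=
  ∑ k ∈ freqs K, Lam L κ k * ‖gridCoeff L K f k‖ ^ 2

lemma kappa_le_Lam {κ : ℝ} (k : ℤ × ℤ) : κ ≤ Lam L κ k := by
  unfold Lam; nlinarith [sq_nonneg (-1 + lam L k)]

lemma sum_norm_gridCoeff_sq_le_kappaSq {κ : ℝ} (hκ : 1 ≤ κ) (f : Grid K) :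
    ∑ k ∈ freqs K, ‖gridCoeff L K f k‖ ^ 2 ≤ kappaSq L κ K f :=
  Finset.sum_le_sum fun k _ =>
    le_mul_of_one_le_left (sq_nonneg _) (hκ.trans (kappa_le_Lam k))

lemma kappaSq_nonneg {κ : ℝ} (hκ : 1 ≤ κ) (f : Grid K) : 0 ≤ kappaSq L κ K f :=
  (Finset.sum_nonneg fun _ _ => sq_nonneg _).trans (sum_norm_gridCoeff_sq_le_kappaSq hκ f)

lemma gridNorm_le_of_kappaSq (hL : 0 < L) {κ : ℝ} (hκ : 1 ≤ κ) (f : Grid K) :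
    gridNorm L K f ≤ L * Real.sqrt (kappaSq L κ K f) := by
  refine le_of_sq_le_sq ?_ (by positivity)
  rw [gridNorm_sq hL.ne', mul_pow, Real.sq_sqrt (kappaSq_nonneg hκ f)]
  exact mul_le_mul_of_nonneg_left (sum_norm_gridCoeff_sq_le_kappaSq hκ f) (sq_nonneg _)

/-- Because `λ² ≤ 4((λ-1)² + 1)`; the assumption `κ ≥ 1` covers the kernel of `Δ+1`. -/
lemma gridNorm_gridLaplacian_le (hL : 0 < L) {κ : ℝ} (hκ : 1 ≤ κ) (f : Grid K) :
    gridNorm L K (gridLaplacian L K f) ≤ 2 * L * Real.sqrt (kappaSq L κ K f) := by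
  refine le_of_sq_le_sq ?_ (by positivity)
  rw [gridNorm_sq hL.ne', mul_pow, Real.sq_sqrt (kappaSq_nonneg hκ f), mul_pow, mul_comm (2 ^ 2),
    mul_assoc]
  refine mul_le_mul_of_nonneg_left ?_ (sq_nonneg _)
  rw [kappaSq, Finset.mul_sum]
  refine Finset.sum_le_sum fun k hk => ?_
  rw [gridLaplacian, gridCoeff_multiplier hL.ne' (fun k => by rw [lam_neg]) f hk, norm_mul, mul_pow,
    Complex.norm_real, Real.norm_eq_abs, sq_abs, ← mul_assoc]
  refine mul_le_mul_of_nonneg_right ?_ (sq_nonneg _)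
  unfold Lam
  nlinarith [sq_nonneg (lam L k - 2)]

/-- The discrete Sobolev inequality in terms of `kappaSq`. -/
lemma IsDiscreteSobolevConst.abs_le (hL : 0 < L) {Chat κ : ℝ} (hC : IsDiscreteSobolevConst L Chat)
    (hκ : 1 ≤ κ) (f : Grid K) (p : Fin (2 * K + 1) × Fin (2 * K + 1)) :
    |f p| ≤ 3 * |Chat| * L * Real.sqrt (kappaSq L κ K f) := by
  have h1 := gridNorm_le_of_kappaSq hL hκ f
  have h2 := gridNorm_gridLaplacian_le hL hκ f
  have h0 : 0 ≤ gridNorm L K f + gridNorm L K (gridLaplacian L K f) :=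
    add_nonneg (Real.sqrt_nonneg _) (Real.sqrt_nonneg _)
  calc |f p| ≤ Chat * (gridNorm L K f + gridNorm L K (gridLaplacian L K f)) := hC K f p
    _ ≤ |Chat| * (gridNorm L K f + gridNorm L K (gridLaplacian L K f)) := by
        gcongr; exact le_abs_self _
    _ ≤ |Chat| * (L * Real.sqrt (kappaSq L κ K f) + 2 * L * Real.sqrt (kappaSq L κ K f)) := by
        gcongr
    _ = _ := by ring

end GridFourier

/-! ### Projection onto trigonometric polynomials, seen on the grid. -/

section Projection

variable {L : ℝ} [hL : Fact (0 < L)] {K : ℕ}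

/-- The projection has degree at most `K`, so sampling it causes no aliasing. -/
lemma gridCoeff_projectToGrid (f : C(Torus L, ℝ)) {k : ℤ × ℤ} (hk : k ∈ freqs K) :
    gridCoeff L K (projectToGrid L K f) k = torusCoeff L f k :=
  gridCoeff_synthesize hL.out.ne' (torusCoeff_neg_freq f) hk

lemma abs_projectToGrid_le {s A : ℝ} (hs : 2 ≤ s) {f : C(Torus L, ℝ)}
    (hf : SobBound L s (torusCoeff L f) A) (p : Fin (2 * K + 1) × Fin (2 * K + 1)) :
    |projectToGrid L K f p| ≤ Real.sqrt (A * wtSum L) := by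
  have h := synthesize_coe (K := K) hL.out.ne' (torusCoeff_neg_freq f) p
  rw [projectToGrid, ← Real.norm_eq_abs, ← Complex.norm_real, h]
  refine (norm_sum_le _ _).trans (le_trans (le_of_eq ?_) (hf.sum_norm_le hL.out hs (freqs K)))
  exact Finset.sum_congr rfl fun k _ => by rw [norm_mul, norm_gridWave, mul_one]

/-- The projection error on the grid. -/
lemma abs_restrictToGrid_sub_projectToGrid_le {s A : ℝ} (hs : 2 ≤ s) {f : C(Torus L, ℝ)}
    (hf : SobBound L s (torusCoeff L f) A) (p : Fin (2 * K + 1) × Fin (2 * K + 1)) :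
    |restrictToGrid L K f p - projectToGrid L K f p|
      ≤ Real.sqrt (A * wtSum L) * meshSize L K ^ (s - 2) := by
  have h := synthesize_coe (K := K) hL.out.ne' (torusCoeff_neg_freq f) p
  have hsum := hasSum_torusCoeff_wave f (hf.summable_norm hL.out hs).of_norm
    ((p.1 : ℕ) * meshSize L K) ((p.2 : ℕ) * meshSize L K)
  rw [← Real.norm_eq_abs, ← Complex.norm_real, Complex.ofReal_sub]
  have hlim := (hsum.sub_const (∑ k ∈ freqs K, torusCoeff L f k * gridWave L K k p)).norm
  rw [← h] at hlim
  refine le_of_tendsto hlim ?_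
  filter_upwards [Filter.eventually_ge_atTop (freqs K)] with F hF
  change ‖∑ k ∈ F, torusCoeff L f k * gridWave L K k p - _‖ ≤ _
  rw [h, ← Finset.sum_sdiff_eq_sub hF]
  refine (norm_sum_le _ _).trans (le_trans (le_of_eq ?_)
    (hf.sum_norm_tail_le hL.out hs K (F \ freqs K) Finset.sdiff_disjoint))
  exact Finset.sum_congr rfl fun k _ => by rw [norm_mul, norm_gridWave, mul_one]

end Projection

/-! ### Energy estimates for damped linear systems and exponential Euler steps. -/

section Energy

/-- A differential form of Gronwall's inequality. -/
lemma le_exp_mul_of_deriv_le {g g' : ℝ → ℝ} {σ α β : ℝ} (hσ : 0 ≤ σ) (hα : 0 ≤ α) (hβ : 0 ≤ β)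
    (hg : ∀ s ∈ Icc 0 σ, HasDerivAt g (g' s) s) (h : ∀ s ∈ Icc 0 σ, g' s ≤ α * g s + β) :
    g σ ≤ Real.exp (α * σ) * (g 0 + σ * β) := by
  -- The hypothesis makes this function nonincreasing, because `e^{-αs} ≤ 1`.
  set φ : ℝ → ℝ := fun s => Real.exp (-(α * s)) * g s - β * s with hφ
  have hd : ∀ s ∈ Icc 0 σ, HasDerivAt φ
      (Real.exp (-(α * s)) * (-α) * g s + Real.exp (-(α * s)) * g' s - β) s := fun s hs => by
    have h1 : HasDerivAt (fun s => Real.exp (-(α * s))) (Real.exp (-(α * s)) * (-α)) s := by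
      have h2 := ((hasDerivAt_id s).const_mul α).neg.exp
      simpa using h2
    have h3 := ((hasDerivAt_id s).const_mul β)
    simp only [id, mul_one] at h3
    exact (h1.mul (hg s hs)).sub h3
  have hanti : AntitoneOn φ (Icc 0 σ) := by
    refine antitoneOn_of_deriv_nonpos (convex_Icc _ _)
      (fun s hs => (hd s hs).continuousAt.continuousWithinAt)
      (fun s hs => (hd s (interior_subset hs)).differentiableAt.differentiableWithinAt)
      fun s hs => ?_
    have hs' := interior_subset hs
    rw [(hd s hs').deriv]
    have h1 := h s hs'
    have h2 : Real.exp (-(α * s)) ≤ 1 :=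
      Real.exp_le_one_iff.2 (neg_nonpos.2 (mul_nonneg hα hs'.1))
    have h3 := Real.exp_pos (-(α * s))
    nlinarith [mul_le_mul_of_nonneg_left h1 h3.le, mul_le_mul_of_nonneg_right h2 hβ]
  have h1 := hanti (left_mem_Icc.2 hσ) (right_mem_Icc.2 hσ) hσ
  simp only [hφ, mul_zero, neg_zero, Real.exp_zero, one_mul, sub_zero] at h1
  have h2 : g σ = Real.exp (α * σ) * (Real.exp (-(α * σ)) * g σ) := by
    rw [← mul_assoc, ← Real.exp_add]; simp
  rw [h2]
  gcongr
  linarith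

variable {ι : Type*} {S : Finset ι} {Λ : ι → ℝ} {y r : ι → ℝ → ℂ} {σ B : ℝ}

lemma hasDerivAt_norm_sq_mode {k : ι} {s : ℝ}
    (h : HasDerivAt (y k) (-(Λ k : ℂ) * y k s + r k s) s) :
    HasDerivAt (fun s => ‖y k s‖ ^ 2)
      (2 * (-(Λ k * ‖y k s‖ ^ 2) + inner ℝ (y k s) (r k s))) s := by
  have h1 := h.norm_sq
  have h2 : -(Λ k : ℂ) * y k s = (-(Λ k)) • y k s := by simp
  rw [h2, inner_add_right, inner_smul_right, real_inner_self_eq_norm_sq, neg_mul] at h1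
  exact h1

lemma two_mul_inner_le (a b : ℂ) {c : ℝ} (hc : 0 < c) :
    2 * inner ℝ a b ≤ c⁻¹ * ‖a‖ ^ 2 + c * ‖b‖ ^ 2 := by
  have h1 := real_inner_le_norm a b
  have h2 : 2 * (‖a‖ * ‖b‖) ≤ c⁻¹ * ‖a‖ ^ 2 + c * ‖b‖ ^ 2 := by
    have : c⁻¹ * ‖a‖ ^ 2 + c * ‖b‖ ^ 2 - 2 * (‖a‖ * ‖b‖) = c⁻¹ * (‖a‖ - c * ‖b‖) ^ 2 := by
      field_simp; ring
    have h3 : 0 ≤ c⁻¹ * (‖a‖ - c * ‖b‖) ^ 2 := by positivity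
    linarith
  linarith

/-- Energy estimate for a damped linear system, in the norm weighted by the damping rates. -/
lemma sum_weighted_norm_sq_le (hΛ : ∀ k, 0 < Λ k) (hσ : 0 ≤ σ)
    (hy : ∀ k ∈ S, ∀ s ∈ Icc 0 σ, HasDerivAt (y k) (-(Λ k : ℂ) * y k s + r k s) s)
    (hr : ∀ s ∈ Icc 0 σ, ∑ k ∈ S, ‖r k s‖ ^ 2 ≤ B) :
    ∑ k ∈ S, Λ k * ‖y k σ‖ ^ 2 ≤ ∑ k ∈ S, Λ k * ‖y k 0‖ ^ 2 + σ * B := by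
  have hB : 0 ≤ B := (Finset.sum_nonneg fun _ _ => sq_nonneg _).trans (hr 0 (left_mem_Icc.2 hσ))
  have h := le_exp_mul_of_deriv_le (g := fun s => ∑ k ∈ S, Λ k * ‖y k s‖ ^ 2)
    (g' := fun s => ∑ k ∈ S, Λ k * (2 * (-(Λ k * ‖y k s‖ ^ 2) + inner ℝ (y k s) (r k s))))
    hσ le_rfl hB
    (fun s hs => HasDerivAt.fun_sum fun k hk =>
      (hasDerivAt_norm_sq_mode (hy k hk s hs)).const_mul (Λ k)) fun s hs => by
    rw [zero_mul, zero_add]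
    refine le_trans (Finset.sum_le_sum fun k _ => ?_) (hr s hs)
    have hk := hΛ k
    -- Young's inequality with parameter `1/Λ`: the forcing costs `Λ²|y|²`, half of the available
    -- dissipation, and what remains is `|r|²` without a weight.
    have h1 := two_mul_inner_le (y k s) (r k s) (inv_pos.2 hk)
    rw [inv_inv] at h1
    have h2 : Λ k * (2 * inner ℝ (y k s) (r k s))
        ≤ Λ k * (Λ k * ‖y k s‖ ^ 2 + (Λ k)⁻¹ * ‖r k s‖ ^ 2) :=
      mul_le_mul_of_nonneg_left h1 hk.le
    have h3 : Λ k * (Λ k * ‖y k s‖ ^ 2 + (Λ k)⁻¹ * ‖r k s‖ ^ 2)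
        = Λ k * (Λ k * ‖y k s‖ ^ 2) + ‖r k s‖ ^ 2 := by field_simp
    have h4 : 0 ≤ Λ k * (Λ k * ‖y k s‖ ^ 2) := by positivity
    nlinarith
  simpa using h

/-- Energy estimate for a damped linear system, in the unweighted norm. -/
lemma sum_norm_sq_le (hΛ : ∀ k, 0 < Λ k) (hσ : 0 < σ)
    (hy : ∀ k ∈ S, ∀ s ∈ Icc 0 σ, HasDerivAt (y k) (-(Λ k : ℂ) * y k s + r k s) s)
    (hr : ∀ s ∈ Icc 0 σ, ∑ k ∈ S, ‖r k s‖ ^ 2 ≤ B) :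
    ∑ k ∈ S, ‖y k σ‖ ^ 2 ≤ 3 * (∑ k ∈ S, ‖y k 0‖ ^ 2 + σ ^ 2 * B) := by
  have hB : 0 ≤ B :=
    (Finset.sum_nonneg fun _ _ => sq_nonneg _).trans (hr 0 (left_mem_Icc.2 hσ.le))
  -- Gronwall with rate `1/σ`, so that the growth factor over the interval is `e ≤ 3`.
  have h := le_exp_mul_of_deriv_le (g := fun s => ∑ k ∈ S, ‖y k s‖ ^ 2)
    (g' := fun s => ∑ k ∈ S, 2 * (-(Λ k * ‖y k s‖ ^ 2) + inner ℝ (y k s) (r k s)))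
    hσ.le (inv_nonneg.2 hσ.le) (mul_nonneg hσ.le hB)
    (fun s hs => HasDerivAt.fun_sum fun k hk => hasDerivAt_norm_sq_mode (hy k hk s hs))
    fun s hs => by
    have h0 := mul_le_mul_of_nonneg_left (hr s hs) hσ.le
    refine le_trans ?_ (add_le_add_right h0 _)
    rw [Finset.mul_sum, Finset.mul_sum, ← Finset.sum_add_distrib]
    refine Finset.sum_le_sum fun k _ => ?_
    have h1 := two_mul_inner_le (y k s) (r k s) hσ
    have h4 : 0 ≤ Λ k * ‖y k s‖ ^ 2 := mul_nonneg (hΛ k).le (sq_nonneg _)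
    linarith
  rw [inv_mul_cancel₀ hσ.ne'] at h
  refine h.trans ?_
  have h0 : 0 ≤ ∑ k ∈ S, ‖y k 0‖ ^ 2 := Finset.sum_nonneg fun _ _ => sq_nonneg _
  have h3 : Real.exp 1 ≤ 3 := Real.exp_one_lt_three.le
  have h5 : ∑ k ∈ S, ‖y k 0‖ ^ 2 + σ * (σ * B) = ∑ k ∈ S, ‖y k 0‖ ^ 2 + σ ^ 2 * B := by ring
  rw [h5]
  gcongr

/-- The solution at time `s` of `v' = -Λv + g`, `v(0) = a`. -/
noncomputable def expStep (Λ : ℝ) (a g : ℂ) (s : ℝ) : ℂ :=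
  (Real.exp (-(s * Λ)) : ℂ) * a + (((1 - Real.exp (-(s * Λ))) / Λ : ℝ) : ℂ) * g

lemma expStep_zero (Λ : ℝ) (a g : ℂ) : expStep Λ a g 0 = a := by simp [expStep]

lemma hasDerivAt_expStep {Λ : ℝ} (hΛ : Λ ≠ 0) (a g : ℂ) (s : ℝ) :
    HasDerivAt (expStep Λ a g) (-(Λ : ℂ) * expStep Λ a g s + g) s := by
  have h1 : HasDerivAt (fun s : ℝ => Real.exp (-(s * Λ))) (Real.exp (-(s * Λ)) * (-Λ)) s := by
    have h2 := ((hasDerivAt_id s).mul_const Λ).neg.exp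
    simpa using h2
  have h2 : HasDerivAt (fun s : ℝ => (1 - Real.exp (-(s * Λ))) / Λ) (Real.exp (-(s * Λ))) s := by
    have h3 := ((hasDerivAt_const s (1 : ℝ)).sub h1).div_const Λ
    convert! h3 using 1
    field_simp
    ring
  have h4 := (h1.ofReal_comp.mul_const a).add (h2.ofReal_comp.mul_const g)
  convert! h4 using 1
  have hc : (Λ : ℂ) ≠ 0 := by exact_mod_cast hΛ
  simp only [expStep]
  push_cast
  field_simp
  ring

variable {L κ : ℝ} {K : ℕ}

lemma Lam_neg (k : ℤ × ℤ) : Lam L κ (-k) = Lam L κ k := by simp only [Lam, lam_neg]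

lemma Lam_pos (hκ : 1 ≤ κ) (k : ℤ × ℤ) : 0 < Lam L κ k :=
  one_pos.trans_le (hκ.trans (kappa_le_Lam k))

lemma Lam_le_wt_sq {κb : ℝ} (hκ : 0 ≤ κ) (hκb : κ ≤ κb) (k : ℤ × ℤ) :
    Lam L κ k ≤ (1 + κb) * wt L k ^ 2 := by
  have h1 := one_le_wt (L := L) k
  have h2 := lam_nonneg (L := L) k
  have h3 : (-1 + lam L k) ^ 2 ≤ wt L k ^ 2 := by unfold wt; nlinarith
  have h4 : κ ≤ κb * wt L k ^ 2 := by nlinarith [one_le_pow₀ (n := 2) h1]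
  unfold Lam
  linarith

/-- Identifies the `φ₁` multiplier with the weight of the frozen source in `expStep`, also at `s =
0`. -/
lemma mul_phi1 {Λ s : ℝ} (hΛ : Λ ≠ 0) :
    s * phi1 (s * Λ) = (1 - Real.exp (-(s * Λ))) / Λ := by
  unfold phi1
  by_cases hs : s = 0
  · simp [hs]
  · rw [if_neg (mul_ne_zero hs hΛ)]
    field_simp

/-- The Fourier coefficients of one exponential Euler step. -/
lemma gridCoeff_phi0Op_add_phi1Op (hL : L ≠ 0) (hκ : 1 ≤ κ) (s : ℝ) (f g : Grid K) {k : ℤ × ℤ}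
    (hk : k ∈ freqs K) :
    gridCoeff L K (phi0Op L κ K s f + s • phi1Op L κ K s g) k
      = expStep (Lam L κ k) (gridCoeff L K f k) (gridCoeff L K g k) s := by
  rw [gridCoeff_add, gridCoeff_smul, phi0Op, phi1Op,
    gridCoeff_multiplier hL (fun k => by rw [Lam_neg]) _ hk,
    gridCoeff_multiplier hL (fun k => by rw [Lam_neg]) _ hk, ← mul_assoc, expStep,
    ← mul_phi1 (Lam_pos hκ k).ne']
  push_cast
  rfl

/-- Stability of one exponential Euler step. -/
lemma kappaSq_phi0Op_add_phi1Op_le (hL : L ≠ 0) (hκ : 1 ≤ κ) {s : ℝ} (hs : 0 ≤ s) (f g : Grid K) :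
    kappaSq L κ K (phi0Op L κ K s f + s • phi1Op L κ K s g)
      ≤ kappaSq L κ K f + s * ∑ k ∈ freqs K, ‖gridCoeff L K g k‖ ^ 2 := by
  have h := sum_weighted_norm_sq_le (S := freqs K) (Λ := Lam L κ)
    (y := fun k => expStep (Lam L κ k) (gridCoeff L K f k) (gridCoeff L K g k))
    (r := fun k _ => gridCoeff L K g k) (Lam_pos hκ) hs
    (fun k _ s _ => hasDerivAt_expStep (Lam_pos hκ k).ne' _ _ s) (fun _ _ => le_rfl)
  simp only [expStep_zero] at h
  refine le_trans (le_of_eq ?_) h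
  exact Finset.sum_congr rfl fun k hk => by rw [gridCoeff_phi0Op_add_phi1Op hL hκ s f g hk]

lemma norm_add_sq_le_two {E : Type*} [SeminormedAddCommGroup E] (a b : E) :
    ‖a + b‖ ^ 2 ≤ 2 * ‖a‖ ^ 2 + 2 * ‖b‖ ^ 2 := by
  nlinarith [norm_add_le a b, norm_nonneg (a + b), sq_nonneg (‖a‖ - ‖b‖)]

lemma norm_add_add_sq_le_three {E : Type*} [SeminormedAddCommGroup E] (a b c : E) :
    ‖a + b + c‖ ^ 2 ≤ 3 * ‖a‖ ^ 2 + 3 * ‖b‖ ^ 2 + 3 * ‖c‖ ^ 2 := by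
  nlinarith [norm_add₃_le (a := a) (b := b) (c := c), norm_nonneg (a + b + c),
    sq_nonneg (‖a‖ - ‖b‖), sq_nonneg (‖a‖ - ‖c‖), sq_nonneg (‖b‖ - ‖c‖)]

lemma sum_norm_gridCoeff_add_sq_le (f g : Grid K) :
    ∑ k ∈ freqs K, ‖gridCoeff L K (f + g) k‖ ^ 2
      ≤ 2 * ∑ k ∈ freqs K, ‖gridCoeff L K f k‖ ^ 2
        + 2 * ∑ k ∈ freqs K, ‖gridCoeff L K g k‖ ^ 2 := by
  rw [Finset.mul_sum, Finset.mul_sum, ← Finset.sum_add_distrib]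
  refine Finset.sum_le_sum fun k _ => ?_
  rw [gridCoeff_add]
  exact norm_add_sq_le_two _ _

lemma kappaSq_sub_le (hκ : 1 ≤ κ) (f g : Grid K) :
    kappaSq L κ K (f - g) ≤ 2 * kappaSq L κ K f + 2 * kappaSq L κ K g := by
  unfold kappaSq
  rw [Finset.mul_sum, Finset.mul_sum, ← Finset.sum_add_distrib]
  refine Finset.sum_le_sum fun k _ => ?_
  have h := norm_add_sq_le_two (gridCoeff L K f k) (-gridCoeff L K g k)
  rw [norm_neg, ← sub_eq_add_neg] at h
  rw [gridCoeff_sub]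
  nlinarith [(Lam_pos (L := L) hκ k).le]

end Energy

/-! ### Local error of the stage and of the full step. -/

section Consistency

variable {L : ℝ} [hL : Fact (0 < L)] {T ε s M κ κb B : ℝ} {U G₁ G₂ : ℝ → C(Torus L, ℝ)} {K : ℕ}

/-- The stabilized nonlinearity `κu - f(u)` on continuous functions. -/
noncomputable def sourceC (ε κ : ℝ) (f : C(Torus L, ℝ)) : C(Torus L, ℝ) := κ • f - nonlinC ε f

/-- The time derivative of `sourceC` along a curve. -/
noncomputable def sourceC₁ (ε κ : ℝ) (f g : C(Torus L, ℝ)) : C(Torus L, ℝ) :=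
  κ • g - nonlinC₁ ε f g

lemma torusCoeff_sub (f g : C(Torus L, ℝ)) (k : ℤ × ℤ) :
    torusCoeff L (f - g) k = torusCoeff L f k - torusCoeff L g k :=
  map_sub (torusCoeffCLM L k) f g

namespace ExactData

lemma hasDerivAt_sourceC (D : ExactData L T ε s M U G₁ G₂) (κ t : ℝ) :
    HasDerivAt (fun t => sourceC ε κ (U t)) (sourceC₁ ε κ (U t) (G₁ t)) t :=
  ((D.deriv_U t).const_smul κ).sub (hasDerivAt_nonlinC ε (D.deriv_U t))

lemma hasDerivAt_sourceC₁ (D : ExactData L T ε s M U G₁ G₂) (κ t : ℝ) :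
    HasDerivAt (fun t => sourceC₁ ε κ (U t) (G₁ t))
      (κ • G₂ t - nonlinC₂ ε (U t) (G₁ t) (G₂ t)) t :=
  ((D.deriv_G₁ t).const_smul κ).sub (hasDerivAt_nonlinC₁ ε (D.deriv_U t) (D.deriv_G₁ t))

lemma norm_smul_sub_le {f g : C(Torus L, ℝ)} (hκ : 0 ≤ κ) (hκb : κ ≤ κb) (hf : ‖f‖ ≤ M)
    (hg : ‖g‖ ≤ M) : ‖κ • f - g‖ ≤ (κb + 1) * M := by
  have hM : 0 ≤ M := (norm_nonneg _).trans hf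
  have hκb0 : 0 ≤ κb := hκ.trans hκb
  calc ‖κ • f - g‖ ≤ κ * ‖f‖ + ‖g‖ := by
        refine (norm_sub_le _ _).trans (le_of_eq ?_)
        rw [norm_smul, Real.norm_of_nonneg hκ]
    _ ≤ κb * M + M := by gcongr
    _ = _ := by ring

lemma norm_sourceC₁_le (D : ExactData L T ε s M U G₁ G₂) (hκ : 0 ≤ κ) (hκb : κ ≤ κb) {t : ℝ}
    (ht : t ∈ Icc 0 T) : ‖sourceC₁ ε κ (U t) (G₁ t)‖ ≤ (κb + 1) * M :=
  norm_smul_sub_le hκ hκb (D.norm_G₁ t ht) (D.norm_nonlinC₁ t ht)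

lemma norm_sourceC_sub_le (D : ExactData L T ε s M U G₁ G₂) (hκ : 0 ≤ κ) (hκb : κ ≤ κb)
    {a b : ℝ} (ha : a ∈ Icc 0 T) (hb : b ∈ Icc 0 T) :
    ‖sourceC ε κ (U b) - sourceC ε κ (U a)‖ ≤ (κb + 1) * M * |b - a| :=
  (convex_Icc 0 T).norm_image_sub_le_of_norm_hasDerivWithin_le
    (fun t _ => (D.hasDerivAt_sourceC κ t).hasDerivWithinAt)
    (fun _ ht => D.norm_sourceC₁_le hκ hκb ht) ha hb

lemma norm_sourceC₁_sub_le (D : ExactData L T ε s M U G₁ G₂) (hκ : 0 ≤ κ) (hκb : κ ≤ κb)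
    {a b : ℝ} (ha : a ∈ Icc 0 T) (hb : b ∈ Icc 0 T) :
    ‖sourceC₁ ε κ (U b) (G₁ b) - sourceC₁ ε κ (U a) (G₁ a)‖ ≤ (κb + 1) * M * |b - a| :=
  (convex_Icc 0 T).norm_image_sub_le_of_norm_hasDerivWithin_le
    (fun t _ => (D.hasDerivAt_sourceC₁ κ t).hasDerivWithinAt)
    (fun t ht => norm_smul_sub_le hκ hκb (D.norm_G₂ t ht) (D.norm_nonlinC₂ t ht)) ha hb

/-- Second order Taylor estimate for the stabilized nonlinearity. -/
lemma norm_sourceC_taylor_le (D : ExactData L T ε s M U G₁ G₂) (hκ : 0 ≤ κ) (hκb : κ ≤ κb)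
    {a τ m b : ℝ} (ha : 0 ≤ a) (haT : a + τ ≤ T) (hm : m ∈ Icc a (a + τ))
    (hb : b ∈ Icc a (a + τ)) :
    ‖sourceC ε κ (U b) - sourceC ε κ (U m) - (b - m) • sourceC₁ ε κ (U m) (G₁ m)‖
      ≤ (κb + 1) * M * τ ^ 2 := by
  have hsub : Icc a (a + τ) ⊆ Icc 0 T := Icc_subset_Icc ha haT
  have hM : 0 ≤ (κb + 1) * M :=
    (norm_nonneg _).trans (D.norm_sourceC₁_le hκ hκb (hsub hm))
  have hdiff : ∀ x ∈ Icc a (a + τ), |x - m| ≤ τ := fun x hx => by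
    rw [abs_le]; constructor <;> linarith [hx.1, hx.2, hm.1, hm.2]
  -- Mean value inequality for the source minus its tangent at `m`; the derivative of this
  -- difference is itself `O(τ)` by the Lipschitz bound on `sourceC₁`.
  have h := (convex_Icc a (a + τ)).norm_image_sub_le_of_norm_hasDerivWithin_le
    (f := fun t => sourceC ε κ (U t) - (t - m) • sourceC₁ ε κ (U m) (G₁ m))
    (f' := fun t => sourceC₁ ε κ (U t) (G₁ t) - sourceC₁ ε κ (U m) (G₁ m))
    (C := (κb + 1) * M * τ)
    (fun t _ => by
      have h1 := ((hasDerivAt_id t).sub_const m).smul_const (sourceC₁ ε κ (U m) (G₁ m))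
      rw [one_smul] at h1
      exact ((D.hasDerivAt_sourceC κ t).sub h1).hasDerivWithinAt)
    (fun t ht => (D.norm_sourceC₁_sub_le hκ hκb (hsub hm) (hsub ht)).trans
      (mul_le_mul_of_nonneg_left (hdiff t ht) hM)) hm hb
  have hτ : 0 ≤ τ := (abs_nonneg _).trans (hdiff m hm)
  calc _ = ‖sourceC ε κ (U b) - (b - m) • sourceC₁ ε κ (U m) (G₁ m)
          - (sourceC ε κ (U m) - (m - m) • sourceC₁ ε κ (U m) (G₁ m))‖ := by
        congr 1
        rw [sub_self, zero_smul, sub_zero]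
        abel
    _ ≤ (κb + 1) * M * τ * |b - m| := h
    _ ≤ (κb + 1) * M * τ * τ := by
        gcongr
        exact hdiff b hb
    _ = _ := by ring

/-- The mode equations in stabilized form. -/
lemma torusCoeff_G₁ (D : ExactData L T ε s M U G₁ G₂) (κ : ℝ) (k : ℤ × ℤ) {t : ℝ}
    (ht : t ∈ Icc 0 T) :
    torusCoeff L (G₁ t) k
      = -(Lam L κ k : ℂ) * torusCoeff L (U t) k + torusCoeff L (sourceC ε κ (U t)) k := by
  rw [D.mode k t ht, sourceC, torusCoeff_sub, torusCoeff_smul, Lam]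
  push_cast
  ring

/-- Bounds `L_κ` applied to the time derivative of the source, the quantity multiplying the midpoint
corrector. Since `Λ ≤ (1+κb)(1+λ)²`, squaring uses four powers of the weight, exactly the `H⁴`
bounds. -/
lemma sum_Lam_sq_norm_sourceC₁_le (D : ExactData L T ε s M U G₁ G₂) (hκ : 0 ≤ κ) (hκb : κ ≤ κb)
    {t : ℝ} (ht : t ∈ Icc 0 T) (F : Finset (ℤ × ℤ)) :
    ∑ k ∈ F, ‖(Lam L κ k : ℂ) * torusCoeff L (sourceC₁ ε κ (U t) (G₁ t)) k‖ ^ 2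
      ≤ (1 + κb) ^ 2 * (2 * (κb ^ 2 * M) + 2 * M) := by
  have h1 := ((D.sob_G₁ t ht).torusCoeff_smul κ).torusCoeff_sub (D.sob_nonlinC₁ t ht) F
  have hM : 0 ≤ M := (norm_nonneg _).trans (D.norm_U t ht)
  calc _ ≤ ∑ k ∈ F, (1 + κb) ^ 2 *
        (wt L k ^ (4 : ℝ) * ‖torusCoeff L (sourceC₁ ε κ (U t) (G₁ t)) k‖ ^ 2) := by
        refine Finset.sum_le_sum fun k _ => ?_
        rw [norm_mul, mul_pow, ← mul_assoc, Complex.norm_real, Real.norm_eq_abs, sq_abs]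
        refine mul_le_mul_of_nonneg_right ?_ (sq_nonneg _)
        have h2 : wt L k ^ (4 : ℝ) = (wt L k ^ 2) ^ 2 := by
          rw [← pow_mul, ← Real.rpow_natCast]; norm_num
        rw [h2, ← mul_pow]
        exact pow_le_pow_left₀ (hκ.trans (kappa_le_Lam k)) (Lam_le_wt_sq hκ hκb k) 2
    _ = (1 + κb) ^ 2 *
        ∑ k ∈ F, wt L k ^ (4 : ℝ) * ‖torusCoeff L (sourceC₁ ε κ (U t) (G₁ t)) k‖ ^ 2 := by
        rw [Finset.mul_sum]
    _ ≤ (1 + κb) ^ 2 * (2 * (κ ^ 2 * M) + 2 * M) := by gcongr; exact h1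
    _ ≤ _ := by gcongr

end ExactData

lemma projectToGrid_smul_sub (r : ℝ) (f g : C(Torus L, ℝ))
    (p : Fin (2 * K + 1) × Fin (2 * K + 1)) :
    projectToGrid L K (r • f - g) p = r * projectToGrid L K f p - projectToGrid L K g p := by
  simp only [projectToGrid, synthesize, torusCoeff_sub, torusCoeff_smul, sub_mul,
    Finset.sum_sub_distrib, Complex.sub_re, mul_assoc, ← Finset.mul_sum, Complex.re_ofReal_mul]

/-- Factor out `a - b`; the cofactor `a² + ab + b² - ε` is at most `3B² + ε` in absolute value. -/
lemma abs_nonlin_sub_le (hε : 0 ≤ ε) {a b : ℝ} (ha : |a| ≤ B) (hb : |b| ≤ B) :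
    |nonlin ε a - nonlin ε b| ≤ (3 * B ^ 2 + ε) * |a - b| := by
  have h : nonlin ε a - nonlin ε b = (a ^ 2 + a * b + b ^ 2 - ε) * (a - b) := by
    unfold nonlin; ring
  rw [h, abs_mul]
  refine mul_le_mul_of_nonneg_right ?_ (abs_nonneg _)
  have ha2 : a ^ 2 ≤ B ^ 2 := sq_le_sq' (by linarith [neg_le_of_abs_le ha]) (le_of_abs_le ha)
  have hb2 : b ^ 2 ≤ B ^ 2 := sq_le_sq' (by linarith [neg_le_of_abs_le hb]) (le_of_abs_le hb)
  rw [abs_le]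
  constructor <;> nlinarith [sq_nonneg (a + b), sq_nonneg (a - b), sq_nonneg B]

/-- Size of the projection and aliasing errors of the nonlinearity on the grid. -/
noncomputable def spatialError (L ε s M B : ℝ) (K : ℕ) : ℝ :=
  (1 + (3 * B ^ 2 + ε)) * (Real.sqrt (M * wtSum L) * meshSize L K ^ (s - 2))

/-- The discrete nonlinearity compared with the projected continuous one. -/
lemma ExactData.sum_norm_source_sub_le (D : ExactData L T ε s M U G₁ G₂) (hε : 0 ≤ ε)
    (hs : 2 ≤ s) (hκ : 0 ≤ κ) (hκb : κ ≤ κb) {t : ℝ} (ht : t ∈ Icc 0 T) (g : Grid K)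
    (hg : ∀ p, |g p| ≤ B) (hw : ∀ p, |projectToGrid L K (U t) p| ≤ B) (hM : M ≤ B) :
    ∑ k ∈ freqs K, ‖torusCoeff L (sourceC ε κ (U t)) k - gridCoeff L K (nonlinK ε κ g) k‖ ^ 2
      ≤ 2 * ((κb + (3 * B ^ 2 + ε)) ^ 2 *
          ∑ k ∈ freqs K, ‖torusCoeff L (U t) k - gridCoeff L K g k‖ ^ 2)
        + 2 * spatialError L ε s M B K ^ 2 := by
  set w := projectToGrid L K (U t) with hwdef
  -- `D₁` is the Lipschitz response to the error `w - g`; `D₂` is the failure of projection to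
  -- commute with the nonlinearity. The linear term `κu` contributes nothing to `D₂`.
  set D₁ : Grid K := fun p => κ * (w p - g p) - (nonlin ε (w p) - nonlin ε (g p)) with hD₁
  set D₂ : Grid K := fun p =>
    (restrictToGrid L K (nonlinC ε (U t)) p - projectToGrid L K (nonlinC ε (U t)) p)
      + (nonlin ε (w p) - nonlin ε (restrictToGrid L K (U t) p)) with hD₂
  have hsum : projectToGrid L K (sourceC ε κ (U t)) - nonlinK ε κ g = D₁ + D₂ := by
    ext p
    have : restrictToGrid L K (nonlinC ε (U t)) p = nonlin ε (restrictToGrid L K (U t) p) :=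
      nonlinC_apply _ _ _
    simp only [Pi.sub_apply, Pi.add_apply, sourceC, projectToGrid_smul_sub, hD₁, hD₂, nonlinK, this,
      hwdef]
    ring
  have e1 : ∀ k ∈ freqs K, ‖torusCoeff L (sourceC ε κ (U t)) k - gridCoeff L K (nonlinK ε κ g) k‖ ^ 2
      = ‖gridCoeff L K (D₁ + D₂) k‖ ^ 2 := fun k hk => by
    rw [← hsum, gridCoeff_sub, gridCoeff_projectToGrid _ hk]
  have e2 : ∀ k ∈ freqs K, ‖torusCoeff L (U t) k - gridCoeff L K g k‖ ^ 2
      = ‖gridCoeff L K (w - g) k‖ ^ 2 := fun k hk => by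
    rw [gridCoeff_sub, hwdef, gridCoeff_projectToGrid _ hk]
  rw [Finset.sum_congr rfl e1, Finset.sum_congr rfl e2]
  refine (sum_norm_gridCoeff_add_sq_le D₁ D₂).trans ?_
  have hU : ∀ p, |restrictToGrid L K (U t) p| ≤ B := fun p =>
    ((U t).norm_coe_le_norm _).trans ((D.norm_U t ht).trans hM)
  have h1 : ∀ p, |D₁ p| ≤ (κb + (3 * B ^ 2 + ε)) * |(w - g) p| := fun p => by
    have h2 := abs_nonlin_sub_le hε (hw p) (hg p)
    calc |D₁ p| ≤ |κ * (w p - g p)| + |nonlin ε (w p) - nonlin ε (g p)| := abs_sub _ _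
      _ ≤ κb * |w p - g p| + (3 * B ^ 2 + ε) * |w p - g p| := by
          rw [abs_mul, abs_of_nonneg hκ]
          gcongr
      _ = _ := by rw [Pi.sub_apply]; ring
  have h2 : ∀ p, |D₂ p| ≤ spatialError L ε s M B K := fun p => by
    have h3 := abs_restrictToGrid_sub_projectToGrid_le (K := K) hs (D.sob_nonlinC t ht) p
    have h4 := abs_restrictToGrid_sub_projectToGrid_le (K := K) hs (D.sob_U t ht) p
    have h5 := abs_nonlin_sub_le hε (hw p) (hU p)
    rw [abs_sub_comm (w p)] at h5
    calc |D₂ p| ≤ _ := abs_add_le _ _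
      _ ≤ Real.sqrt (M * wtSum L) * meshSize L K ^ (s - 2) + (3 * B ^ 2 + ε) *
          (Real.sqrt (M * wtSum L) * meshSize L K ^ (s - 2)) := by
          refine add_le_add h3 (h5.trans ?_)
          exact mul_le_mul_of_nonneg_left h4 (by positivity)
      _ = _ := by unfold spatialError; ring
  have h3 := sum_norm_gridCoeff_sq_le_of_abs_le hL.out.ne' h1
  have h4 := sum_norm_gridCoeff_sq_le_of_le hL.out.ne' h2
  linarith

/-- Error of the internal stage. -/
lemma ExactData.sum_norm_stage_sub_le (D : ExactData L T ε s M U G₁ G₂) (hε : 0 ≤ ε)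
    (hs : 2 ≤ s) (hκ : 1 ≤ κ) (hκb : κ ≤ κb) {a τ : ℝ} (ha : 0 ≤ a) (hτ : 0 < τ)
    (haT : a + τ ≤ T) (f : Grid K) (hf : ∀ p, |f p| ≤ B)
    (hw : ∀ p, |projectToGrid L K (U a) p| ≤ B) (hM : M ≤ B) :
    ∑ k ∈ freqs K, ‖torusCoeff L (U (a + τ)) k
        - gridCoeff L K (phi0Op L κ K τ f + τ • phi1Op L κ K τ (nonlinK ε κ f)) k‖ ^ 2
      ≤ 3 * (∑ k ∈ freqs K, ‖torusCoeff L (U a) k - gridCoeff L K f k‖ ^ 2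
        + τ ^ 2 * (2 * ((κb + 1) * M * τ) ^ 2 + 2 * (2 * ((κb + (3 * B ^ 2 + ε)) ^ 2 *
          ∑ k ∈ freqs K, ‖torusCoeff L (U a) k - gridCoeff L K f k‖ ^ 2)
        + 2 * spatialError L ε s M B K ^ 2))) := by
  have hκ0 : 0 ≤ κ := zero_le_one.trans hκ
  have haI : a ∈ Icc 0 T := ⟨ha, by linarith⟩
  have hM0 : 0 ≤ M := (norm_nonneg _).trans (D.norm_U a haI)
  have hIcc : ∀ t ∈ Icc 0 τ, a + t ∈ Icc 0 T := fun t ht => ⟨by linarith [ht.1], by linarith [ht.2]⟩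
  -- The forcing splits into the variation of the exact source since time `a`, of order `τ`, and the
  -- source mismatch at time `a`. The unweighted estimate supplies a further factor `τ`.
  have h := sum_norm_sq_le (S := freqs K) (Λ := Lam L κ)
    (B := 2 * ((κb + 1) * M * τ) ^ 2 + 2 * (2 * ((κb + (3 * B ^ 2 + ε)) ^ 2 *
          ∑ k ∈ freqs K, ‖torusCoeff L (U a) k - gridCoeff L K f k‖ ^ 2)
        + 2 * spatialError L ε s M B K ^ 2))
    (y := fun k t => torusCoeff L (U (a + t)) k
      - expStep (Lam L κ k) (gridCoeff L K f k) (gridCoeff L K (nonlinK ε κ f) k) t)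
    (r := fun k t => torusCoeff L (sourceC ε κ (U (a + t)) - sourceC ε κ (U a)) k
      + (torusCoeff L (sourceC ε κ (U a)) k - gridCoeff L K (nonlinK ε κ f) k))
    (Lam_pos hκ) hτ (fun k _ t ht => by
      have h1 := (hasDerivAt_coeff_comp (D.deriv_U (a + t)) k).scomp t
        ((hasDerivAt_id t).const_add a)
      rw [one_smul] at h1
      have h2 := h1.sub (hasDerivAt_expStep (Lam_pos (L := L) hκ k).ne' (gridCoeff L K f k)
        (gridCoeff L K (nonlinK ε κ f) k) t)
      refine h2.congr_deriv ?_
      rw [D.torusCoeff_G₁ κ k (hIcc t ht), torusCoeff_sub]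
      ring) (fun t ht => ?_)
  · simp only [add_zero, expStep_zero] at h
    refine le_trans (le_of_eq ?_) h
    exact Finset.sum_congr rfl fun k hk => by
      rw [gridCoeff_phi0Op_add_phi1Op hL.out.ne' hκ τ _ _ hk]
  · have h1 := sum_norm_torusCoeff_sq_le (sourceC ε κ (U (a + t)) - sourceC ε κ (U a)) (freqs K)
    have h2 := D.norm_sourceC_sub_le hκ0 hκb haI (hIcc t ht)
    have h3 := D.sum_norm_source_sub_le hε hs hκ0 hκb haI f hf hw hM
    have h4 : ‖sourceC ε κ (U (a + t)) - sourceC ε κ (U a)‖ ^ 2 ≤ ((κb + 1) * M * τ) ^ 2 := by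
      refine pow_le_pow_left₀ (norm_nonneg _) (h2.trans ?_) 2
      rw [add_sub_cancel_left, abs_of_nonneg ht.1]
      have : 0 ≤ (κb + 1) * M := by nlinarith
      exact mul_le_mul_of_nonneg_left ht.2 this
    refine (Finset.sum_le_sum fun k _ => norm_add_sq_le_two _ _).trans ?_
    rw [Finset.sum_add_distrib, ← Finset.mul_sum, ← Finset.mul_sum]
    linarith

lemma kappaSq_projectToGrid_sub (f : C(Torus L, ℝ)) (g : Grid K) :
    kappaSq L κ K (projectToGrid L K f - g)
      = ∑ k ∈ freqs K, Lam L κ k * ‖torusCoeff L f k - gridCoeff L K g k‖ ^ 2 :=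
  Finset.sum_congr rfl fun k hk => by rw [gridCoeff_sub, gridCoeff_projectToGrid _ hk]

/-- Error recursion of one step, in terms of the error of the internal stage `g`. -/
lemma ExactData.kappaSq_step_sub_le (D : ExactData L T ε s M U G₁ G₂) (hε : 0 ≤ ε)
    (hs : 2 ≤ s) (hκ : 1 ≤ κ) (hκb : κ ≤ κb) {a τ : ℝ} (ha : 0 ≤ a) (hτ : 0 < τ)
    (haT : a + τ ≤ T) (f g : Grid K) (hg : ∀ p, |g p| ≤ B)
    (hw : ∀ p, |projectToGrid L K (U (a + τ / 2)) p| ≤ B) (hM : M ≤ B) :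
    kappaSq L κ K (projectToGrid L K (U (a + τ))
        - (phi0Op L κ K τ f + τ • phi1Op L κ K τ (nonlinK ε κ g)))
      ≤ kappaSq L κ K (projectToGrid L K (U a) - f) + τ * (
        3 * (τ ^ 4 * ((1 + κb) ^ 2 * (2 * (κb ^ 2 * M) + 2 * M)))
        + 3 * ((κb + 1) * M * τ ^ 2) ^ 2
        + 3 * (2 * ((κb + (3 * B ^ 2 + ε)) ^ 2 *
          ∑ k ∈ freqs K, ‖torusCoeff L (U (a + τ / 2)) k - gridCoeff L K g k‖ ^ 2)
        + 2 * spatialError L ε s M B K ^ 2)) := by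
  have hκ0 : 0 ≤ κ := zero_le_one.trans hκ
  have hmI : a + τ / 2 ∈ Icc a (a + τ) := ⟨by linarith, by linarith⟩
  have hsub : Icc a (a + τ) ⊆ Icc 0 T := Icc_subset_Icc ha haT
  have hIcc : ∀ t ∈ Icc 0 τ, a + t ∈ Icc a (a + τ) :=
    fun t ht => ⟨by linarith [ht.1], by linarith [ht.2]⟩
  set m := a + τ / 2 with hm
  set n₁ := sourceC₁ ε κ (U m) (G₁ m) with hn₁
  -- The error is corrected by `t(t-τ)/2 · n₁`, which vanishes at `0` and `τ` and has derivative
  -- `(t-τ/2) n₁`. The forcing is then the damping acting on the corrector, the Taylor remainder at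
  -- the midpoint, and the source mismatch at the stage.
  have h := sum_weighted_norm_sq_le (S := freqs K) (Λ := Lam L κ)
    (B := 3 * (τ ^ 4 * ((1 + κb) ^ 2 * (2 * (κb ^ 2 * M) + 2 * M)))
        + 3 * ((κb + 1) * M * τ ^ 2) ^ 2
        + 3 * (2 * ((κb + (3 * B ^ 2 + ε)) ^ 2 *
          ∑ k ∈ freqs K, ‖torusCoeff L (U (a + τ / 2)) k - gridCoeff L K g k‖ ^ 2)
        + 2 * spatialError L ε s M B K ^ 2))
    (y := fun k t => torusCoeff L (U (a + t)) k
      - expStep (Lam L κ k) (gridCoeff L K f k) (gridCoeff L K (nonlinK ε κ g) k) t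
      - ((t * (t - τ) / 2 : ℝ) : ℂ) * torusCoeff L n₁ k)
    (r := fun k t => ((-(t * (t - τ) / 2) : ℝ) : ℂ) * ((Lam L κ k : ℂ) * torusCoeff L n₁ k)
      + torusCoeff L (sourceC ε κ (U (a + t)) - sourceC ε κ (U m) - (a + t - m) • n₁) k
      + (torusCoeff L (sourceC ε κ (U m)) k - gridCoeff L K (nonlinK ε κ g) k))
    (Lam_pos hκ) hτ.le (fun k _ t ht => by
      have h1 := (hasDerivAt_coeff_comp (D.deriv_U (a + t)) k).scomp t
        ((hasDerivAt_id t).const_add a)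
      rw [one_smul] at h1
      have h2 := h1.sub (hasDerivAt_expStep (Lam_pos (L := L) hκ k).ne' (gridCoeff L K f k)
        (gridCoeff L K (nonlinK ε κ g) k) t)
      have h3 : HasDerivAt (fun t : ℝ => t * (t - τ) / 2) (t - τ / 2) t := by
        have h4 := ((hasDerivAt_id t).mul ((hasDerivAt_id t).sub_const τ)).div_const 2
        refine h4.congr_deriv ?_
        simp only [id]
        ring
      refine (h2.sub (h3.ofReal_comp.mul_const (torusCoeff L n₁ k))).congr_deriv ?_
      rw [D.torusCoeff_G₁ κ k (hsub (hIcc t ht)), torusCoeff_sub, torusCoeff_sub, torusCoeff_smul,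
        hm]
      push_cast
      ring) (fun t ht => ?_)
  · simp only [add_zero, expStep_zero, sub_self, mul_zero, zero_mul, zero_div, Complex.ofReal_zero,
      sub_zero] at h
    rw [kappaSq_projectToGrid_sub, kappaSq_projectToGrid_sub]
    refine le_trans (le_of_eq ?_) h
    exact Finset.sum_congr rfl fun k hk => by
      rw [gridCoeff_phi0Op_add_phi1Op hL.out.ne' hκ τ _ _ hk]
  · have h1 := sum_norm_torusCoeff_sq_le
      (sourceC ε κ (U (a + t)) - sourceC ε κ (U m) - (a + t - m) • n₁) (freqs K)
    have h2 : ‖sourceC ε κ (U (a + t)) - sourceC ε κ (U m) - (a + t - m) • n₁‖ ^ 2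
        ≤ ((κb + 1) * M * τ ^ 2) ^ 2 :=
      pow_le_pow_left₀ (norm_nonneg _)
        (D.norm_sourceC_taylor_le hκ0 hκb ha haT hmI (hIcc t ht)) 2
    have h3 := D.sum_norm_source_sub_le hε hs hκ0 hκb (hsub hmI) g hg hw hM
    have h4 := D.sum_Lam_sq_norm_sourceC₁_le hκ0 hκb (hsub hmI) (freqs K)
    have h5 : (-(t * (t - τ) / 2)) ^ 2 ≤ τ ^ 4 := by
      have h6 : 0 ≤ t * (τ - t) := mul_nonneg ht.1 (by linarith [ht.2])
      have h7 : t * (τ - t) ≤ τ ^ 2 := by nlinarith [ht.1, ht.2]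
      calc (-(t * (t - τ) / 2)) ^ 2 = (t * (τ - t)) ^ 2 / 4 := by ring
        _ ≤ (τ ^ 2) ^ 2 / 1 := by
            have := pow_le_pow_left₀ h6 h7 2
            have := sq_nonneg (t * (τ - t))
            linarith
        _ = τ ^ 4 := by ring
    have h8 : ∑ k ∈ freqs K, ‖((-(t * (t - τ) / 2) : ℝ) : ℂ) *
        ((Lam L κ k : ℂ) * torusCoeff L n₁ k)‖ ^ 2
        ≤ τ ^ 4 * ((1 + κb) ^ 2 * (2 * (κb ^ 2 * M) + 2 * M)) := by
      refine le_trans (le_of_eq ?_) (mul_le_mul h5 h4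
        (Finset.sum_nonneg fun _ _ => sq_nonneg _) (by positivity))
      rw [Finset.mul_sum]
      refine Finset.sum_congr rfl fun k _ => ?_
      rw [norm_mul, mul_pow, Complex.norm_real, Real.norm_eq_abs, sq_abs]
    refine (Finset.sum_le_sum fun k _ => norm_add_add_sq_le_three _ _ _).trans ?_
    rw [Finset.sum_add_distrib, Finset.sum_add_distrib, ← Finset.mul_sum, ← Finset.mul_sum,
      ← Finset.mul_sum]
    linarith

end Consistency

/-! ### Bootstrap, error recursion and uniform bound on the stabilization parameter. -/

section Convergence

variable {L : ℝ} [hL : Fact (0 < L)] {T ε s M κb Chat : ℝ} {U G₁ G₂ : ℝ → C(Torus L, ℝ)}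

lemma kappaSq_projectToGrid_le {κ : ℝ} {K : ℕ} (hκ : 0 ≤ κ) (hκb : κ ≤ κb) (hs : 2 ≤ s)
    {f : C(Torus L, ℝ)} (hf : SobBound L s (torusCoeff L f) M) :
    kappaSq L κ K (projectToGrid L K f) ≤ (1 + κb) * M := by
  have h1 := hf.mono_exp hs (freqs K)
  have hκb0 : 0 ≤ κb := hκ.trans hκb
  calc kappaSq L κ K (projectToGrid L K f)
      ≤ ∑ k ∈ freqs K, (1 + κb) * (wt L k ^ (2 : ℝ) * ‖torusCoeff L f k‖ ^ 2) := by
        refine Finset.sum_le_sum fun k hk => ?_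
        rw [gridCoeff_projectToGrid _ hk, ← mul_assoc, Real.rpow_two]
        exact mul_le_mul_of_nonneg_right (Lam_le_wt_sq hκ hκb k) (sq_nonneg _)
    _ = (1 + κb) * ∑ k ∈ freqs K, wt L k ^ (2 : ℝ) * ‖torusCoeff L f k‖ ^ 2 := by
        rw [Finset.mul_sum]
    _ ≤ _ := by gcongr

lemma abs_nonlinK_le {κ B z : ℝ} (hε : 0 ≤ ε) (hκ : 0 ≤ κ) (hκb : κ ≤ κb) (hz : |z| ≤ B) :
    |κ * z - nonlin ε z| ≤ (κb + (B ^ 2 + ε)) * B := by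
  have hB : 0 ≤ B := (abs_nonneg z).trans hz
  have hz2 : z ^ 2 ≤ B ^ 2 := sq_le_sq' (by linarith [neg_le_of_abs_le hz]) (le_of_abs_le hz)
  have h : κ * z - nonlin ε z = (κ - z ^ 2 + ε) * z := by unfold nonlin; ring
  rw [h, abs_mul]
  refine mul_le_mul ?_ hz (abs_nonneg _) (by nlinarith [sq_nonneg B])
  rw [abs_le]
  constructor <;> nlinarith [sq_nonneg z]

/-- Uniform bounds for numerical solutions whose error is at most one. -/
lemma ExactData.exists_sup_bound (D : ExactData L T ε s M U G₁ G₂) (hε : 0 ≤ ε) (hs : 2 ≤ s)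
    (hC : IsDiscreteSobolevConst L Chat) (κb : ℝ) :
    ∃ B, M ≤ B ∧ (∀ (K : ℕ), ∀ t ∈ Icc 0 T, ∀ p, |projectToGrid L K (U t) p| ≤ B) ∧
      ∀ (K : ℕ) (κ τ : ℝ) (f : Grid K), 1 ≤ κ → κ ≤ κb → 0 ≤ τ → τ ≤ 1 → ∀ t ∈ Icc 0 T,
        kappaSq L κ K (projectToGrid L K (U t) - f) ≤ 1 →
        (∀ p, |f p| ≤ B) ∧ ∀ p, |erkStage L ε κ τ K f p| ≤ B := by
  -- `W` bounds `kappaSq` of a grid function within distance one of the projected solution, and `B₁`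
  -- its maximum. `Q` bounds the resulting source, and `B₂` the stage, by stability of the half
  -- step.
  set W := 2 * ((1 + κb) * M) + 2 with hW
  set B₁ := 3 * |Chat| * L * Real.sqrt W with hB₁
  set Q := (κb + (B₁ ^ 2 + ε)) * B₁ with hQ
  set B₂ := 3 * |Chat| * L * Real.sqrt (W + Q ^ 2) with hB₂
  have hLpos := hL.out
  refine ⟨max M (max (Real.sqrt (M * wtSum L)) (max B₁ B₂)), le_max_left _ _, ?_, ?_⟩
  · intro K t ht p
    exact (abs_projectToGrid_le hs (D.sob_U t ht) p).trans
      ((le_max_left _ _).trans (le_max_right _ _))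
  · intro K κ τ f hκ hκb hτ hτ1 t ht hf
    have hκ0 : 0 ≤ κ := zero_le_one.trans hκ
    have hfW : kappaSq L κ K f ≤ W := by
      have h1 := kappaSq_sub_le (L := L) (K := K) hκ (projectToGrid L K (U t))
        (projectToGrid L K (U t) - f)
      rw [sub_sub_cancel] at h1
      have h2 := kappaSq_projectToGrid_le (K := K) hκ0 hκb hs (D.sob_U t ht)
      linarith
    have hfB : ∀ p, |f p| ≤ B₁ := fun p =>
      (hC.abs_le hLpos hκ f p).trans
        (mul_le_mul_of_nonneg_left (Real.sqrt_le_sqrt hfW) (by positivity))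
    have hN : ∑ k ∈ freqs K, ‖gridCoeff L K (nonlinK ε κ f) k‖ ^ 2 ≤ Q ^ 2 :=
      sum_norm_gridCoeff_sq_le_of_le hLpos.ne' fun p => abs_nonlinK_le hε hκ0 hκb (hfB p)
    have hstage : kappaSq L κ K (erkStage L ε κ τ K f) ≤ W + Q ^ 2 := by
      have h1 := kappaSq_phi0Op_add_phi1Op_le (L := L) hLpos.ne' hκ (s := τ / 2) (by linarith) f
        (nonlinK ε κ f)
      have h2 : τ / 2 * ∑ k ∈ freqs K, ‖gridCoeff L K (nonlinK ε κ f) k‖ ^ 2 ≤ 1 * Q ^ 2 :=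
        mul_le_mul (by linarith) hN (Finset.sum_nonneg fun _ _ => sq_nonneg _) zero_le_one
      unfold erkStage
      linarith
    refine ⟨fun p => (hfB p).trans ?_, fun p => ((hC.abs_le hLpos hκ _ p).trans
      (mul_le_mul_of_nonneg_left (Real.sqrt_le_sqrt hstage) (by positivity))).trans ?_⟩
    · exact (le_max_left _ _).trans ((le_max_right _ _).trans (le_max_right _ _))
    · exact (le_max_right _ _).trans ((le_max_right _ _).trans (le_max_right _ _))

/-- The arithmetic of the error recursion. -/
lemma step_arith {E E' S X Q P l σ₀ η τ : ℝ} (hE0 : 0 ≤ E) (hE : E ≤ E') (hQ0 : 0 ≤ Q)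
    (hτ : 0 < τ) (hτ1 : τ ≤ 1) (hη0 : 0 ≤ η)
    (h1 : S ≤ 3 * (E + (τ / 2) ^ 2 * (2 * (P * (τ / 2)) ^ 2
      + 2 * (2 * (l ^ 2 * E) + 2 * (σ₀ * η) ^ 2))))
    (h2 : X ≤ E' + τ * (3 * (τ ^ 4 * Q) + 3 * (P * τ ^ 2) ^ 2
      + 3 * (2 * (l ^ 2 * S) + 2 * (σ₀ * η) ^ 2))) :
    X ≤ E' + τ * ((3 * Q + 3 * P ^ 2 + 6 * l ^ 2 * (P ^ 2 + 3 * σ₀ ^ 2) + 6 * σ₀ ^ 2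
      + 6 * l ^ 2 * (3 + 3 * l ^ 2) + 1) * (E' + (τ ^ 2 + η) ^ 2)) := by
  set ρ := τ ^ 2 + η with hρ
  have hτ2 : τ ^ 2 ≤ 1 := pow_le_one₀ hτ.le hτ1
  have hτ4 : τ ^ 4 ≤ ρ ^ 2 := by
    have : τ ^ 4 = (τ ^ 2) ^ 2 := by ring
    rw [this]
    exact pow_le_pow_left₀ (sq_nonneg _) (by linarith) 2
  have hη2 : η ^ 2 ≤ ρ ^ 2 := pow_le_pow_left₀ hη0 (by linarith [sq_nonneg τ]) 2
  -- The prefactor `τ²` of the stage estimate turns its `O(τ²)` source variation into `τ⁴ ≤ ρ²`.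
  have hS : S ≤ (3 + 3 * l ^ 2) * E' + (P ^ 2 + 3 * σ₀ ^ 2) * ρ ^ 2 := by
    have i1 : (τ / 2) ^ 2 * (2 * (2 * (l ^ 2 * E) + 2 * (σ₀ * η) ^ 2))
        ≤ l ^ 2 * E + σ₀ ^ 2 * η ^ 2 := by
      have : 0 ≤ l ^ 2 * E + σ₀ ^ 2 * η ^ 2 := by positivity
      calc _ = τ ^ 2 * (l ^ 2 * E + σ₀ ^ 2 * η ^ 2) := by ring
        _ ≤ 1 * (l ^ 2 * E + σ₀ ^ 2 * η ^ 2) := by gcongr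
        _ = _ := one_mul _
    have i2 : (τ / 2) ^ 2 * (2 * (P * (τ / 2)) ^ 2) = P ^ 2 * τ ^ 4 / 8 := by ring
    have i3 : P ^ 2 * τ ^ 4 ≤ P ^ 2 * ρ ^ 2 := by gcongr
    have i4 : σ₀ ^ 2 * η ^ 2 ≤ σ₀ ^ 2 * ρ ^ 2 := by gcongr
    have i5 : l ^ 2 * E ≤ l ^ 2 * E' := by gcongr
    have i6 : 0 ≤ P ^ 2 * ρ ^ 2 := by positivity
    have i7 : S ≤ 3 * (E + ((τ / 2) ^ 2 * (2 * (P * (τ / 2)) ^ 2)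
        + (τ / 2) ^ 2 * (2 * (2 * (l ^ 2 * E) + 2 * (σ₀ * η) ^ 2)))) := by
      rw [← mul_add]; exact h1
    linarith
  refine h2.trans ?_
  gcongr
  have j1 : τ ^ 4 * Q ≤ ρ ^ 2 * Q := by gcongr
  have j2 : (P * τ ^ 2) ^ 2 ≤ P ^ 2 * ρ ^ 2 := by
    calc (P * τ ^ 2) ^ 2 = P ^ 2 * τ ^ 4 := by ring
      _ ≤ _ := by gcongr
  have j3 : l ^ 2 * S ≤ l ^ 2 * ((3 + 3 * l ^ 2) * E' + (P ^ 2 + 3 * σ₀ ^ 2) * ρ ^ 2) := by gcongr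
  have j4 : (σ₀ * η) ^ 2 ≤ σ₀ ^ 2 * ρ ^ 2 := by
    rw [mul_pow]; gcongr
  have hE' : 0 ≤ E' := hE0.trans hE
  have j5 : 0 ≤ (3 * Q + 3 * P ^ 2 + 6 * l ^ 2 * (P ^ 2 + 3 * σ₀ ^ 2) + 6 * σ₀ ^ 2) * E' := by
    positivity
  have j6 : 0 ≤ (6 * l ^ 2 * (3 + 3 * l ^ 2)) * ρ ^ 2 := by positivity
  have j7 : 0 ≤ E' + ρ ^ 2 := by positivity
  linarith

/-- The error recursion of the scheme. -/
lemma ExactData.exists_step_bound (D : ExactData L T ε s M U G₁ G₂) (hε : 0 ≤ ε) (hs : 2 ≤ s)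
    (hC : IsDiscreteSobolevConst L Chat) (κb : ℝ) (hM : 0 ≤ M) :
    ∃ C, 0 < C ∧ ∀ (K : ℕ) (κ τ a : ℝ) (f : Grid K), 1 ≤ κ → κ ≤ κb → 0 < τ → τ ≤ 1 → 0 ≤ a →
      a + τ ≤ T → kappaSq L κ K (projectToGrid L K (U a) - f) ≤ 1 →
      kappaSq L κ K (projectToGrid L K (U (a + τ)) - erkStep L ε κ τ K f)
        ≤ kappaSq L κ K (projectToGrid L K (U a) - f)
          + τ * (C * (kappaSq L κ K (projectToGrid L K (U a) - f)
            + (τ ^ 2 + meshSize L K ^ (s - 2)) ^ 2)) := by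
  obtain ⟨B, hMB, hw, hB⟩ := D.exists_sup_bound hε hs hC κb
  set l := κb + (3 * B ^ 2 + ε) with hl
  set P := (κb + 1) * M with hP
  set Q := (1 + κb) ^ 2 * (2 * (κb ^ 2 * M) + 2 * M) with hQ
  set σ₀ := (1 + (3 * B ^ 2 + ε)) * Real.sqrt (M * wtSum L) with hσ₀
  have hQ0 : 0 ≤ Q := by positivity
  refine ⟨3 * Q + 3 * P ^ 2 + 6 * l ^ 2 * (P ^ 2 + 3 * σ₀ ^ 2) + 6 * σ₀ ^ 2
    + 6 * l ^ 2 * (3 + 3 * l ^ 2) + 1, by positivity, ?_⟩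
  intro K κ τ a f hκ hκb hτ hτ1 ha haT hf
  have hLpos := hL.out
  have haI : a ∈ Icc 0 T := ⟨ha, by linarith⟩
  have hmI : a + τ / 2 ∈ Icc 0 T := ⟨by linarith, by linarith⟩
  obtain ⟨hfB, hgB⟩ := hB K κ τ f hκ hκb hτ.le hτ1 a haI hf
  -- The stage is by definition an exponential Euler step of length `τ/2`.
  have h1 := D.sum_norm_stage_sub_le hε hs hκ hκb ha (half_pos hτ) (by linarith) f hfB
    (hw K a haI) hMB
  have h2 := D.kappaSq_step_sub_le hε hs hκ hκb ha hτ haT f (erkStage L ε κ τ K f) hgB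
    (hw K _ hmI) hMB
  set η := meshSize L K ^ (s - 2) with hη
  have hη0 : 0 ≤ η := Real.rpow_nonneg (by unfold meshSize; positivity) _
  have hσ : spatialError L ε s M B K = σ₀ * η := by
    rw [spatialError, hσ₀, mul_assoc]
  have hE : ∑ k ∈ freqs K, ‖torusCoeff L (U a) k - gridCoeff L K f k‖ ^ 2
      ≤ kappaSq L κ K (projectToGrid L K (U a) - f) := by
    refine le_trans (le_of_eq ?_) (sum_norm_gridCoeff_sq_le_kappaSq hκ _)
    exact Finset.sum_congr rfl fun k hk => by rw [gridCoeff_sub, gridCoeff_projectToGrid _ hk]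
  have hE0 : 0 ≤ ∑ k ∈ freqs K, ‖torusCoeff L (U a) k - gridCoeff L K f k‖ ^ 2 :=
    Finset.sum_nonneg fun _ _ => sq_nonneg _
  rw [hσ] at h1 h2
  exact step_arith hE0 hE hQ0 hτ hτ1 hη0 h1 h2

/-- Discrete Gronwall inequality for an error recursion that holds as long as the error is at most
one. -/
lemma discrete_gronwall {E : ℕ → ℝ} {C T τ ρ : ℝ} {N : ℕ} (hC : 0 ≤ C) (hτ : 0 ≤ τ)
    (hN : N * τ ≤ T) (h0 : E 0 = 0)
    (hstep : ∀ n < N, E n ≤ 1 → E (n + 1) ≤ E n + τ * (C * (E n + ρ ^ 2)))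
    (hsmall : Real.exp (C * T) * (T * C * ρ ^ 2) ≤ 1) :
    ∀ n ≤ N, E n ≤ Real.exp (C * T) * (T * C * ρ ^ 2) := by
  have hmono : ∀ n : ℕ, n ≤ N →
      Real.exp (C * (n * τ)) * (n * τ * C * ρ ^ 2) ≤ Real.exp (C * T) * (T * C * ρ ^ 2) := by
    intro n hn
    have : (n : ℝ) * τ ≤ T := le_trans (by gcongr) hN
    gcongr
  -- The induction needs the bound with `nτ` in place of `T`, since it must improve at each step.
  suffices h : ∀ n ≤ N, E n ≤ Real.exp (C * (n * τ)) * (n * τ * C * ρ ^ 2) from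
    fun n hn => (h n hn).trans (hmono n hn)
  intro n
  induction n with
  | zero => intro _; simp [h0]
  | succ n ih =>
    intro hn
    have h1 := ih (by omega)
    -- Bootstrap: the bound already proved, together with the smallness of `ρ`, gives `E n ≤ 1`,
    -- which licenses the next step.
    have h2 := hstep n (by omega) (h1.trans ((hmono n (by omega)).trans hsmall))
    have h3 : 1 + C * τ ≤ Real.exp (C * τ) := by linarith [Real.add_one_le_exp (C * τ)]
    have h4 : Real.exp (C * ((n + 1 : ℕ) * τ)) = Real.exp (C * τ) * Real.exp (C * (n * τ)) := by
      rw [← Real.exp_add]; congr 1; push_cast; ring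
    have h5 : 1 ≤ Real.exp (C * τ) * Real.exp (C * (n * τ)) := by
      rw [← h4]
      exact Real.one_le_exp (by positivity)
    calc E (n + 1) ≤ (1 + C * τ) * E n + τ * C * ρ ^ 2 := by linarith
      _ ≤ Real.exp (C * τ) * (Real.exp (C * (n * τ)) * (n * τ * C * ρ ^ 2))
          + (Real.exp (C * τ) * Real.exp (C * (n * τ))) * (τ * C * ρ ^ 2) := by
          refine add_le_add ?_ (le_mul_of_one_le_left (by positivity) h5)
          calc (1 + C * τ) * E n
              ≤ (1 + C * τ) * (Real.exp (C * (n * τ)) * (n * τ * C * ρ ^ 2)) := by gcongr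
            _ ≤ _ := by gcongr
      _ = _ := by rw [h4]; push_cast; ring

/-- The stabilization parameter is bounded uniformly in the grid. -/
lemma exists_kappa_bound (hε : 0 ≤ ε) (hs : 2 ≤ s) {f : C(Torus L, ℝ)}
    (hf : SobBound L s (torusCoeff L f) M) :
    ∃ κb, ∀ K : ℕ, kappa L ε Chat K (projectToGrid L K f) ≤ κb := by
  have hLpos := hL.out
  set A := Real.sqrt (M * wtSum L) with hA
  set Eb := 1 / 2 * (L ^ 2 * M) + L ^ 2 * (A ^ 4 / 4) with hEb
  set Sb := 2 * Real.sqrt 3 * |Chat| * (2 * Real.sqrt (Eb + L ^ 2)) with hSb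
  refine ⟨max ((3 * Sb ^ 2 + ε) / 2) 1, fun K => ?_⟩
  set w := projectToGrid L K f with hw
  have hE : gridEnergy L ε K w ≤ Eb := by
    have h1 : gridNorm L K (gridLaplacian L K w + w) ^ 2 ≤ L ^ 2 * M := by
      rw [gridNorm_sq hLpos.ne']
      refine mul_le_mul_of_nonneg_left ?_ (sq_nonneg _)
      refine le_trans (Finset.sum_le_sum fun k hk => ?_) (hf.mono_exp hs (freqs K))
      rw [gridCoeff_add, gridLaplacian, gridCoeff_multiplier hLpos.ne' (fun k => by rw [lam_neg]) w hk,
        hw, gridCoeff_projectToGrid _ hk]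
      have e : ((-lam L k : ℝ) : ℂ) * torusCoeff L f k + torusCoeff L f k
          = ((1 - lam L k : ℝ) : ℂ) * torusCoeff L f k := by push_cast; ring
      rw [e, norm_mul, mul_pow, Complex.norm_real, Real.norm_eq_abs, sq_abs, Real.rpow_two]
      refine mul_le_mul_of_nonneg_right ?_ (sq_nonneg _)
      have := lam_nonneg (L := L) k
      unfold wt; nlinarith
    -- The quadratic term has a favourable sign for `ε ≥ 0` and is dropped; the total grid weight is
    -- `L²`.
    have h2 : gridInner L K (fun p => 1 / 4 * w p ^ 4 - ε / 2 * w p ^ 2) 1 ≤ L ^ 2 * (A ^ 4 / 4) := by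
      unfold gridInner
      calc meshSize L K ^ 2 * ∑ p, (1 / 4 * w p ^ 4 - ε / 2 * w p ^ 2) * (1 : Grid K) p
          ≤ meshSize L K ^ 2 *
            ∑ _p : Fin (2 * K + 1) × Fin (2 * K + 1), A ^ 4 / 4 := by
            refine mul_le_mul_of_nonneg_left (Finset.sum_le_sum fun p _ => ?_) (sq_nonneg _)
            have h3 := abs_projectToGrid_le (K := K) hs hf p
            have h4 : w p ^ 4 ≤ A ^ 4 := by
              rw [← Even.pow_abs (by decide : Even 4) (w p)]
              exact pow_le_pow_left₀ (abs_nonneg _) h3 4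
            have h5 : 0 ≤ ε / 2 * w p ^ 2 := by positivity
            rw [Pi.one_apply, mul_one]
            linarith
        _ = _ := by
            rw [Finset.sum_const, Finset.card_univ, Fintype.card_prod, Fintype.card_fin,
              nsmul_eq_mul, meshSize]
            push_cast
            field_simp
    unfold gridEnergy
    linarith
  -- An upper bound on the energy suffices: `Real.sqrt` is monotone and vanishes on negative
  -- arguments, which is the `max{·, 0}` in `C₀`.
  have hS : |supBound L ε Chat K w| ≤ Sb := by
    unfold supBound
    rw [abs_mul, abs_mul, abs_of_nonneg (by positivity : (0 : ℝ) ≤ 2 * Real.sqrt 3),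
      abs_of_nonneg (by positivity : (0 : ℝ) ≤ 2 * Real.sqrt (gridEnergy L ε K w + L ^ 2))]
    rw [hSb]
    gcongr
  have hS2 : supBound L ε Chat K w ^ 2 ≤ Sb ^ 2 := by
    rw [← sq_abs]; exact pow_le_pow_left₀ (abs_nonneg _) hS 2
  unfold kappa
  refine max_le_max ?_ le_rfl
  have : |3 * supBound L ε Chat K w ^ 2 - ε| ≤ 3 * Sb ^ 2 + ε := by
    rw [abs_le]
    constructor <;> nlinarith [sq_nonneg (supBound L ε Chat K w), sq_nonneg Sb]
  linarith

lemma gridNorm_le_of_sq {K : ℕ} {f : Grid K} {b : ℝ} (hb : 0 ≤ b)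
    (h : ∑ k ∈ freqs K, ‖gridCoeff L K f k‖ ^ 2 ≤ b ^ 2) : gridNorm L K f ≤ L * b := by
  have hLpos := hL.out
  refine le_of_sq_le_sq ?_ (by positivity)
  rw [gridNorm_sq hLpos.ne', mul_pow]
  gcongr

end Convergence

end SwiftHohenberg

/-! ### The convergence theorem. -/

theorem theorem4p1 (L T ε m₀ Chat : ℝ) [Fact (0 < L)] (hT : 0 < T) (hε : 0 < ε) (hm₀ : 0 ≤ m₀)
    (hChat : SwiftHohenberg.IsDiscreteSobolevConst L Chat)
    (uₑ : ℝ → C(SwiftHohenberg.Torus L, ℝ))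
    (hcont : ContinuousOn uₑ (Set.Icc 0 T))
    (hsol : SwiftHohenberg.IsSolution L T ε uₑ)
    (hreg : SwiftHohenberg.RegularityClass L T m₀ uₑ) :
    ∃ C τ₀ h₀ : ℝ, 0 < C ∧ 0 < τ₀ ∧ 0 < h₀ ∧
      ∀ (K Nt : ℕ) (h τ κ : ℝ) (u : ℕ → SwiftHohenberg.Grid K),
        h = SwiftHohenberg.meshSize L K → 0 < Nt → τ = T / Nt → h ≤ h₀ → τ ≤ τ₀ →
        κ = SwiftHohenberg.kappa L ε Chat K (SwiftHohenberg.projectToGrid L K (uₑ 0)) →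
        u = SwiftHohenberg.erkSol L ε κ τ K (SwiftHohenberg.projectToGrid L K (uₑ 0)) →
        ∀ n ≤ Nt,
          SwiftHohenberg.gridNorm L K
              (SwiftHohenberg.restrictToGrid L K (uₑ (n * τ)) - u n)
            ≤ C * (τ ^ 2 + h ^ m₀) := by
  open SwiftHohenberg in
  have hLpos : 0 < L := Fact.out
  obtain ⟨M, U, G₁, G₂, hM, D, huU⟩ := exists_exactData hT hm₀ hcont hsol hreg
  have h0I : (0 : ℝ) ∈ Icc 0 T := ⟨le_rfl, hT.le⟩
  have hs : (2 : ℝ) ≤ m₀ + 4 := by linarith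
  obtain ⟨κb, hκb⟩ := exists_kappa_bound (Chat := Chat) hε.le hs (D.sob_U 0 h0I)
  obtain ⟨C₁, hC₁, hstep⟩ := D.exists_step_bound hε.le hs hChat κb hM.le
  set Γ := Real.exp (C₁ * T) * (T * C₁) with hΓ
  have hΓ0 : 0 < Γ := by positivity
  -- Steps below `δ` give `ρ ≤ 2δ`, so `Γρ² ≤ 4Γδ² ≤ 4Γδ ≤ 1`, which is the smallness that Gronwall
  -- requires.
  set δ := min 1 (1 / (4 * Γ + 4)) with hδ
  have hδ0 : 0 < δ := lt_min one_pos (by positivity)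
  have hδ1 : δ ≤ 1 := min_le_left _ _
  set A := Real.sqrt (M * wtSum L) with hA
  -- `A` accounts for the projection error and `Γ` for the discrete error; the factor `L` converts
  -- coefficients to the grid norm.
  refine ⟨L * Real.sqrt (2 * A ^ 2 + 2 * Γ), δ, δ, by positivity, hδ0, hδ0, ?_⟩
  intro K Nt h τ κ u hh hNt hτ hh₀ hτ₀ hκ hu n hn
  have hNt' : (0 : ℝ) < Nt := by exact_mod_cast hNt
  have hτ0 : 0 < τ := by rw [hτ]; positivity
  have hh0 : 0 < h := by rw [hh, meshSize]; positivity
  have hh1 : h ≤ 1 := hh₀.trans hδ1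
  have hNτ : (Nt : ℝ) * τ = T := by rw [hτ]; field_simp
  have hmem : ∀ j : ℕ, j ≤ Nt → (j : ℝ) * τ ∈ Icc 0 T := fun j hj => by
    refine ⟨by positivity, ?_⟩
    rw [← hNτ]
    gcongr
  have hU0 : projectToGrid L K (uₑ 0) = projectToGrid L K (U 0) := by rw [huU 0 h0I]
  rw [hU0] at hκ hu
  have hκ1 : 1 ≤ κ := by rw [hκ]; exact le_max_right _ _
  have hκb' : κ ≤ κb := by rw [hκ]; exact hκb K
  set ρ := τ ^ 2 + h ^ (m₀ + 2) with hρ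
  have hrpow : (0 : ℝ) ≤ h ^ (m₀ + 2) := Real.rpow_nonneg hh0.le _
  have hρ0 : 0 ≤ ρ := by positivity
  have hρδ : ρ ≤ 2 * δ := by
    have i1 : τ ^ 2 ≤ τ := by nlinarith [hτ₀.trans hδ1]
    have i2 : h ^ (m₀ + 2) ≤ h ^ (1 : ℝ) :=
      Real.rpow_le_rpow_of_exponent_ge hh0 hh1 (by linarith)
    rw [Real.rpow_one] at i2
    linarith
  have hsmall : Real.exp (C₁ * T) * (T * C₁ * ρ ^ 2) ≤ 1 := by
    have i1 : ρ ^ 2 ≤ 4 * δ := by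
      have : ρ ^ 2 ≤ (2 * δ) ^ 2 := by gcongr
      nlinarith
    have i2 : δ ≤ 1 / (4 * Γ + 4) := min_le_right _ _
    calc Real.exp (C₁ * T) * (T * C₁ * ρ ^ 2) = Γ * ρ ^ 2 := by rw [hΓ]; ring
      _ ≤ Γ * (4 * (1 / (4 * Γ + 4))) := by
          gcongr
          linarith
      _ ≤ 1 := by
          rw [mul_one_div, ← mul_div_assoc, div_le_one (by positivity)]
          linarith
  have hgron := discrete_gronwall (N := Nt) (ρ := ρ)
    (E := fun j => kappaSq L κ K (projectToGrid L K (U (j * τ)) - u j)) hC₁.le hτ0.le hNτ.le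
    -- There is no initial error, as `u⁰` is itself the projection.
    (by simp [hu, erkSol, kappaSq, gridCoeff]) (fun j hj hE => by
      have i1 := hstep K κ τ (j * τ) (u j) hκ1 hκb' hτ0 (hτ₀.trans hδ1) (hmem j hj.le).1
        (by
          have := (hmem (j + 1) hj).2
          push_cast at this
          linarith) hE
      have i2 : ((j + 1 : ℕ) : ℝ) * τ = j * τ + τ := by push_cast; ring
      have i3 : u (j + 1) = erkStep L ε κ τ K (u j) := by rw [hu]; rfl
      have i4 : m₀ + 4 - 2 = m₀ + 2 := by ring
      rw [← hh, i4] at i1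
      rw [i2, i3]
      exact i1) hsmall n hn
  have hnI := hmem n hn
  rw [huU _ hnI]
  have hproj : ∑ k ∈ freqs K,
      ‖gridCoeff L K (restrictToGrid L K (U (n * τ)) - projectToGrid L K (U (n * τ))) k‖ ^ 2
      ≤ (A * ρ) ^ 2 := by
    refine sum_norm_gridCoeff_sq_le_of_le hLpos.ne' fun p => ?_
    refine (abs_restrictToGrid_sub_projectToGrid_le hs (D.sob_U _ hnI) p).trans ?_
    have i4 : m₀ + 4 - 2 = m₀ + 2 := by ring
    rw [← hh, i4]
    gcongr
    rw [hρ]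
    linarith [sq_nonneg τ]
  have htotal : ∑ k ∈ freqs K, ‖gridCoeff L K (restrictToGrid L K (U (n * τ)) - u n) k‖ ^ 2
      ≤ (Real.sqrt (2 * A ^ 2 + 2 * Γ) * ρ) ^ 2 := by
    have i1 := sum_norm_gridCoeff_add_sq_le (L := L)
      (restrictToGrid L K (U (n * τ)) - projectToGrid L K (U (n * τ)))
      (projectToGrid L K (U (n * τ)) - u n)
    rw [sub_add_sub_cancel] at i1
    have i2 := (sum_norm_gridCoeff_sq_le_kappaSq (L := L) hκ1
      (projectToGrid L K (U (n * τ)) - u n)).trans hgron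
    have i3 : Real.exp (C₁ * T) * (T * C₁ * ρ ^ 2) = Γ * ρ ^ 2 := by rw [hΓ]; ring
    rw [mul_pow, Real.sq_sqrt (by positivity)]
    nlinarith
  refine (gridNorm_le_of_sq (by positivity) htotal).trans ?_
  rw [← mul_assoc]
  refine mul_le_mul_of_nonneg_left ?_ (by positivity)
  -- The argument yields two orders in `h` more than claimed; they are given up using `h ≤ 1`.
  have hpow : h ^ (m₀ + 2) ≤ h ^ m₀ := Real.rpow_le_rpow_of_exponent_ge hh0 hh1 (by linarith)
  linarith
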